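/- Let $M$ be a smooth (finite-dimensional, Hausdorff, second countable) manifold, let $(A\to M,\rho,[\cdot,\cdot])$ be a Lie algebroid with differential $\mathbf d_A$ on $\Omega^\bullet(A)=\Gamma(\wedge^\bullet A^*)$ and cohomology $H^\bullet(A)$, and let $\underline E=E_0[0]\oplus\dots\oplus E_{n-1}[n-1]$ be a graded vector bundle over $M$, where $E_0,\dots,E_{n-1}$ are smooth real vector bundles of finite rank. Give $\Omega(A,\underline E)_\bullet=\Gamma(\wedge^\bullet A^*\otimes\underline E)$ the total grading, in which $\Omega^p(A,E_i)$ has degree $p+i$. An $n$-representation ($n$-term representation up to homotopy) of $A$ on $\underline E$ is an $\mathbb R$-linear operator $\mathcal D\colon\Omega(A,\underline E)_\bullet\to\Omega(A,\underline E)_{\bullet+1}$ with $\mathcal D^2=0$ and $$\mathcal D(\omega\wedge\eta)=\mathbf d_A\omega\wedge\eta+(-1)^{k}\,\omega\wedge\mathcal D\eta\qquad(\omega\in\Omega^k(A),\ \eta\in\Omega(A,\underline E)_\bullet).$$ For a smooth vector bundle $E\to M$ and $l\ge 1$, the $l$-th $A$-Pontryagin character of $E$ is the class $$\sigma^l_A(E)=\bigl[\operatorname{tr}(R_\nabla^l)\bigr]\in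 H^{2l}(A),$$ where $\nabla\colon\Gamma(A)\times\Gamma(E)\to\Gamma(E)$ is any linear $A$-connection on $E$, $R_\nabla\in\Omega^2(A,\operatorname{End}E)$ is its curvature and $R_\nabla^l\in\Omega^{2l}(A,\operatorname{End}E)$ is the $l$-th power of $R_\nabla$ under the wedge product and composition. (Such connections exist, $\operatorname{tr}(R_\nabla^l)$ is $\mathbf d_A$-closed, and its class does not depend on $\nabla$.) Theorem. If there exists an $n$-representation of $A$ on $\underline E$, then $$\sum_{i=0}^{n-1}(-1)^i\,\sigma^l_A(E_i)=0\in H^{2l}(A)\qquad\text{for all } l\ge 1.$$ -/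

import Mathlib

open Bundle Manifold ContDiff Topology

set_option linter.unusedSectionVars false

noncomputable section

namespace LieAlgd

section algebra

variable {R L : Type*} [CommRing R] [Algebra ℝ R] [LieRing L] [LieAlgebra ℝ L] [Module R L]
  [LieRingModule L R] [LieRinehartRing R L] [LieRinehartAlgebra ℝ R L]

/-- `k`-forms with values in `N`: alternating `R`-multilinear maps `L × ⋯ × L → N`. For
`R = C^∞(M)`, `L = Γ(A)` and `N = Γ(E)` this is `Ω^k(A, E) = Γ(⋀^k A^* ⊗ E)`. -/
abbrev Form (R L : Type*) [CommRing R] [AddCommGroup L] [Module R L]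
    (k : ℕ) (N : Type*) [AddCommGroup N] [Module R N] : Type _ :=
  L [⋀^Fin k]→ₗ[R] N

section wedge

variable {N N₁ N₂ N₃ : Type*} [AddCommGroup N] [Module R N] [AddCommGroup N₁] [Module R N₁]
  [AddCommGroup N₂] [Module R N₂] [AddCommGroup N₃] [Module R N₃]

/-- The wedge product of forms with values in `N₁` and `N₂`, with respect to a bilinear pairing
`β : N₁ × N₂ → N₃`: the sum over `(k, p)`-shuffles `τ` of
`sign τ • β (θ (a_τ(1), …, a_τ(k))) (η (a_τ(k+1), …, a_τ(k+p)))`. -/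
def wedge (β : N₁ →ₗ[R] N₂ →ₗ[R] N₃) {k p : ℕ} (θ : Form R L k N₁) (η : Form R L p N₂) :
    Form R L (k + p) N₃ :=
  ((TensorProduct.lift β).compAlternatingMap (θ.domCoprod η)).domDomCongr finSumFinEquiv

/-- The exterior product `η ↦ θ ∧ η` with a scalar form `θ`. -/
def wedgeLeft [Module ℝ N] [IsScalarTower ℝ R N] {k : ℕ} (θ : Form R L k R) (p : ℕ) :
    Form R L p N →ₗ[ℝ] Form R L (k + p) N where
  toFun η := wedge (LinearMap.lsmul R N) θ η
  map_add' η η' := by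
    have h : θ.domCoprod (η + η') = θ.domCoprod η + θ.domCoprod η' := by
      rw [← AlternatingMap.domCoprod'_apply, TensorProduct.tmul_add, map_add]; rfl
    ext v
    simp [wedge, h]
  map_smul' c η := by
    have h : θ.domCoprod ((algebraMap ℝ R c) • η) = (algebraMap ℝ R c) • θ.domCoprod η := by
      rw [← AlternatingMap.domCoprod'_apply, TensorProduct.tmul_smul, map_smul]; rfl
    have h' : c • η = (algebraMap ℝ R c) • η := by ext v; simp
    ext v
    rw [h', wedge, h]
    simp [wedge]

end wedge

section differential

variable {k : ℕ}

/-- The Koszul formula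
`∑_j (-1)^j ρ(a_j)(θ(…, â_j, …)) + ∑_{i<j} (-1)^(i+j) θ([a_i, a_j], …, â_i, …, â_j, …)`.
In the second sum, `[a_i, a_j]` is moved from the first place to the place of `a_i`, which
turns the sign `(-1)^(i+j)` into `(-1)^j`. Here `⁅a, f⁆` is the derivative `ρ(a)(f)`. -/
def koszul (θ : Form R L k R) (v : Fin (k + 1) → L) : R :=
  ∑ j : Fin (k + 1), (-1) ^ (j : ℕ) • (⁅v j, θ (j.removeNth v)⁆ +
    ∑ i with i < j, θ (j.removeNth (Function.update v i ⁅v i, v j⁆)))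

/-- The derivation `f ↦ ρ(a)(f)`. -/
def actL (a : L) : R →ₗ[ℝ] R := LieModule.toEnd ℝ L R a
@[simp] lemma actL_apply (a : L) (f : R) : actL a f = ⁅a, f⁆ := rfl

lemma lie_smul_left (f : R) (a b : L) : ⁅f • a, b⁆ = f • ⁅a, b⁆ - ⁅b, f⁆ • a := by
  rw [← lie_skew, LieRinehartRing.leibniz_smul_right, ← lie_skew a b, smul_neg]
  abel


/-- A form, viewed as an alternating `ℝ`-multilinear map. -/
def realForm (θ : Form R L k R) : L [⋀^Fin k]→ₗ[ℝ] R :=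
  { θ.toMultilinearMap.restrictScalars ℝ with
    map_eq_zero_of_eq' := θ.map_eq_zero_of_eq' }

@[simp] lemma realForm_apply (θ : Form R L k R) (v : Fin k → L) : realForm θ v = θ v := rfl

/-- The first sum of the Koszul formula. -/
def dOne (θ : Form R L k R) : L [⋀^Fin (k + 1)]→ₗ[ℝ] R :=
  AlternatingMap.alternatizeUncurryFin
    { toFun := fun a => (actL (R := R) a).compAlternatingMap (realForm θ)
      map_add' := fun a b => by ext v; simp
      map_smul' := fun c a => by ext v; simp }

/-- Auxiliary map: `v ↦ ∑_i θ(…, [a, v_i], …)`, as a multilinear map. -/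
def derSumAux (θ : Form R L k R) (a : L) : MultilinearMap ℝ (fun _ : Fin k => L) R :=
  ∑ i : Fin k, (realForm θ).toMultilinearMap.compLinearMap
        (Function.update (fun _ => LinearMap.id) i (LieAlgebra.ad ℝ L a : L →ₗ[ℝ] L))

lemma derSumAux_apply (θ : Form R L k R) (a : L) (v : Fin k → L) :
    derSumAux θ a v = ∑ i, θ (Function.update v i ⁅a, v i⁆) := by
  simp only [derSumAux, sum_apply, MultilinearMap.compLinearMap_apply]
  refine Finset.sum_congr rfl fun i _ => ?_
  change θ _ = θ _
  congr 1
  ext j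
  by_cases h : j = i
  · subst h; simp
  · simp [h]

/-- Auxiliary map: `v ↦ ∑_i θ(…, [a, v_i], …)`, as an alternating map. -/
def derSum (θ : Form R L k R) (a : L) : L [⋀^Fin k]→ₗ[ℝ] R :=
  { derSumAux θ a with
    map_eq_zero_of_eq' := by
      intro v i j hv hij
      change derSumAux θ a v = 0
      rw [derSumAux_apply, Fintype.sum_eq_add i j hij]
      · have := θ.map_swap (Function.update v i ⁅a, v i⁆) hij
        have h2 : Function.update v i ⁅a, v i⁆ ∘ Equiv.swap i j = Function.update v j ⁅a, v j⁆ := by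
          ext m
          by_cases h1 : m = i
          · subst h1; simp [hij, hij.symm, hv]
          by_cases h2 : m = j
          · subst h2; simp [hv]
          · simp [h1, h2, Equiv.swap_apply_of_ne_of_ne h1 h2]
        rw [h2] at this
        rw [this]; simp
      · rintro m ⟨h1, h2⟩
        apply θ.map_eq_zero_of_eq _ _ hij
        simp [h1.symm, h2.symm, hv] }

lemma derSum_apply (θ : Form R L k R) (a : L) (v : Fin k → L) :
    derSum θ a v = ∑ i, θ (Function.update v i ⁅a, v i⁆) := derSumAux_apply θ a v

/-- Auxiliary map: minus twice the second sum of the Koszul formula. -/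
def dTwo (θ : Form R L k R) : L [⋀^Fin (k + 1)]→ₗ[ℝ] R :=
  AlternatingMap.alternatizeUncurryFin
    { toFun := fun a => derSum θ a
      map_add' := fun a b => by
        ext v
        simp [derSum_apply, Finset.sum_add_distrib]
      map_smul' := fun c a => by
        ext v
        have : ∀ x : L, c • x = (algebraMap ℝ R c) • x := by simp
        rw [RingHom.id_apply, AlternatingMap.smul_apply, derSum_apply, derSum_apply,
          Finset.smul_sum]
        refine Finset.sum_congr rfl fun i _ => ?_
        rw [smul_lie, this, AlternatingMap.map_update_smul, algebraMap_smul] }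

lemma dOne_apply (θ : Form R L k R) (v : Fin (k + 1) → L) :
    dOne θ v = ∑ j : Fin (k + 1), (-1) ^ (j : ℕ) • ⁅v j, θ (j.removeNth v)⁆ := by
  simp [dOne, AlternatingMap.alternatizeUncurryFin_apply]

lemma dTwo_apply (θ : Form R L k R) (v : Fin (k + 1) → L) :
    dTwo θ v = ∑ j : Fin (k + 1), (-1) ^ (j : ℕ) •
      ∑ i : Fin k, θ (Function.update (j.removeNth v) i ⁅v j, v (j.succAbove i)⁆) := by
  simp [dTwo, AlternatingMap.alternatizeUncurryFin_apply, derSum_apply, Fin.removeNth]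


lemma removeNth_update_self {α : Type*} (j : Fin (k + 1)) (v : Fin (k + 1) → α) (x : α) :
    j.removeNth (Function.update v j x) = j.removeNth v := by
  ext m; simp [Fin.removeNth, Fin.succAbove_ne]

lemma removeNth_update_succAbove {α : Type*} (j : Fin (k + 1)) (i : Fin k)
    (v : Fin (k + 1) → α) (x : α) :
    j.removeNth (Function.update v (j.succAbove i) x) =
      Function.update (j.removeNth v) i x := by
  ext m
  by_cases h : m = i
  · subst h; simp [Fin.removeNth]
  · simp [Fin.removeNth, h, Fin.succAbove_right_injective.eq_iff]


lemma two_smul_koszul (θ : Form R L k R) (v : Fin (k + 1) → L) :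
    (2 : ℝ) • koszul θ v = (2 : ℝ) • dOne θ v - dTwo θ v := by
  set B : Fin (k + 1) → Fin (k + 1) → R := fun j i =>
    (-1) ^ (j : ℕ) • θ (j.removeNth (Function.update v i ⁅v i, v j⁆)) with hB
  have hsymm : ∀ i j, i ≠ j → B i j = B j i := by
    intro i j hij
    let w := Function.update (Function.update v i ⁅v i, v j⁆) j ⁅v i, v j⁆
    have h := θ.neg_one_pow_smul_map_removeNth_add_eq_zero_of_eq
      (v := w) (i := i) (j := j) (by simp [w, hij]) hij
    have h1 : j.removeNth w = j.removeNth (Function.update v i ⁅v i, v j⁆) :=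
      removeNth_update_self _ _ _
    have h2 : i.removeNth w = i.removeNth (Function.update v j ⁅v i, v j⁆) := by
      simp only [w]
      rw [Function.update_comm hij, removeNth_update_self]
    obtain ⟨m, rfl⟩ := Fin.exists_succAbove_eq hij.symm
    rw [h1, h2, removeNth_update_succAbove] at h
    simp only [hB]
    rw [← lie_skew (v (i.succAbove m)) (v i), removeNth_update_succAbove, AlternatingMap.map_update_neg, smul_neg]
    rw [neg_eq_iff_add_eq_zero]
    exact h
  have hk : koszul θ v = dOne θ v + ∑ j, ∑ i with i < j, B j i := by
    simp only [koszul, dOne_apply, smul_add, Finset.sum_add_distrib, hB, Finset.smul_sum]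
  have hd : dTwo θ v = - ∑ j, ∑ i with i ≠ j, B j i := by
    rw [dTwo_apply, ← Finset.sum_neg_distrib]
    refine Finset.sum_congr rfl fun j _ => ?_
    have : Finset.univ.filter (fun i => i ≠ j) = Finset.univ.map j.succAboveEmb := by
      ext i; simp [Fin.exists_succAbove_eq_iff]
    rw [this, Finset.sum_map, Finset.smul_sum, ← Finset.sum_neg_distrib]
    refine Finset.sum_congr rfl fun i _ => ?_
    simp only [hB, Fin.coe_succAboveEmb]
    rw [removeNth_update_succAbove, ← lie_skew, AlternatingMap.map_update_neg, smul_neg]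
  have hsplit : ∑ j, ∑ i with i ≠ j, B j i =
      (∑ j, ∑ i with i < j, B j i) + ∑ j, ∑ i with i < j, B j i := by
    have e1 : ∀ j : Fin (k + 1), ∑ i with i ≠ j, B j i =
        (∑ i with i < j, B j i) + ∑ i with j < i, B j i := by
      intro j
      rw [← Finset.sum_union]
      · refine Finset.sum_congr ?_ fun _ _ => rfl
        ext i; simp [lt_or_lt_iff_ne]
      · rw [Finset.disjoint_filter]
        intro i _ h; exact not_lt.mpr h.le
    simp only [e1, Finset.sum_add_distrib]
    congr 1
    simp only [Finset.sum_filter]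
    rw [Finset.sum_comm]
    refine Finset.sum_congr rfl fun i _ => Finset.sum_congr rfl fun j _ => ?_
    split_ifs with h
    · exact hsymm _ _ h.ne
    · rfl
  rw [hk, hd, hsplit, smul_add, two_smul ℝ (∑ j, ∑ i with i < j, B j i)]
  abel

lemma derSum_update_smul (θ : Form R L k R) (a : L) (u : Fin k → L) (i : Fin k) (f : R) (x : L) :
    derSum θ a (Function.update u i (f • x)) =
      f • derSum θ a (Function.update u i x) + ⁅a, f⁆ * θ (Function.update u i x) := by
  have key : ∀ m, θ (Function.update (Function.update u i (f • x)) m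
      ⁅a, Function.update u i (f • x) m⁆) =
      f • θ (Function.update (Function.update u i x) m ⁅a, Function.update u i x m⁆) +
        if m = i then ⁅a, f⁆ * θ (Function.update u i x) else 0 := by
    intro m
    by_cases h : m = i
    · subst h
      simp
    · simp only [h, if_false, add_zero, ne_eq, not_false_eq_true, Function.update_of_ne]
      rw [Function.update_comm (Ne.symm h), AlternatingMap.map_update_smul,
        Function.update_comm (Ne.symm h)]
  simp only [derSum_apply, key, Finset.sum_add_distrib, Finset.smul_sum]
  simp

lemma removeNth_succ_update_zero (j : Fin k) (v : Fin (k + 1) → L) (f : R)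
    (θ : Form R L k R) :
    θ (j.succ.removeNth (Function.update v 0 (f • v 0))) = f • θ (j.succ.removeNth v) := by
  cases k with
  | zero => exact j.elim0
  | succ k =>
    have h : (0 : Fin (k + 2)) = j.succ.succAbove 0 := by simp
    conv_lhs => rw [h, removeNth_update_succAbove, AlternatingMap.map_update_smul, ← removeNth_update_succAbove]
    simp

lemma dOne_smul (θ : Form R L k R) (v : Fin (k + 1) → L) (f : R) :
    dOne θ (Function.update v 0 (f • v 0)) = f • dOne θ v +
      ∑ j : Fin k, (-1) ^ (j + 1 : ℕ) • (⁅v j.succ, f⁆ * θ (j.succ.removeNth v)) := by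
  rw [dOne_apply, dOne_apply, Fin.sum_univ_succ, Fin.sum_univ_succ]
  simp only [removeNth_succ_update_zero, removeNth_update_self]
  simp [Finset.sum_add_distrib, Finset.mul_sum, mul_add, add_assoc, mul_left_comm]

lemma dTwo_smul (θ : Form R L k R) (v : Fin (k + 1) → L) (f : R) :
    dTwo θ (Function.update v 0 (f • v 0)) = f • dTwo θ v +
      (2 : ℝ) • ∑ j : Fin k, (-1) ^ (j + 1 : ℕ) • (⁅v j.succ, f⁆ * θ (j.succ.removeNth v)) := by
  have hdt : ∀ w : Fin (k + 1) → L, dTwo θ w = ∑ j : Fin (k + 1), (-1) ^ (j : ℕ) •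
      derSum θ (w j) (j.removeNth w) := by
    intro w; simp [dTwo, AlternatingMap.alternatizeUncurryFin_apply]
  have h0 : derSum θ (f • v 0) (Fin.removeNth 0 v) = f • derSum θ (v 0) (Fin.removeNth 0 v) +
      ∑ j : Fin k, (-1) ^ (j + 1 : ℕ) • (⁅v j.succ, f⁆ * θ (j.succ.removeNth v)) := by
    rw [derSum_apply, derSum_apply, Finset.smul_sum, ← Finset.sum_add_distrib]
    refine Finset.sum_congr rfl fun i _ => ?_
    have hz := θ.neg_one_pow_smul_map_removeNth_add_eq_zero_of_eq
      (v := Function.update v i.succ (v 0)) (i := 0) (j := i.succ)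
      (by simp [(Fin.succ_ne_zero i).symm]) (Fin.succ_ne_zero i).symm
    have e : i.succ = Fin.succAbove 0 i := by simp
    rw [removeNth_update_self] at hz
    conv at hz => lhs; lhs; rw [e, removeNth_update_succAbove]
    simp only [Fin.val_zero, pow_zero, one_smul, Fin.val_succ] at hz
    rw [lie_smul_left, AlternatingMap.map_update_sub, AlternatingMap.map_update_smul,
      AlternatingMap.map_update_smul, eq_neg_of_add_eq_zero_left hz]
    simp [Fin.removeNth, mul_left_comm]
  have hj : ∀ j : Fin k, derSum θ (v j.succ) (j.succ.removeNth (Function.update v 0 (f • v 0))) =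
      f • derSum θ (v j.succ) (j.succ.removeNth v) + ⁅v j.succ, f⁆ * θ (j.succ.removeNth v) := by
    intro j
    cases k with
    | zero => exact j.elim0
    | succ k =>
      have h : (0 : Fin (k + 2)) = j.succ.succAbove 0 := by simp
      conv_lhs => rw [h, removeNth_update_succAbove]
      rw [derSum_update_smul, ← removeNth_update_succAbove]
      simp
  rw [hdt, hdt, Fin.sum_univ_succ, Fin.sum_univ_succ]
  simp only [removeNth_update_self, Function.update_self, h0, ne_eq, Fin.succ_ne_zero,
    not_false_eq_true, Function.update_of_ne, hj]
  simp [Finset.sum_add_distrib, Finset.mul_sum, two_smul, mul_left_comm, mul_add]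
  abel

lemma koszul_eq (θ : Form R L k R) (v : Fin (k + 1) → L) :
    koszul θ v = (dOne θ - (2⁻¹ : ℝ) • dTwo θ) v := by
  have h := congrArg (fun x => (2⁻¹ : ℝ) • x) (two_smul_koszul θ v)
  simpa [smul_sub, smul_smul] using h

lemma koszul_update_smul (θ : Form R L k R) (v : Fin (k + 1) → L) (i : Fin (k + 1)) (f : R)
    (x : L) :
    koszul θ (Function.update v i (f • x)) = f • koszul θ (Function.update v i x) := by
  have h0 : ∀ (v : Fin (k + 1) → L) (x : L),
      koszul θ (Function.update v 0 (f • x)) = f • koszul θ (Function.update v 0 x) := by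
    intro v x
    have h1 := dOne_smul θ (Function.update v 0 x) f
    have h2 := dTwo_smul θ (Function.update v 0 x) f
    simp only [Function.update_idem, Function.update_self] at h1 h2
    rw [koszul_eq, koszul_eq, AlternatingMap.sub_apply, AlternatingMap.sub_apply,
      AlternatingMap.smul_apply, AlternatingMap.smul_apply, h1, h2, smul_add, smul_smul,
      inv_mul_cancel₀ two_ne_zero, one_smul, smul_sub, smul_comm f]
    abel
  by_cases hi : i = 0
  · subst hi; exact h0 v x
  · have hs : ∀ w : Fin (k + 1) → L, koszul θ (w ∘ Equiv.swap i 0) = - koszul θ w := by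
      intro w
      rw [koszul_eq, koszul_eq, AlternatingMap.map_swap _ _ hi]
    have hu : ∀ y : L, Function.update v i y =
        Function.update (v ∘ Equiv.swap i 0) 0 y ∘ Equiv.swap i 0 := by
      intro y
      ext m
      by_cases h1 : m = i
      · subst h1; simp
      by_cases h2 : m = 0
      · subst h2; simp [hi, Ne.symm hi]
      · simp [h1, h2, Equiv.swap_apply_of_ne_of_ne h1 h2]
    rw [hu, hu x, hs, hs, h0, smul_neg]

/-- The differential `d_A : Ω^k(A) → Ω^(k+1)(A)`. -/
def extDer (k : ℕ) : Form R L k R →ₗ[ℝ] Form R L (k + 1) R where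
  toFun θ :=
    { toFun := koszul θ
      map_update_add' := fun {_} v i x y => by
        simp only [koszul_eq]
        convert! AlternatingMap.map_update_add (dOne θ - (2⁻¹ : ℝ) • dTwo θ) v i x y 
      map_update_smul' := fun {_} v i f x => by
        convert! koszul_update_smul θ v i f x
      map_eq_zero_of_eq' := fun v i j h hij => by
        rw [koszul_eq]
        exact AlternatingMap.map_eq_zero_of_eq _ v h hij }
  map_add' θ η := by
    ext v
    change koszul (θ + η) v = koszul θ v + koszul η v
    simp only [koszul, AlternatingMap.add_apply, lie_add, Finset.sum_add_distrib, smul_add]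
    abel
  map_smul' c θ := by
    ext v
    change koszul (c • θ) v = c • koszul θ v
    simp only [koszul, AlternatingMap.smul_apply, lie_smul, Finset.smul_sum, smul_add]
    simp only [smul_comm c]

end differential


variable (R L) in
/-- The closed `k`-forms. -/
def closedForms (k : ℕ) : Submodule ℝ (Form R L k R) := LinearMap.ker (extDer k)

variable (R L) in
/-- The exact `k`-forms. -/
def exactForms : (k : ℕ) → Submodule ℝ (Form R L k R)
  | 0 => ⊥
  | k + 1 => LinearMap.range (extDer k)


/-- The quotient `Z / (Z ∩ B)`. -/
abbrev Subquotient {V : Type*} [AddCommGroup V] [Module ℝ V] (Z B : Submodule ℝ V) : Type _ :=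
  Z ⧸ B.comap Z.subtype

variable (R L) in
/-- The cohomology `H^k(A)` in degree `k`: closed forms modulo exact forms. -/
abbrev Cohomology (k : ℕ) : Type _ :=
  Subquotient (closedForms R L k) (exactForms R L k)

/-- The cohomology class of a closed form. -/
def cohomologyClass {k : ℕ} (θ : Form R L k R) (h : extDer k θ = 0) : Cohomology R L k :=
  Submodule.Quotient.mk ⟨θ, h⟩


variable (R L) in
/-- A linear `L`-connection on `N`: for `L = Γ(A)` and `N = Γ(E)`, a linear `A`-connection on `E`. -/
structure LinearConnection (N : Type*) [AddCommGroup N] [Module R N] [Module ℝ N]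
    [IsScalarTower ℝ R N] where
  nabla : L →ₗ[R] N →ₗ[ℝ] N
  leibniz : ∀ (a : L) (f : R) (e : N), nabla a (f • e) = f • nabla a e + ⁅a, f⁆ • e

namespace LinearConnection

variable {N : Type*} [AddCommGroup N] [Module R N] [Module ℝ N] [IsScalarTower ℝ R N]

/-- `R_∇(a, b) e = ∇_a ∇_b e - ∇_b ∇_a e - ∇_[a,b] e`. -/
def curvatureOp (D : LinearConnection R L N) (a b : L) : Module.End R N where
  toFun e := D.nabla a (D.nabla b e) - D.nabla b (D.nabla a e) - D.nabla ⁅a, b⁆ e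
  map_add' x y := by simp only [map_add]; abel
  map_smul' f x := by
    simp only [D.leibniz, map_add, smul_sub, lie_lie, RingHom.id_apply, sub_smul]
    abel

lemma curvatureOp_add_left (D : LinearConnection R L N) (a a' b : L) :
    D.curvatureOp (a + a') b = D.curvatureOp a b + D.curvatureOp a' b := by
  ext e
  simp only [curvatureOp, LinearMap.coe_mk, AddHom.coe_mk, LinearMap.add_apply, map_add, add_lie]
  abel

lemma curvatureOp_smul_left (D : LinearConnection R L N) (f : R) (a b : L) :
    D.curvatureOp (f • a) b = f • D.curvatureOp a b := by
  ext e
  simp only [curvatureOp, LinearMap.coe_mk, AddHom.coe_mk, LinearMap.smul_apply, map_smul,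
    lie_smul_left, map_sub, LinearMap.sub_apply, D.leibniz, smul_sub]
  abel

lemma curvatureOp_swap (D : LinearConnection R L N) (a b : L) :
    D.curvatureOp a b = - D.curvatureOp b a := by
  ext e
  simp only [curvatureOp, LinearMap.coe_mk, AddHom.coe_mk, LinearMap.neg_apply]
  rw [← lie_skew b a]
  simp only [map_neg, LinearMap.neg_apply]
  abel

/-- The curvature `R_∇ ∈ Ω^2(A, End E)`. -/
def curvature (D : LinearConnection R L N) : Form R L 2 (Module.End R N) where
  toFun v := D.curvatureOp (v 0) (v 1)
  map_update_add' {_} v i x y := by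
    have hr : ∀ a b c, D.curvatureOp a (b + c) = D.curvatureOp a b + D.curvatureOp a c := by
      intro a b c
      rw [D.curvatureOp_swap a (b + c), D.curvatureOp_swap a b, D.curvatureOp_swap a c,
        D.curvatureOp_add_left]
      abel
    fin_cases i <;> simp [D.curvatureOp_add_left, hr]
  map_update_smul' {_} v i f x := by
    have hr : ∀ a b (f : R), D.curvatureOp a (f • b) = f • D.curvatureOp a b := by
      intro a b f
      rw [D.curvatureOp_swap a (f • b), D.curvatureOp_swap a b, D.curvatureOp_smul_left, smul_neg]
    fin_cases i <;> simp [D.curvatureOp_smul_left, hr]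
  map_eq_zero_of_eq' v i j h hij := by
    have h0 : ∀ a, D.curvatureOp a a = 0 := by
      intro a
      ext e
      simp [curvatureOp]
    fin_cases i <;> fin_cases j <;> simp_all

/-- The power `R_∇^l ∈ Ω^(2l)(A, End E)`, for the wedge product of `End E`-valued forms given by
composition of endomorphisms. -/
def curvaturePow (D : LinearConnection R L N) : (l : ℕ) → Form R L (2 * l) (Module.End R N)
  | 0 => AlternatingMap.constOfIsEmpty R L (Fin 0) (1 : Module.End R N)
  | l + 1 => wedge (LinearMap.mul R (Module.End R N)) (D.curvaturePow l) D.curvature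

end LinearConnection

section graded

variable {n : ℕ} (N : Fin n → Type*) [∀ i, AddCommGroup (N i)] [∀ i, Module R (N i)]
  [∀ i, Module ℝ (N i)] [∀ i, IsScalarTower ℝ R (N i)]

variable (R L) in
/-- The forms with values in the graded bundle `E_0[0] ⊕ ⋯ ⊕ E_(n-1)[n-1]`, as the direct sum of
its pieces `Ω^p(A, E_i)`; the index `s = (i, p)` stands for the piece `Ω^p(A, E_i)`. -/
abbrev GradedForm : Type _ :=
  DirectSum (Fin n × ℕ) fun s => Form R L s.2 (N s.1)

variable (R L) in
/-- The forms of total degree `d`, i.e. those with components in `Ω^p(A, E_i)`, `p + i = d`. -/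
def totalDegree (d : ℕ) : Submodule ℝ (GradedForm R L N) where
  carrier := {η | ∀ s : Fin n × ℕ, η s ≠ 0 → s.2 + (s.1 : ℕ) = d}
  add_mem' {η η'} h h' s hs := by
    by_contra hd
    have h1 : η s = 0 := by_contra fun hne => hd (h s hne)
    have h2 : η' s = 0 := by_contra fun hne => hd (h' s hne)
    exact hs (by simp [h1, h2])
  zero_mem' s hs := absurd rfl hs
  smul_mem' c η h s hs := h s fun h0 => hs (by simp [DirectSum.smul_apply, h0])

variable {N} in
/-- The exterior product `η ↦ θ ∧ η` on forms with values in a graded bundle. -/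
def gradedWedge {k : ℕ} (θ : Form R L k R) : GradedForm R L N →ₗ[ℝ] GradedForm R L N :=
  DirectSum.toModule ℝ (Fin n × ℕ) (GradedForm R L N) fun s =>
    (DirectSum.lof ℝ (Fin n × ℕ) (fun s => Form R L s.2 (N s.1)) (s.1, k + s.2)).comp
      (wedgeLeft θ s.2)

variable (R L) in
/-- A connection up to homotopy (an `n`-connection) on `E_0[0] ⊕ ⋯ ⊕ E_(n-1)[n-1]`: an operator
`𝒟` of total degree `1` with `𝒟(θ ∧ η) = dθ ∧ η + (-1)^|θ| θ ∧ 𝒟 η`. -/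
structure HomotopyConnection where
  toLinearMap : GradedForm R L N →ₗ[ℝ] GradedForm R L N
  degree_one : ∀ (d : ℕ) (η : GradedForm R L N), η ∈ totalDegree R L N d →
    toLinearMap η ∈ totalDegree R L N (d + 1)
  leibniz : ∀ (k : ℕ) (θ : Form R L k R) (η : GradedForm R L N),
    toLinearMap (gradedWedge θ η) =
      gradedWedge (extDer k θ) η + (-1 : ℝ) ^ k • gradedWedge θ (toLinearMap η)

variable {N} in
/-- An `n`-representation (an `n`-term representation up to homotopy) is an `n`-connection `𝒟`
with `𝒟 ∘ 𝒟 = 0`. -/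
def HomotopyConnection.IsRepresentation (D : HomotopyConnection R L N) : Prop :=
  D.toLinearMap ∘ₗ D.toLinearMap = 0

end graded

end algebra

section geometry

variable {EM : Type*} [NormedAddCommGroup EM] [NormedSpace ℝ EM]
  {H : Type*} [TopologicalSpace H] {I : ModelWithCorners ℝ EM H}
  {M : Type*} [TopologicalSpace M] [ChartedSpace H M]
  {F : Type*} [NormedAddCommGroup F] [NormedSpace ℝ F]
  {E : M → Type*} [TopologicalSpace (TotalSpace F E)] [∀ x, TopologicalSpace (E x)]
  [∀ x, AddCommGroup (E x)] [∀ x, Module ℝ (E x)] [FiberBundle F E] [VectorBundle ℝ F E]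

/-- Multiplication of smooth sections by smooth functions. -/
instance sectionSMul : SMul C^∞⟮I, M; ℝ⟯ Cₛ^∞⟮I; F, E⟯ :=
  ⟨fun f s => ⟨fun x => f x • s x, f.contMDiff.smul_section s.contMDiff⟩⟩

@[simp] lemma section_smul_apply (f : C^∞⟮I, M; ℝ⟯) (s : Cₛ^∞⟮I; F, E⟯) (x : M) :
    (f • s) x = f x • s x := rfl

@[simp] lemma section_add_apply (s t : Cₛ^∞⟮I; F, E⟯) (x : M) : (s + t) x = s x + t x := rfl

/-- `Γ(E)` is a `C^∞(M)`-module. -/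
instance sectionModule : Module C^∞⟮I, M; ℝ⟯ Cₛ^∞⟮I; F, E⟯ where
  one_smul s := by ext x; simp
  mul_smul f g s := by ext x; simp [mul_smul]
  smul_zero f := by ext x; simp
  smul_add f s t := by ext x; simp
  add_smul f g s := by ext x; simp [add_smul]
  zero_smul s := by ext x; simp

instance sectionScalarTower : IsScalarTower ℝ C^∞⟮I, M; ℝ⟯ Cₛ^∞⟮I; F, E⟯ where
  smul_assoc c f s := by ext x; simp [mul_smul]

lemma section_sum_apply {ι : Type*} (t : Finset ι) (f : ι → Cₛ^∞⟮I; F, E⟯) (x : M) :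
    (∑ i ∈ t, f i) x = ∑ i ∈ t, f i x :=
  map_sum ((Pi.evalAddMonoidHom (fun x => E x) x).comp (ContMDiffSection.coeAddHom I F ∞ E)) f t

section frames

variable [FiniteDimensional ℝ EM] [IsManifold I ∞ M] [T2Space M] [FiniteDimensional ℝ F]
  [ContMDiffVectorBundle ∞ F E I]

lemma exists_global_frame (x : M) :
    ∃ U : Set M, IsOpen U ∧ x ∈ U ∧ ∃ g : Fin (Module.finrank ℝ F) → Cₛ^∞⟮I; F, E⟯,
      ∃ b : ∀ y ∈ U, Module.Basis (Fin (Module.finrank ℝ F)) ℝ (E y),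
        (∀ y hy i, b y hy i = g i y) ∧
        ∀ s : Cₛ^∞⟮I; F, E⟯, ∃ c : Fin (Module.finrank ℝ F) → C^∞⟮I, M; ℝ⟯,
          ∀ y hy i, c i y = (b y hy).repr (s y) i := by
  classical
  have : ContMDiffVectorBundle 1 F E I := ContMDiffVectorBundle.of_le (n := ∞) (by simp)
  let e := trivializationAt F E x
  have he : e.baseSet ∈ 𝓝 x :=
    e.open_baseSet.mem_nhds (FiberBundle.mem_baseSet_trivializationAt' x)
  obtain ⟨ψ, -, hψ⟩ := (SmoothBumpFunction.nhds_basis_tsupport (I := I) x).mem_iff.1 he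
  let b := Module.finBasis ℝ F
  obtain ⟨U, hU1, hU, hxU⟩ := mem_nhds_iff.1 (show {y | ψ y = 1} ∈ 𝓝 x from ψ.eventuallyEq_one)
  have hsub : ∀ y ∈ U, y ∈ e.baseSet := by
    intro y hyU
    have hy := hU1 hyU
    apply hψ
    apply subset_tsupport
    rw [Function.mem_support]
    rw [Set.mem_ofPred_eq] at hy
    rw [hy]; exact one_ne_zero
  refine ⟨U, hU, hxU, fun i => ⟨fun y => ψ y • e.localFrame b i y, ?_⟩,
    fun y hy => e.basisAt b (hsub y hy), ?_, ?_⟩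
  · exact ContMDiffOn.smul_section_of_tsupport (u := e.baseSet) ψ.contMDiff.contMDiffOn
      e.open_baseSet hψ (e.contMDiffOn_localFrame_baseSet ∞ b i)
  · intro y hy i
    have h1 : ψ y = 1 := hU1 hy
    simp [h1, hsub y hy]
  · intro s
    refine ⟨fun i => ⟨fun y => ψ y * e.localFrameCoeff I b i y (s y), ?_⟩, ?_⟩
    · apply contMDiff_of_tsupport
      intro y hy
      have hy' : y ∈ e.baseSet := hψ (closure_mono (Function.support_mul_subset_left _ _) hy)
      exact ψ.contMDiff.contMDiffAt.mul
        (contMDiffAt_localFrameCoeff (I := I) b hy' s.contMDiff.contMDiffAt i)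
    · intro y hy i
      have h1 : ψ y = 1 := hU1 hy
      have := e.localFrameCoeff_apply_of_mem_baseSet (I := I) b (hsub y hy) s i
      simp [h1, this]

lemma exists_section_eq (x : M) (v : E x) : ∃ s : Cₛ^∞⟮I; F, E⟯, s x = v := by
  obtain ⟨U, -, hx, g, b, hb, -⟩ := exists_global_frame (I := I) (F := F) (E := E) x
  refine ⟨∑ i, ((b x hx).repr v i) • g i, ?_⟩
  rw [section_sum_apply]
  conv_rhs => rw [← (b x hx).sum_repr v]
  refine Finset.sum_congr rfl fun i _ => ?_
  rw [hb]; rfl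

/-- A `C^∞(M)`-linear endomorphism of `Γ(E)` is local. -/
lemma end_apply_congr (φ : Module.End C^∞⟮I, M; ℝ⟯ Cₛ^∞⟮I; F, E⟯) {U : Set M} (hU : IsOpen U)
    {x : M} (hx : x ∈ U) {s t : Cₛ^∞⟮I; F, E⟯} (h : ∀ y ∈ U, s y = t y) : φ s x = φ t x := by
  obtain ⟨ψ, -, hψ⟩ := (SmoothBumpFunction.nhds_basis_tsupport (I := I) x).mem_iff.1
    (hU.mem_nhds hx)
  let f : C^∞⟮I, M; ℝ⟯ := ⟨ψ, ψ.contMDiff⟩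
  have hf : f x = 1 := ψ.eq_one
  have hst : f • s = f • t := by
    ext y
    by_cases hy : y ∈ U
    · simp [h y hy]
    · have : f y = 0 := by
        by_contra h0
        exact hy (hψ (subset_tsupport _ h0))
      simp [this]
  have := congrArg (fun u => φ u x) hst
  simpa [hf] using this

lemma exists_fiberMap (φ : Module.End C^∞⟮I, M; ℝ⟯ Cₛ^∞⟮I; F, E⟯) (x : M) :
    ∃ T : E x →ₗ[ℝ] E x, ∀ s : Cₛ^∞⟮I; F, E⟯, φ s x = T (s x) := by
  obtain ⟨U, hU, hx, g, b, hb, hc⟩ := exists_global_frame (I := I) (F := F) (E := E) x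
  refine ⟨(b x hx).constr ℝ fun i => φ (g i) x, fun s => ?_⟩
  obtain ⟨c, hc⟩ := hc s
  have h : ∀ y ∈ U, s y = (∑ i, c i • g i : Cₛ^∞⟮I; F, E⟯) y := by
    intro y hy
    rw [section_sum_apply]
    conv_lhs => rw [← (b y hy).sum_repr (s y)]
    refine Finset.sum_congr rfl fun i _ => ?_
    rw [hb, section_smul_apply, hc y hy]
  rw [end_apply_congr φ hU hx h, map_sum, section_sum_apply, Module.Basis.constr_apply_fintype]
  refine Finset.sum_congr rfl fun i _ => ?_
  rw [map_smul, section_smul_apply, hc x hx]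
  rfl

/-- The linear map `φ_x : E_x → E_x` with `φ_x (s x) = (φ s) x`, for `φ ∈ Γ(End E)` viewed as a
`C^∞(M)`-linear endomorphism of `Γ(E)`. -/
def fiberMap (φ : Module.End C^∞⟮I, M; ℝ⟯ Cₛ^∞⟮I; F, E⟯) (x : M) : E x →ₗ[ℝ] E x :=
  (exists_fiberMap φ x).choose

lemma fiberMap_apply (φ : Module.End C^∞⟮I, M; ℝ⟯ Cₛ^∞⟮I; F, E⟯) (s : Cₛ^∞⟮I; F, E⟯) (x : M) :
    fiberMap φ x (s x) = φ s x :=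
  ((exists_fiberMap φ x).choose_spec s).symm

lemma contMDiff_trace_fiberMap (φ : Module.End C^∞⟮I, M; ℝ⟯ Cₛ^∞⟮I; F, E⟯) :
    ContMDiff I 𝓘(ℝ) ∞ fun x => LinearMap.trace ℝ (E x) (fiberMap φ x) := by
  intro x
  obtain ⟨U, hU, hx, g, b, hb, hc⟩ := exists_global_frame (I := I) (F := F) (E := E) x
  choose c hc using hc
  have h : ∀ y ∈ U, LinearMap.trace ℝ (E y) (fiberMap φ y) = (∑ i, c (φ (g i)) i) y := by
    intro y hy
    rw [LinearMap.trace_eq_matrix_trace ℝ (b y hy), Matrix.trace]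
    have hs : (∑ i, c (φ (g i)) i) y = ∑ i, c (φ (g i)) i y :=
      map_sum (ContMDiffMap.evalRingHom y) _ _
    rw [hs]
    refine Finset.sum_congr rfl fun i _ => ?_
    rw [hc _ y hy, Matrix.diag_apply, LinearMap.toMatrix_apply, hb, fiberMap_apply]
  exact (∑ i, c (φ (g i)) i).contMDiff.contMDiffAt.congr_of_eventuallyEq
    (Filter.eventually_of_mem (hU.mem_nhds hx) h)

/-- The fibrewise trace `tr : Γ(End E) → C^∞(M)`, `(tr φ)(x) = tr (φ_x)`. -/
def bundleTrace : Module.End C^∞⟮I, M; ℝ⟯ Cₛ^∞⟮I; F, E⟯ →ₗ[C^∞⟮I, M; ℝ⟯] C^∞⟮I, M; ℝ⟯ where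
  toFun φ := ⟨fun x => LinearMap.trace ℝ (E x) (fiberMap φ x), contMDiff_trace_fiberMap φ⟩
  map_add' φ φ' := by
    ext x
    have : fiberMap (φ + φ') x = fiberMap φ x + fiberMap φ' x := by
      ext v
      obtain ⟨s, rfl⟩ := exists_section_eq (I := I) (F := F) x v
      simp [fiberMap_apply]
    change LinearMap.trace ℝ (E x) _ = LinearMap.trace ℝ (E x) _ + LinearMap.trace ℝ (E x) _
    rw [this, map_add]
  map_smul' f φ := by
    ext x
    have : fiberMap (f • φ) x = f x • fiberMap φ x := by
      ext v
      obtain ⟨s, rfl⟩ := exists_section_eq (I := I) (F := F) x v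
      simp [fiberMap_apply]
    change LinearMap.trace ℝ (E x) _ = f x * LinearMap.trace ℝ (E x) _
    rw [this, map_smul, smul_eq_mul]

end frames

section algebroid

variable [IsManifold I ∞ M]

variable (I F E) in
/-- A Lie algebroid structure on the vector bundle `E → M`: a smooth vector bundle morphism (the
anchor) `ρ : E → TM` over the identity and a Lie bracket on `Γ(E)` such that
`[a, f b] = f [a, b] + (ρ(a) f) b`. -/
class LieAlgebroid [ContMDiffVectorBundle ∞ F E I] where
  anchor : ∀ x : M, E x →ₗ[ℝ] TangentSpace I x
  contMDiff_anchor : ContMDiff (I.prod 𝓘(ℝ, F)) I.tangent ∞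
    (fun p : TotalSpace F E => (⟨p.proj, anchor p.proj p.snd⟩ : TangentBundle I M))
  bracket : Cₛ^∞⟮I; F, E⟯ → Cₛ^∞⟮I; F, E⟯ → Cₛ^∞⟮I; F, E⟯
  bracket_add_left : ∀ a b c, bracket (a + b) c = bracket a c + bracket b c
  bracket_add_right : ∀ a b c, bracket a (b + c) = bracket a b + bracket a c
  bracket_self : ∀ a, bracket a a = 0
  jacobi : ∀ a b c, bracket a (bracket b c) = bracket (bracket a b) c + bracket b (bracket a c)
  bracket_smul_right : ∀ (a : Cₛ^∞⟮I; F, E⟯) (f : C^∞⟮I, M; ℝ⟯) (b : Cₛ^∞⟮I; F, E⟯) (x : M),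
    bracket a (f • b) x =
      f x • bracket a b x + mvfderiv I f x (anchor x (a x)) • b x

variable [ContMDiffVectorBundle ∞ F E I] [LieAlgebroid I F E]

instance sectionLieRing : LieRing Cₛ^∞⟮I; F, E⟯ where
  bracket := LieAlgebroid.bracket
  add_lie := LieAlgebroid.bracket_add_left
  lie_add := LieAlgebroid.bracket_add_right
  lie_self := LieAlgebroid.bracket_self
  leibniz_lie := LieAlgebroid.jacobi


lemma contMDiff_anchor_section (a : Cₛ^∞⟮I; F, E⟯) : ContMDiff I I.tangent ∞
    (fun x => (⟨x, LieAlgebroid.anchor (I := I) (F := F) x (a x)⟩ : TangentBundle I M)) :=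
  (LieAlgebroid.contMDiff_anchor (I := I) (F := F) (E := E)).comp a.contMDiff

/-- The derivative `ρ(a)(f)` of a smooth function along the anchor of a section. -/
def anchorDeriv (a : Cₛ^∞⟮I; F, E⟯) (f : C^∞⟮I, M; ℝ⟯) : C^∞⟮I, M; ℝ⟯ :=
  ⟨fun x => mvfderiv I f x (LieAlgebroid.anchor (I := I) (F := F) x (a x)), by
    have h1 : ContMDiff I 𝓘(ℝ, ℝ).tangent ∞ _ :=
      (f.contMDiff.contMDiff_tangentMap (m := ∞) le_rfl).comp (contMDiff_anchor_section a)
    have h2 := (contMDiff_snd_tangentBundle_modelSpace ℝ 𝓘(ℝ, ℝ) (n := ∞)).comp h1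
    exact h2⟩

lemma bracket_smul (a : Cₛ^∞⟮I; F, E⟯) (f : C^∞⟮I, M; ℝ⟯) (b : Cₛ^∞⟮I; F, E⟯) :
    ⁅a, f • b⁆ = f • ⁅a, b⁆ + anchorDeriv a f • b := by
  ext x; exact LieAlgebroid.bracket_smul_right a f b x

lemma anchorDeriv_const (a : Cₛ^∞⟮I; F, E⟯) (c : ℝ) :
    anchorDeriv a (algebraMap ℝ C^∞⟮I, M; ℝ⟯ c) = 0 := by
  ext x
  change mvfderiv I (fun _ : M => c) x _ = 0
  rw [mvfderiv_const]; rfl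

lemma smooth_mdifferentiableAt (f : C^∞⟮I, M; ℝ⟯) (x : M) : MDifferentiableAt I 𝓘(ℝ) f x :=
  f.contMDiff.mdifferentiableAt (by simp)

lemma anchorDeriv_add (a : Cₛ^∞⟮I; F, E⟯) (f g : C^∞⟮I, M; ℝ⟯) :
    anchorDeriv a (f + g) = anchorDeriv a f + anchorDeriv a g := by
  ext x
  change mvfderiv I (⇑f + ⇑g) x _ = mvfderiv I f x _ + mvfderiv I g x _
  rw [mvfderiv_add (smooth_mdifferentiableAt f x) (smooth_mdifferentiableAt g x)]
  rfl

lemma anchorDeriv_mul (a : Cₛ^∞⟮I; F, E⟯) (f g : C^∞⟮I, M; ℝ⟯) :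
    anchorDeriv a (f * g) = f * anchorDeriv a g + anchorDeriv a f * g := by
  ext x
  change mvfderiv I (⇑f * ⇑g) x _ = f x * mvfderiv I g x _ + mvfderiv I f x _ * g x
  rw [mvfderiv_mul (smooth_mdifferentiableAt f x) (smooth_mdifferentiableAt g x)]
  simp [mul_comm]

lemma anchorDeriv_add_left (a b : Cₛ^∞⟮I; F, E⟯) (f : C^∞⟮I, M; ℝ⟯) :
    anchorDeriv (a + b) f = anchorDeriv a f + anchorDeriv b f := by
  ext x
  simp only [anchorDeriv, ContMDiffMap.coeFn_mk, section_add_apply, map_add]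
  rfl

lemma anchorDeriv_smul_left (g : C^∞⟮I, M; ℝ⟯) (a : Cₛ^∞⟮I; F, E⟯) (f : C^∞⟮I, M; ℝ⟯) :
    anchorDeriv (g • a) f = g * anchorDeriv a f := by
  ext x
  simp only [anchorDeriv, ContMDiffMap.coeFn_mk, section_smul_apply, map_smul]
  rfl

instance sectionLieAlgebra : LieAlgebra ℝ Cₛ^∞⟮I; F, E⟯ where
  lie_smul c a b := by
    have h : ∀ s : Cₛ^∞⟮I; F, E⟯, c • s = algebraMap ℝ C^∞⟮I, M; ℝ⟯ c • s := fun s =>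
      (algebraMap_smul _ c s).symm
    rw [h, h, bracket_smul, anchorDeriv_const, zero_smul, add_zero]

variable [FiniteDimensional ℝ EM] [T2Space M] [FiniteDimensional ℝ F]

/-- The anchor is a morphism of Lie algebras. -/
lemma anchorDeriv_lie (a b : Cₛ^∞⟮I; F, E⟯) (f : C^∞⟮I, M; ℝ⟯) :
    anchorDeriv ⁅a, b⁆ f = anchorDeriv a (anchorDeriv b f) - anchorDeriv b (anchorDeriv a f) := by
  ext x
  by_cases hx : ∃ v : E x, v ≠ 0
  · obtain ⟨v, hv⟩ := hx
    obtain ⟨c, hc⟩ := exists_section_eq (I := I) (F := F) x v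
    have h := leibniz_lie a b (f • c)
    simp only [bracket_smul, lie_add] at h
    have h2 : anchorDeriv ⁅a, b⁆ f • c =
        (anchorDeriv a (anchorDeriv b f) - anchorDeriv b (anchorDeriv a f)) • c := by
      linear_combination (norm := module) f • leibniz_lie a b c - h
    have h3 : (anchorDeriv ⁅a, b⁆ f) x • v =
        (anchorDeriv a (anchorDeriv b f) - anchorDeriv b (anchorDeriv a f)) x • v := by
      rw [← hc]
      exact congrArg (fun s : Cₛ^∞⟮I; F, E⟯ => s x) h2
    exact smul_left_injective ℝ hv h3
  · push Not at hx
    have h0 : ∀ (s : Cₛ^∞⟮I; F, E⟯) (g : C^∞⟮I, M; ℝ⟯), anchorDeriv s g x = 0 := by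
      intro s g
      change mvfderiv I g x _ = 0
      rw [hx (s x), map_zero, map_zero]
    change _ = anchorDeriv a (anchorDeriv b f) x - anchorDeriv b (anchorDeriv a f) x
    rw [h0, h0, h0, sub_zero]

instance functionLieRingModule : LieRingModule Cₛ^∞⟮I; F, E⟯ C^∞⟮I, M; ℝ⟯ where
  bracket := anchorDeriv
  add_lie := anchorDeriv_add_left
  lie_add := anchorDeriv_add
  leibniz_lie a b f := by
    change anchorDeriv a (anchorDeriv b f) = anchorDeriv ⁅a, b⁆ f + anchorDeriv b (anchorDeriv a f)
    rw [anchorDeriv_lie]; abel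

instance sectionLieRinehartRing : LieRinehartRing C^∞⟮I, M; ℝ⟯ Cₛ^∞⟮I; F, E⟯ where
  lie_smul_eq_mul' f g a := anchorDeriv_smul_left f a g
  leibniz_mul_right' a f g := anchorDeriv_mul a f g
  leibniz_smul_right' a b f := bracket_smul a f b

instance sectionLieRinehartAlgebra : LieRinehartAlgebra ℝ C^∞⟮I, M; ℝ⟯ Cₛ^∞⟮I; F, E⟯ where
  smul_lie c a f := by
    have h : c • a = algebraMap ℝ C^∞⟮I, M; ℝ⟯ c • a := (algebraMap_smul _ c a).symm
    rw [h, LieRinehartRing.lie_smul_eq_mul, Algebra.smul_def]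
  lie_smul c a f := by
    rw [Algebra.smul_def, Algebra.smul_def, LieRinehartRing.leibniz_mul_right]
    change _ + anchorDeriv a _ * f = _
    rw [anchorDeriv_const, zero_mul, add_zero, smul_eq_mul]

end algebroid
end geometry

section pontryagin

variable {EM : Type*} [NormedAddCommGroup EM] [NormedSpace ℝ EM] [FiniteDimensional ℝ EM]
  {H : Type*} [TopologicalSpace H] (I : ModelWithCorners ℝ EM H)
  {M : Type*} [TopologicalSpace M] [ChartedSpace H M] [IsManifold I ∞ M] [T2Space M]
  (FA : Type*) [NormedAddCommGroup FA] [NormedSpace ℝ FA] [FiniteDimensional ℝ FA]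
  (A : M → Type*) [TopologicalSpace (TotalSpace FA A)] [∀ x, TopologicalSpace (A x)]
  [∀ x, AddCommGroup (A x)] [∀ x, Module ℝ (A x)] [FiberBundle FA A] [VectorBundle ℝ FA A]
  [ContMDiffVectorBundle ∞ FA A I] [LieAlgebroid I FA A]
  (F : Type*) [NormedAddCommGroup F] [NormedSpace ℝ F] [FiniteDimensional ℝ F]
  (E : M → Type*) [TopologicalSpace (TotalSpace F E)] [∀ x, TopologicalSpace (E x)]
  [∀ x, AddCommGroup (E x)] [∀ x, Module ℝ (E x)] [FiberBundle F E] [VectorBundle ℝ F E]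
  [ContMDiffVectorBundle ∞ F E I]

variable {I FA A F E} in
/-- The form `tr (R_∇^l) ∈ Ω^(2l)(A)` of a linear `A`-connection `∇` on `E`. -/
def pontryaginForm
    (D : LinearConnection C^∞⟮I, M; ℝ⟯ Cₛ^∞⟮I; FA, A⟯ Cₛ^∞⟮I; F, E⟯) (l : ℕ) :
    Form C^∞⟮I, M; ℝ⟯ Cₛ^∞⟮I; FA, A⟯ (2 * l) C^∞⟮I, M; ℝ⟯ :=
  bundleTrace.compAlternatingMap (D.curvaturePow l)

/-- `c ∈ H^(2l)(A)` is the `l`-th `A`-Pontryagin character `σ_A^l(E)` of `E`: there are linear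
`A`-connections on `E`, and for each of them, `tr (R_∇^l)` is closed and its class is `c`. -/
def IsPontryaginCharacter (l : ℕ)
    (c : Cohomology C^∞⟮I, M; ℝ⟯ Cₛ^∞⟮I; FA, A⟯ (2 * l)) : Prop :=
  Nonempty (LinearConnection C^∞⟮I, M; ℝ⟯ Cₛ^∞⟮I; FA, A⟯ Cₛ^∞⟮I; F, E⟯) ∧
  ∀ D : LinearConnection C^∞⟮I, M; ℝ⟯ Cₛ^∞⟮I; FA, A⟯ Cₛ^∞⟮I; F, E⟯,
    ∃ h : extDer (2 * l) (pontryaginForm D l) = 0, c = cohomologyClass (pontryaginForm D l) h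

end pontryagin

end LieAlgd

end

/-! Restricted to sections, the operator `𝒟` splits by form degree. Total degree one leaves a map ∂
: Γ(E_i) → Γ(E_{i+1}) in form degree zero (`bdry`), an A-connection ∇ on each E_i in form degree one
(`conn`), and a map ω from Γ(E_i) to two-forms with values in E_{i-1} in form degree two (`htpy`);
higher components play no role. In form degree one, `𝒟² = 0` says that ∂ intertwines the connections
(`bdry_nabla`). In form degree two it says R_∇ = -(ω∂ + ∂ω) (`curvatureOp_conn`). So powers of R
commute with ∂, and in the supertrace of R^l R = -R^l(ω∂ + ∂ω) the two kinds of terms are exchanged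
by cyclicity of the trace and cancel, because ∂ joins bundles that are counted with opposite signs.
The alternating sum of the tr(R_∇^l) thus vanishes already as a form (`sum_tracePow_conn`).

What remains is Chern-Weil theory: tr(R_∇^l) is closed by the Bianchi identity (`extDer_tracePow`),
and its class does not depend on ∇, by transgression along the affine family ∇ + Tα
(`exists_tracePow_sub_eq`). Here T is a polynomial variable and the integral over T is taken
coefficient by coefficient.

Two devices carry the computations. Forms become functions on lists of arbitrary length, so that
degrees need no casts; the product and the differential are then defined by recursion on the first
argument, and identities follow by induction on the list. `toList_wedge` and `toList_extDer`
identify them with the given operations. The properties of the fibrewise trace are derived from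
`IsLocalTrace`: multiplied by a suitable bump function, the identity of Γ(E) is a finite sum of rank
one endomorphisms. The same localization writes forms as sums of products of scalar forms and
sections, so that the Leibniz rule determines the components of `𝒟` that enter `𝒟²` from its values
on sections. -/

noncomputable section
namespace LieAlgd

/-! ### Functions on lists and the shuffle product -/

section listForms

variable {L V V₁ V₂ V₃ : Type*} [AddCommGroup V] [AddCommGroup V₁] [AddCommGroup V₂]
  [AddCommGroup V₃]

/-- The interior product of a function on lists with `a`. -/
def iota (a : L) (θ : List L → V) : List L → V := fun w => θ (a :: w)

/-- The grading involution. -/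
def hat (θ : List L → V) : List L → V := fun w => (-1 : ℤ) ^ w.length • θ w

/-- The shuffle product of functions on lists, with respect to a biadditive pairing. -/
def shuffle (β : V₁ →+ V₂ →+ V₃) : List L → (List L → V₁) → (List L → V₂) → V₃
  | [], θ, η => β (θ []) (η [])
  | a :: w, θ, η => shuffle β w (iota a θ) η + shuffle β w (hat θ) (iota a η)

@[simp] lemma iota_apply (a : L) (θ : List L → V) (w : List L) : iota a θ w = θ (a :: w) := rfl

lemma hat_apply (θ : List L → V) (w : List L) : hat θ w = (-1 : ℤ) ^ w.length • θ w := rfl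

@[simp] lemma hat_nil (θ : List L → V) : hat θ [] = θ [] := by simp [hat]

@[simp] lemma hat_cons (θ : List L → V) (a : L) (w : List L) :
    hat θ (a :: w) = - hat (iota a θ) w := by simp [hat, pow_succ]

lemma iota_hat (a : L) (θ : List L → V) : iota a (hat θ) = - hat (iota a θ) := by
  ext w; simp

@[simp] lemma iota_add (a : L) (θ η : List L → V) : iota a (θ + η) = iota a θ + iota a η := rfl
@[simp] lemma iota_neg (a : L) (θ : List L → V) : iota a (-θ) = -iota a θ := rfl
@[simp] lemma iota_zero (a : L) : iota a (0 : List L → V) = 0 := rfl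
@[simp] lemma hat_add (θ η : List L → V) : hat (θ + η) = hat θ + hat η := by
  ext w; simp [hat]
@[simp] lemma hat_neg (θ : List L → V) : hat (-θ) = -hat θ := by
  ext w; simp [hat]
@[simp] lemma hat_zero : hat (0 : List L → V) = 0 := by
  ext w; simp [hat]
@[simp] lemma hat_hat (θ : List L → V) : hat (hat θ) = θ := by
  ext w; simp [hat, smul_smul, ← mul_pow]

lemma map_hat (g : V →+ V₁) (θ : List L → V) : (fun w => g (hat θ w)) = hat (fun w => g (θ w)) := by
  ext w; simp [hat]

section shuffle

variable (β : V₁ →+ V₂ →+ V₃)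

lemma shuffle_cons (a : L) (w : List L) (θ : List L → V₁) (η : List L → V₂) :
    shuffle β (a :: w) θ η = shuffle β w (iota a θ) η + shuffle β w (hat θ) (iota a η) := rfl

lemma shuffle_add_left (w : List L) (θ θ' : List L → V₁) (η : List L → V₂) :
    shuffle β w (θ + θ') η = shuffle β w θ η + shuffle β w θ' η := by
  induction w generalizing θ θ' η with
  | nil => simp [shuffle]
  | cons a w ih => simp only [shuffle, iota_add, hat_add, ih]; abel

lemma shuffle_add_right (w : List L) (θ : List L → V₁) (η η' : List L → V₂) :
    shuffle β w θ (η + η') = shuffle β w θ η + shuffle β w θ η' := by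
  induction w generalizing θ η η' with
  | nil => simp [shuffle]
  | cons a w ih => simp only [shuffle, iota_add, ih]; abel

/-- The shuffle product, as a biadditive map. -/
def shuffleHom (w : List L) : (List L → V₁) →+ (List L → V₂) →+ V₃ :=
  AddMonoidHom.mk' (fun θ => AddMonoidHom.mk' (shuffle β w θ) (shuffle_add_right β w θ))
    fun θ θ' => by ext η; exact shuffle_add_left β w θ θ' η

lemma shuffleHom_apply (w : List L) (θ : List L → V₁) (η : List L → V₂) :
    shuffleHom β w θ η = shuffle β w θ η := rfl

@[simp] lemma shuffle_neg_left (w : List L) (θ : List L → V₁) (η : List L → V₂) :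
    shuffle β w (-θ) η = -shuffle β w θ η := by simp [← shuffleHom_apply]
@[simp] lemma shuffle_neg_right (w : List L) (θ : List L → V₁) (η : List L → V₂) :
    shuffle β w θ (-η) = -shuffle β w θ η := by simp [← shuffleHom_apply]
@[simp] lemma shuffle_zero_left (w : List L) (η : List L → V₂) :
    shuffle β w 0 η = 0 := by simp [← shuffleHom_apply]
@[simp] lemma shuffle_zero_right (w : List L) (θ : List L → V₁) :
    shuffle β w θ 0 = 0 := by simp [← shuffleHom_apply]
lemma shuffle_zsmul_left (w : List L) (c : ℤ) (θ : List L → V₁) (η : List L → V₂) :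
    shuffle β w (c • θ) η = c • shuffle β w θ η := by simp [← shuffleHom_apply]
lemma shuffle_hat (w : List L) (θ : List L → V₁) (η : List L → V₂) :
    shuffle β w (hat θ) (hat η) = (-1 : ℤ) ^ w.length • shuffle β w θ η := by
  induction w generalizing θ η with
  | nil => simp [shuffle]
  | cons a w ih => 
    simp only [shuffle, iota_hat, shuffle_neg_left, shuffle_neg_right, ih, List.length_cons,
      pow_succ]
    simp

/-- The shuffle product takes values in any subgroup that contains the pairings of values. -/
lemma shuffle_mem (S : AddSubgroup V₃) (w : List L) (θ : List L → V₁) (η : List L → V₂)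
    (h : ∀ u v, β (θ u) (η v) ∈ S) : shuffle β w θ η ∈ S := by
  induction w generalizing θ η with
  | nil => exact h _ _
  | cons a w ih =>
    refine S.add_mem (ih _ _ fun u v => h _ _) (ih _ _ fun u v => ?_)
    simp only [hat, map_zsmul, AddMonoidHom.smul_apply]
    exact S.zsmul_mem (h _ _) _

lemma map_shuffle {W₁ W₂ W₃ : Type*} [AddCommGroup W₁] [AddCommGroup W₂] [AddCommGroup W₃]
    (β' : W₁ →+ W₂ →+ W₃) (g₁ : V₁ →+ W₁) (g₂ : V₂ →+ W₂) (g₃ : V₃ →+ W₃)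
    (h : ∀ x y, g₃ (β x y) = β' (g₁ x) (g₂ y)) (w : List L) (θ : List L → V₁) (η : List L → V₂) :
    g₃ (shuffle β w θ η) = shuffle β' w (fun u => g₁ (θ u)) (fun u => g₂ (η u)) := by
  induction w generalizing θ η with
  | nil => exact h _ _
  | cons a w ih =>
    rw [shuffle_cons, map_add, ih, ih, map_hat]; rfl

end shuffle

/-- Functions on lists, with the shuffle product. -/
def ListForm (L B : Type*) : Type _ := List L → B

namespace ListForm

variable {B : Type*} [Ring B]

instance : AddCommGroup (ListForm L B) := inferInstanceAs (AddCommGroup (List L → B))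

@[ext] lemma ext {x y : ListForm L B} (h : ∀ w, x w = y w) : x = y := funext h

instance : Mul (ListForm L B) := ⟨fun x y w => shuffle AddMonoidHom.mul w x y⟩

instance : One (ListForm L B) := ⟨fun w => if w = [] then 1 else 0⟩

@[simp] lemma add_apply (x y : ListForm L B) (w : List L) : (x + y) w = x w + y w := rfl
@[simp] lemma sub_apply (x y : ListForm L B) (w : List L) : (x - y) w = x w - y w := rfl
@[simp] lemma neg_apply (x : ListForm L B) (w : List L) : (-x) w = - x w := rfl
@[simp] lemma zero_apply (w : List L) : (0 : ListForm L B) w = 0 := rfl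

lemma one_apply (w : List L) : (1 : ListForm L B) w = if w = [] then 1 else 0 := rfl

/-- The interior product, on list forms. -/
def ι (a : L) : ListForm L B →+ ListForm L B := AddMonoidHom.mk' (iota a) fun _ _ => rfl

/-- The grading involution, on list forms. -/
def inv : ListForm L B →+ ListForm L B := AddMonoidHom.mk' hat hat_add

@[simp] lemma ι_apply (a : L) (x : ListForm L B) (w : List L) : ι a x w = x (a :: w) := rfl

lemma inv_apply (x : ListForm L B) (w : List L) : inv x w = (-1 : ℤ) ^ w.length • x w := rfl

@[simp] lemma mul_nil (x y : ListForm L B) : (x * y) [] = x [] * y [] := rfl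

lemma mul_cons (x y : ListForm L B) (a : L) (w : List L) :
    (x * y) (a :: w) = (ι a x * y) w + (inv x * ι a y) w := rfl

@[simp] lemma inv_nil (x : ListForm L B) : inv x [] = x [] := hat_nil x

@[simp] lemma inv_inv (x : ListForm L B) : inv (inv x) = x := hat_hat x

lemma ι_inv (a : L) (x : ListForm L B) : ι a (inv x) = - inv (ι a x) := iota_hat a x

lemma add_mul' (x y z : ListForm L B) : (x + y) * z = x * z + y * z :=
  funext fun w => shuffle_add_left _ w x y z

lemma mul_add' (x y z : ListForm L B) : x * (y + z) = x * y + x * z :=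
  funext fun w => shuffle_add_right _ w x y z

lemma ι_mul' (a : L) (x y : ListForm L B) : ι a (x * y) = ι a x * y + inv x * ι a y := rfl

lemma inv_mul (x y : ListForm L B) : inv (x * y) = inv x * inv y :=
  funext fun w => (shuffle_hat _ w x y).symm

/-- Interior products are graded derivations of the product and the grading involution is
multiplicative, so both sides obey the same recursion. No antisymmetry of the functions is needed.
-/
lemma mul_assoc' (x y z : ListForm L B) : x * y * z = x * (y * z) := by
  ext w
  induction w generalizing x y z with
  | nil => simp [mul_assoc]
  | cons a w ih =>
    simp only [mul_cons, ι_mul', add_mul', mul_add', add_apply, ih, inv_mul]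
    abel

lemma one_mul' (x : ListForm L B) : 1 * x = x := by
  ext w
  have h1 : ∀ a : L, ι a (1 : ListForm L B) = 0 := fun a => by ext w; simp [one_apply]
  have h2 : inv (1 : ListForm L B) = 1 := by
    ext w; by_cases h : w = [] <;> simp [inv_apply, one_apply, h]
  have h0 : ∀ x : ListForm L B, 0 * x = 0 := fun x => by
    ext w; exact shuffle_zero_left _ w x
  induction w generalizing x with
  | nil => simp [one_apply]
  | cons a w ih => simp [mul_cons, h1, h2, h0, ih]

lemma mul_one' (x : ListForm L B) : x * 1 = x := by
  ext w
  have h1 : ∀ a : L, ι a (1 : ListForm L B) = 0 := fun a => by ext w; simp [one_apply]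
  have h0 : ∀ x : ListForm L B, x * 0 = 0 := fun x => by
    ext w; exact shuffle_zero_right _ w x
  induction w generalizing x with
  | nil => simp [one_apply]
  | cons a w ih => simp [mul_cons, h1, h0, ih]

instance : Ring (ListForm L B) where
  __ := (inferInstance : AddCommGroup (ListForm L B))
  left_distrib := mul_add'
  right_distrib := add_mul'
  zero_mul x := funext fun w => shuffle_zero_left _ w x
  mul_zero x := funext fun w => shuffle_zero_right _ w x
  mul_assoc := mul_assoc'
  one_mul := one_mul'
  mul_one := mul_one'

end ListForm

/-! ### Cartan calculus on lists -/

section cartan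

variable [LieRing L] (act : L → V →+ V)

/-- The Lie derivative of a function on lists, with respect to an action `act` on the values. -/
def lieD (a : L) : List L → (List L → V) → V
  | [], θ => act a (θ [])
  | b :: w, θ => lieD a w (iota b θ) - θ (⁅a, b⁆ :: w)

/-- The differential given by Cartan's formula `ι_a d + d ι_a = L_a`. -/
def cartanD : List L → (List L → V) → V
  | [], _ => 0
  | a :: w, θ => lieD act a w θ - cartanD w (iota a θ)

lemma lieD_add (a : L) (w : List L) (θ η : List L → V) :
    lieD act a w (θ + η) = lieD act a w θ + lieD act a w η := by
  induction w generalizing θ η with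
  | nil => simp [lieD]
  | cons b w ih => simp only [lieD, iota_add, ih, Pi.add_apply]; abel

lemma cartanD_add (w : List L) (θ η : List L → V) :
    cartanD act w (θ + η) = cartanD act w θ + cartanD act w η := by
  induction w generalizing θ η with
  | nil => simp [cartanD]
  | cons b w ih => simp only [cartanD, iota_add, ih, lieD_add]; abel

/-- The subgroup `S` matters because a trace on ℝ-linear endomorphisms is compatible with
derivations only on the endomorphisms that are linear over functions. -/
lemma map_lieD (S : AddSubgroup V) (act' : L → V₁ →+ V₁) (g : V →+ V₁)
    (h : ∀ a, ∀ x ∈ S, g (act a x) = act' a (g x)) (a : L) (w : List L) (θ : List L → V)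
    (hθ : ∀ u, θ u ∈ S) :
    g (lieD act a w θ) = lieD act' a w (fun u => g (θ u)) := by
  induction w generalizing θ with
  | nil => exact h _ _ (hθ _)
  | cons b w ih => 
    rw [lieD, map_sub, ih (iota b θ) (fun u => hθ _)]; rfl

lemma map_cartanD (S : AddSubgroup V) (act' : L → V₁ →+ V₁) (g : V →+ V₁)
    (h : ∀ a, ∀ x ∈ S, g (act a x) = act' a (g x)) (w : List L) (θ : List L → V)
    (hθ : ∀ u, θ u ∈ S) :
    g (cartanD act w θ) = cartanD act' w (fun u => g (θ u)) := by
  induction w generalizing θ with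
  | nil => simp [cartanD]
  | cons b w ih =>
    rw [cartanD, map_sub, ih (iota b θ) (fun u => hθ _), map_lieD act S act' g h _ _ _ hθ]; rfl

end cartan

end listForms

section listForms
variable {L V V₁ V₂ V₃ : Type*} [AddCommGroup V] [AddCommGroup V₁] [AddCommGroup V₂]
  [AddCommGroup V₃]

section
variable [LieRing L] (act : L → V →+ V)

lemma lieD_neg (a : L) (w : List L) (θ : List L → V) :
    lieD act a w (-θ) = - lieD act a w θ :=
  (AddMonoidHom.mk' (lieD act a w) (lieD_add act a w)).map_neg θ

lemma cartanD_neg (w : List L) (θ : List L → V) :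
    cartanD act w (-θ) = - cartanD act w θ :=
  (AddMonoidHom.mk' (cartanD act w) (cartanD_add act w)).map_neg θ

lemma lieD_hat (a : L) (w : List L) (θ : List L → V) :
    lieD act a w (hat θ) = (-1 : ℤ) ^ w.length • lieD act a w θ := by
  induction w generalizing θ with
  | nil => simp [lieD]
  | cons b w ih =>
    simp only [lieD, iota_hat, lieD_neg, ih, hat_apply, List.length_cons, pow_succ, smul_sub]
    simp

lemma cartanD_hat (w : List L) (θ : List L → V) :
    cartanD act w (hat θ) = -((-1 : ℤ) ^ w.length • cartanD act w θ) := by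
  induction w generalizing θ with
  | nil => simp [cartanD]
  | cons b w ih =>
    simp only [cartanD, iota_hat, cartanD_neg, ih, lieD_hat, List.length_cons, pow_succ, smul_sub]
    simp only [mul_neg, mul_one, neg_smul]
    abel

end

namespace ListForm

variable [LieRing L] {B : Type*} [Ring B] (act : L → B →+ B)

/-- The Lie derivative of list forms. -/
def lie (a : L) : ListForm L B →+ ListForm L B :=
  AddMonoidHom.mk' (fun x w => lieD act a w x) fun x y => funext fun w => lieD_add act a w x y

/-- The differential of list forms. -/
def d : ListForm L B →+ ListForm L B :=
  AddMonoidHom.mk' (fun x w => cartanD act w x) fun x y => funext fun w => cartanD_add act w x y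

@[simp] lemma d_nil (x : ListForm L B) : d act x [] = 0 := rfl
@[simp] lemma lie_nil (a : L) (x : ListForm L B) : lie act a x [] = act a (x []) := rfl
lemma d_cons (x : ListForm L B) (a : L) (w : List L) :
    d act x (a :: w) = lie act a x w - d act (ι a x) w := rfl
lemma lie_cons (x : ListForm L B) (a b : L) (w : List L) :
    lie act a x (b :: w) = lie act a (ι b x) w - ι ⁅a, b⁆ x w := rfl
lemma ι_d (x : ListForm L B) (a : L) : ι a (d act x) = lie act a x - d act (ι a x) := rfl
lemma ι_lie (x : ListForm L B) (a b : L) :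
    ι b (lie act a x) = lie act a (ι b x) - ι ⁅a, b⁆ x := rfl

lemma inv_d (x : ListForm L B) : inv (d act x) = -d act (inv x) := by
  ext w
  have h := congrArg Neg.neg (cartanD_hat act w x)
  rw [neg_neg] at h
  exact h.symm

lemma lie_inv (a : L) (x : ListForm L B) : lie act a (inv x) = inv (lie act a x) :=
  funext fun w => lieD_hat act a w x

variable {act} (hact : ∀ a x y, act a (x * y) = act a x * y + x * act a y)
include hact

lemma lie_mul (a : L) (x y : ListForm L B) :
    lie act a (x * y) = lie act a x * y + x * lie act a y := by
  ext w
  induction w generalizing x y with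
  | nil => simp [hact]
  | cons b w ih =>
    simp only [lie_cons, ι_mul', map_add, add_apply, ih, mul_cons, ι_lie, sub_mul, mul_sub,
      sub_apply, lie_inv]
    abel

/-- Cartan's formula ι_a d = L_a - d ι_a reduces this to the derivation properties of ι_a and L_a
and to the same statement on a shorter list. -/
lemma d_mul (x y : ListForm L B) : d act (x * y) = d act x * y + inv x * d act y := by
  ext w
  induction w generalizing x y with
  | nil => simp
  | cons a w ih =>
    simp only [d_cons, ι_mul', map_add, add_apply, ih, mul_cons, ι_d, sub_mul, mul_sub,
      sub_apply, lie_mul hact, inv_inv, ι_inv, inv_d, neg_mul, neg_apply]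
    abel

omit hact

/-- A function of degree zero. -/
def const (c : B) : ListForm L B := fun w => if w = [] then c else 0

@[simp] lemma const_nil (c : B) : (const c : ListForm L B) [] = c := rfl
@[simp] lemma ι_const (a : L) (c : B) : ι a (const c) = 0 := by ext w; simp [const]
@[simp] lemma inv_const (c : B) : inv (const c : ListForm L B) = const c := by
  ext w; by_cases h : w = [] <;> simp [inv_apply, const, h]

lemma const_mul (c : B) (x : ListForm L B) (w : List L) : (const c * x : ListForm L B) w = c * x w := by
  induction w generalizing x with
  | nil => simp
  | cons a w ih => simp [mul_cons, ih]

lemma mul_const (c : B) (x : ListForm L B) (w : List L) : (x * const c : ListForm L B) w = x w * c := by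
  induction w generalizing x with
  | nil => simp
  | cons a w ih => simp [mul_cons, ih]

/-- The form of degree one with the given values. -/
def oneForm (Γ : L → B) : ListForm L B
  | [a] => Γ a
  | _ => 0

@[simp] lemma oneForm_nil (Γ : L → B) : oneForm Γ [] = 0 := rfl
@[simp] lemma oneForm_singleton (Γ : L → B) (a : L) : oneForm Γ [a] = Γ a := rfl
@[simp] lemma oneForm_cons_cons (Γ : L → B) (a b : L) (w : List L) :
  oneForm Γ (a :: b :: w) = 0 := rfl

@[simp] lemma ι_oneForm (Γ : L → B) (a : L) : ι a (oneForm Γ) = const (Γ a) := by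
  ext w; cases w <;> simp [const]

@[simp] lemma inv_oneForm (Γ : L → B) : inv (oneForm Γ) = - oneForm Γ := by
  ext w
  rcases w with _ | ⟨a, _ | ⟨b, w⟩⟩ <;> simp [inv_apply]

/-- The action `x ↦ [Γ(a), x]`. -/
def adAct (Γ : L → B) (a : L) : B →+ B := AddMonoidHom.mulLeft (Γ a) - AddMonoidHom.mulRight (Γ a)

lemma adAct_apply (Γ : L → B) (a : L) (x : B) : adAct Γ a x = Γ a * x - x * Γ a := rfl

lemma adAct_mul (Γ : L → B) (a : L) (x y : B) :
    adAct Γ a (x * y) = adAct Γ a x * y + x * adAct Γ a y := by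
  simp only [adAct_apply]; noncomm_ring

lemma lie_adAct (Γ : L → B) (a : L) (x : ListForm L B) (w : List L) :
    lie (adAct Γ) a x w = lie 0 a x w + (Γ a * x w - x w * Γ a) := by
  induction w generalizing x with
  | nil => simp [adAct_apply]
  | cons b w ih => simp only [lie_cons, ih, ι_apply]; abel

/-- The covariant differential is d + [Γ, ·] with the graded commutator, where d is the differential
for the trivial action on coefficients. This makes the curvature calculus purely algebraic. -/
lemma d_adAct (Γ : L → B) (x : ListForm L B) :
    d (adAct Γ) x = d 0 x + oneForm Γ * x - inv x * oneForm Γ := by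
  ext w
  induction w generalizing x with
  | nil => simp
  | cons a w ih =>
    simp only [d_cons, ih, lie_adAct, add_apply, sub_apply, mul_cons, ι_oneForm, const_mul,
      mul_const, inv_oneForm, neg_mul, neg_apply, inv_inv, ι_inv]
    abel

lemma d_zero_oneForm_pair (Γ : L → B) (a b : L) : d 0 (oneForm Γ) [a, b] = -Γ ⁅a, b⁆ := by
  simp [d_cons, lie_cons]

/-- A list form that is concentrated in degree `k`. -/
def IsHomog (k : ℕ) (x : ListForm L B) : Prop := ∀ w, w.length ≠ k → x w = 0

lemma IsHomog.lie {k : ℕ} {x : ListForm L B} (h : IsHomog k x) (a : L) :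
    IsHomog k (lie act a x) := by
  intro w hw
  induction w generalizing k x with
  | nil => simp [h [] hw]
  | cons b w ih =>
    have h1 : ι ⁅a, b⁆ x w = 0 := h _ hw
    rw [lie_cons, h1, sub_zero]
    cases k with
    | zero =>
      have h0 : ι b x = 0 := by ext u; exact h _ (by simp)
      simp [h0]
    | succ k =>
      exact ih (x := ι b x) (k := k) (fun u hu => h _ (by simpa using hu)) (by simpa using hw)

lemma IsHomog.d {k : ℕ} {x : ListForm L B} (h : IsHomog k x) :
    IsHomog (k + 1) (d act x) := by
  intro w hw
  induction w generalizing k x with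
  | nil => simp
  | cons b w ih =>
    rw [d_cons, h.lie b w (by simpa using hw), zero_sub, neg_eq_zero]
    cases k with
    | zero =>
      have h0 : ι b x = 0 := by ext u; exact h _ (by simp)
      simp [h0]
    | succ k =>
      exact ih (x := ι b x) (k := k) (fun u hu => h _ (by simpa using hu)) (by simpa using hw)

lemma isHomog_oneForm (Γ : L → B) : IsHomog 1 (oneForm Γ) := by
  intro w hw
  rcases w with _ | ⟨a, _ | ⟨b, w⟩⟩ <;> simp_all

/-- By degree only three arguments matter, and there this is the Jacobi identity. It is the only
instance of d² = 0 that the Bianchi identity needs. -/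
lemma d_zero_d_zero_oneForm (Γ : L →+ B) : d 0 (d 0 (oneForm Γ)) = 0 := by
  ext w
  by_cases hw : w.length = 3
  · obtain ⟨a, b, c, rfl⟩ := List.length_eq_three.1 hw
    have h := congrArg Γ (leibniz_lie a b c)
    have hs : ⁅⁅a, b⁆, c⁆ = -⁅c, ⁅a, b⁆⁆ := by rw [lie_skew]
    simp [d_cons, lie_cons] at h ⊢
  · exact (isHomog_oneForm Γ).d.d w hw

/-- The curvature `dΓ + Γ²` of a connection form. -/
def curv (Γ : L → B) : ListForm L B := d 0 (oneForm Γ) + oneForm Γ * oneForm Γ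

lemma d_zero_mul (x y : ListForm L B) :
    d (0 : L → B →+ B) (x * y) = d 0 x * y + inv x * d 0 y :=
  d_mul (act := 0) (fun _ _ _ => by simp) x y

lemma inv_d_zero_oneForm (Γ : L → B) : inv (d 0 (oneForm Γ)) = d 0 (oneForm Γ) := by
  rw [inv_d, inv_oneForm, map_neg, neg_neg]

lemma inv_curv (Γ : L → B) : inv (curv Γ) = curv Γ := by
  rw [curv, map_add, inv_mul, inv_d_zero_oneForm, inv_oneForm, neg_mul_neg]

/-- The Bianchi identity. -/
lemma d_adAct_curv (Γ : L →+ B) : d (adAct Γ) (curv Γ) = 0 := by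
  -- With F = dΓ + Γ², the term dF = dΓ Γ - Γ dΓ cancels ΓF - FΓ.
  rw [d_adAct, inv_curv, curv, map_add, d_zero_d_zero_oneForm, d_zero_mul, inv_oneForm]
  noncomm_ring

lemma inv_curv_pow (Γ : L → B) (l : ℕ) : inv (curv Γ ^ l) = curv Γ ^ l := by
  induction l with
  | zero => ext w; by_cases h : w = [] <;> simp [inv_apply, one_apply, h]
  | succ l ih => rw [pow_succ, inv_mul, ih, inv_curv]

lemma d_adAct_curv_pow (Γ : L →+ B) (l : ℕ) : d (adAct Γ) (curv Γ ^ l) = 0 := by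
  induction l with
  | zero =>
    rw [pow_zero, d_adAct]
    have h1 : inv (1 : ListForm L B) = 1 := inv_curv_pow Γ 0
    have : d (0 : L → B →+ B) (1 : ListForm L B) = 0 := by
      -- From 1 = 1 · 1 one gets d1 = d1 + d1.
      have := d_zero_mul (1 : ListForm L B) 1
      rw [h1] at this
      simpa using this
    rw [this, h1]; simp
  | succ l ih => rw [pow_succ, d_mul (adAct_mul Γ), ih, d_adAct_curv]; simp

lemma curv_pair (Γ : L → B) (a b : L) :
    curv Γ [a, b] = Γ a * Γ b - Γ b * Γ a - Γ ⁅a, b⁆ := by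
  rw [curv, add_apply, d_zero_oneForm_pair]
  simp [mul_cons]
  abel

lemma IsHomog.add {k : ℕ} {x y : ListForm L B} (hx : IsHomog k x) (hy : IsHomog k y) :
    IsHomog k (x + y) := fun w hw => by rw [add_apply, hx w hw, hy w hw, add_zero]

lemma IsHomog.mul_oneForm {k : ℕ} {x : ListForm L B} (hx : IsHomog k x) (Γ : L → B) :
    IsHomog (k + 1) (x * oneForm Γ) := by
  intro w hw
  induction w generalizing k x with
  | nil => simp
  | cons b w ih =>
    have h0 : k = 0 → ι b x = 0 := by rintro rfl; ext u; exact hx _ (by simp)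
    rw [mul_cons, ι_oneForm, mul_const, inv_apply, hx w (by simpa using hw), smul_zero, zero_mul,
      add_zero]
    cases k with
    | zero => simp [h0]
    | succ k =>
      exact ih (x := ι b x) (k := k) (fun u hu => hx _ (by simpa using hu)) (by simpa using hw)

lemma isHomog_curv (Γ : L → B) : IsHomog 2 (curv Γ) :=
  (isHomog_oneForm Γ).d.add ((isHomog_oneForm Γ).mul_oneForm Γ)

/-- Evaluation at a list. -/
def ev (w : List L) : ListForm L B →+ B := AddMonoidHom.mk' (fun x => x w) fun _ _ => rfl

lemma zsmul_apply (c : ℤ) (x : ListForm L B) (w : List L) : (c • x) w = c • x w :=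
  map_zsmul (ev w) c x

/-! ### Graded cyclicity of traces -/

section trace

variable {B : Type*} [Ring B] (S : Subring B) (τ : B →+ V)
  (hτ : ∀ x ∈ S, ∀ y ∈ S, τ (x * y) = τ (y * x))

lemma mul_apply_mem (x y : ListForm L B) (hx : ∀ w, x w ∈ S) (hy : ∀ w, y w ∈ S) (w : List L) :
    (x * y) w ∈ S :=
  shuffle_mem _ S.toAddSubgroup w x y fun u v => S.mul_mem (hx u) (hy v)

lemma pow_apply_mem (x : ListForm L B) (hx : ∀ w, x w ∈ S) (l : ℕ) (w : List L) : (x ^ l) w ∈ S := by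
  induction l generalizing w with
  | zero =>
    rw [pow_zero, one_apply]; split_ifs
    exacts [S.one_mem, S.zero_mem]
  | succ l ih => rw [pow_succ]; exact mul_apply_mem S _ _ ih hx w

include hτ in
/-- Graded cyclicity of the trace. -/
lemma trace_mul_comm (x y : ListForm L B) (hx : ∀ w, x w ∈ S) (hy : ∀ w, y w ∈ S) (p q : ℕ)
    (hp : inv x = (-1 : ℤ) ^ p • x) (hq : inv y = (-1 : ℤ) ^ q • y) (w : List L) :
    τ ((x * y) w) = (-1 : ℤ) ^ (p * q) • τ ((y * x) w) := by
  have hι : ∀ (z : ListForm L B) (r : ℕ) (a : L), inv z = (-1 : ℤ) ^ r • z →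
      inv (ι a z) = (-1 : ℤ) ^ (r + 1) • ι a z := by
    intro z r a hz
    rw [← neg_neg (inv (ι a z)), ← ι_inv, hz, map_zsmul, pow_succ, mul_neg_one, neg_smul]
  induction w generalizing x y p q with
  | nil =>
    rw [mul_nil, mul_nil, hτ _ (hx []) _ (hy [])]
    rcases Nat.even_or_odd (p * q) with h | h
    · simp [h.neg_one_pow]
    -- If both parities are odd, the hypothesis gives x [] = -x [], which absorbs the sign without
    -- dividing by two.
    · have h1 := congrFun hp []
      rw [inv_nil, zsmul_apply, (Nat.odd_mul.1 h).1.neg_one_pow, neg_one_smul] at h1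
      rw [h.neg_one_pow, neg_one_smul, ← map_neg, ← mul_neg, ← h1]
  | cons a w ih =>
    -- Splitting off the first argument changes the parity of the factor that receives it. The two
    -- summands for `x * y` then match those for `y * x` in the opposite order.
    rw [mul_cons, mul_cons, map_add, map_add,
      ih (ι a x) y (fun u => hx _) hy (p + 1) q (hι _ _ _ hp) hq, hp, hq, smul_mul_assoc, smul_mul_assoc,
      zsmul_apply, zsmul_apply, map_zsmul, map_zsmul,
      ih x (ι a y) hx (fun u => hy _) p (q + 1) hp (hι _ _ _ hq), smul_add, smul_smul, smul_smul, add_comm]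
    congr 2
    · ring_nf; simp [mul_comm p 2, pow_mul]
    · ring

end trace
end ListForm
end listForms

/-! ### Alternating forms as functions on lists; the wedge product -/

section toList

variable {R L : Type*} [CommRing R] [LieRing L] [Module R L]
  {N N₁ N₂ N₃ : Type*} [AddCommGroup N] [Module R N] [AddCommGroup N₁] [Module R N₁]
  [AddCommGroup N₂] [Module R N₂] [AddCommGroup N₃] [Module R N₃]

/-- A form of degree `k`, as a function on lists that vanishes on lists of length `≠ k`. -/
def Form.toList {k : ℕ} (θ : Form R L k N) (w : List L) : N :=
  if h : w.length = k then θ fun i => w.get (Fin.cast h.symm i) else 0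

lemma Form.toList_ofFn {k : ℕ} (θ : Form R L k N) (v : Fin k → L) :
    θ.toList (List.ofFn v) = θ v := by
  rw [Form.toList, dif_pos (List.length_ofFn)]
  congr 1
  ext i
  simp

lemma Form.toList_of_ne {k : ℕ} (θ : Form R L k N) (w : List L) (h : w.length ≠ k) :
    θ.toList w = 0 := dif_neg h

lemma Form.toList_zero {k : ℕ} : (0 : Form R L k N).toList = 0 := by
  ext w
  rw [Form.toList]; split_ifs <;> rfl

lemma exists_ofFn {k : ℕ} (w : List L) (h : w.length = k) : ∃ v : Fin k → L, w = List.ofFn v := by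
  subst h; exact ⟨w.get, (List.ofFn_get w).symm⟩

lemma Form.toList_injective {k : ℕ} {θ η : Form R L k N} (h : θ.toList = η.toList) : θ = η := by
  ext v
  rw [← θ.toList_ofFn, h, η.toList_ofFn]

lemma Form.eq_toList {k : ℕ} (θ : Form R L k N) (f : List L → N) (h : ∀ v, θ v = f (List.ofFn v))
    (h0 : ∀ w, w.length ≠ k → f w = 0) : θ.toList = f := by
  ext w
  by_cases hw : w.length = k
  · obtain ⟨v, rfl⟩ := exists_ofFn w hw
    rw [toList_ofFn, h]
  · rw [toList_of_ne _ _ hw, h0 _ hw]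

lemma iota_toList_succ {k : ℕ} (θ : Form R L (k + 1) N) (a : L) :
    iota a θ.toList = Form.toList (θ.curryLeft a : Form R L k N) := by
  symm
  refine Form.eq_toList _ _ (fun v => ?_) fun w hw => ?_
  · rw [iota_apply, ← List.ofFn_cons, Form.toList_ofFn]; rfl
  · exact Form.toList_of_ne _ _ (by simpa using hw)

lemma iota_toList_zero (θ : Form R L 0 N) (a : L) : iota a θ.toList = 0 := by
  ext w; exact Form.toList_of_ne _ _ (by simp)

lemma hat_toList {k : ℕ} (θ : Form R L k N) : hat θ.toList = (-1 : ℤ) ^ k • θ.toList := by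
  ext w
  rw [hat_apply, Pi.smul_apply]
  by_cases hw : w.length = k
  · rw [hw]
  · simp [Form.toList_of_ne _ _ hw]

lemma toList_compAlternatingMap {k : ℕ} (g : N₁ →ₗ[R] N₂) (θ : Form R L k N₁) :
    Form.toList (g.compAlternatingMap θ : Form R L k N₂) = fun w => g (θ.toList w) :=
  Form.eq_toList _ _ (fun v => by rw [Form.toList_ofFn]; rfl)
    fun w hw => by rw [Form.toList_of_ne _ _ hw, map_zero]

/-- The biadditive map underlying a bilinear map. -/
def biadd (β : N₁ →ₗ[R] N₂ →ₗ[R] N₃) : N₁ →+ N₂ →+ N₃ :=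
  AddMonoidHom.mk' (fun x => (β x).toAddMonoidHom) fun x y => by ext; simp

@[simp] lemma biadd_apply (β : N₁ →ₗ[R] N₂ →ₗ[R] N₃) (x : N₁) (y : N₂) :
    biadd β x y = β x y := rfl

lemma val_succAbove {m : ℕ} (j : Fin (m + 1)) (y : Fin m) :
    (j.succAbove y : ℕ) = if (y : ℕ) < j then (y : ℕ) else y + 1 := by
  rw [Fin.succAbove]; split_ifs <;> simp_all [Fin.lt_def]

lemma shuffle_eq_zero (β : N₁ →+ N₂ →+ N₃) {k p : ℕ} (θ : List L → N₁) (η : List L → N₂)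
    (hθ : ∀ u, u.length ≠ k → θ u = 0) (hη : ∀ u, u.length ≠ p → η u = 0) (w : List L)
    (hw : w.length ≠ k + p) : shuffle β w θ η = 0 := by
  induction w generalizing k p θ η with
  | nil =>
    by_cases hk : k = 0
    · rw [shuffle, hη [] (by simp at hw ⊢; omega), map_zero]
    · rw [shuffle, hθ [] (by simp; omega), map_zero, AddMonoidHom.zero_apply]
  | cons a w ih =>
    rw [List.length_cons] at hw
    have h1 : shuffle β w (iota a θ) η = 0 := by
      cases k with
      | zero =>
        have : iota a θ = 0 := funext fun u => hθ _ (by simp)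
        rw [this, shuffle_zero_left]
      | succ k => exact ih (k := k) (p := p) _ _ (fun u hu => hθ _ (by simpa using hu)) hη (by omega)
    have h2 : shuffle β w (hat θ) (iota a η) = 0 := by
      cases p with
      | zero =>
        have : iota a η = 0 := funext fun u => hη _ (by simp)
        rw [this, shuffle_zero_right]
      | succ p =>
        exact ih (k := k) (p := p) _ _ (fun u hu => by rw [hat_apply, hθ u hu, smul_zero])
          (fun u hu => hη _ (by simpa using hu)) (by omega)
    rw [shuffle_cons, h1, h2, add_zero]

section permSum
variable (β : N₁ →ₗ[R] N₂ →ₗ[R] N₃)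

/-- The antisymmetrization of `θ ⊗ η`, without normalization. -/
def permSum {k p m : ℕ} (h : k + p = m) (θ : Form R L k N₁) (η : Form R L p N₂) (v : Fin m → L) :
    N₃ :=
  ∑ σ : Equiv.Perm (Fin m), (Equiv.Perm.sign σ : ℤ) •
    β (θ fun i => v (σ (Fin.cast h (Fin.castAdd p i))))
      (η fun i => v (σ (Fin.cast h (Fin.natAdd k i))))

/-- Each shuffle represents a coset of S_k × S_p, on which the alternating maps give k! p! equal
terms. A sum over all permutations is easier to expand by the position of one argument than a sum
over cosets. -/
lemma factorial_smul_wedge {k p : ℕ} (θ : Form R L k N₁) (η : Form R L p N₂)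
    (v : Fin (k + p) → L) :
    (k.factorial * p.factorial) • wedge β θ η v = permSum β rfl θ η v := by
  have h := congrArg (fun f => TensorProduct.lift β (f (v ∘ finSumFinEquiv)))
    (MultilinearMap.domCoprod_alternization_eq θ η)
  simp only [AlternatingMap.smul_apply, Fintype.card_fin, map_nsmul] at h
  refine h.symm.trans ?_
  rw [MultilinearMap.alternatization_apply, map_sum, permSum]
  refine Fintype.sum_equiv (finSumFinEquiv.permCongr) _ _ fun σ => ?_
  rw [Equiv.Perm.sign_permCongr]
  simp only [Units.smul_def, map_zsmul]
  congr 1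
  simp [Function.comp_def]

/-- A permutation σ is determined by the place j with σ j = 0 and by what it does elsewhere: first
move j to the front by a cycle, then permute the other entries by `e`. -/
lemma sum_perm_succ {m : ℕ} (f : Equiv.Perm (Fin (m + 1)) → N) :
    ∑ σ, f σ = ∑ j, ∑ e : Equiv.Perm (Fin m),
      f (Equiv.Perm.decomposeFin.symm (0, e) * Fin.cycleRange j) := by
  rw [← Fintype.sum_prod_type']
  symm
  refine Fintype.sum_bijective
    (fun x : Fin (m + 1) × Equiv.Perm (Fin m) =>
      Equiv.Perm.decomposeFin.symm (0, x.2) * Fin.cycleRange x.1) ?_ _ _ fun _ => rfl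
  rw [Fintype.bijective_iff_injective_and_card]
  constructor
  · rintro ⟨j, e⟩ ⟨j', e'⟩ h
    simp only at h
    -- Both permutations send j' to 0, and the left one sends only j to 0, so j = j'.
    have h1 := congrArg (fun σ : Equiv.Perm (Fin (m + 1)) => σ j') h
    simp only [Equiv.Perm.mul_apply, Fin.cycleRange_self,
      Equiv.Perm.decomposeFin_symm_apply_zero] at h1
    have h0 : Equiv.Perm.decomposeFin.symm (0, e) (0 : Fin (m + 1)) = 0 := by simp
    have h2 : Fin.cycleRange j j' = Fin.cycleRange j j := by
      rw [Fin.cycleRange_self]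
      exact (Equiv.Perm.decomposeFin.symm (0, e)).injective (h1.trans h0.symm)
    obtain rfl := (Fin.cycleRange j).injective h2
    have h3 := mul_right_cancel h
    have h4 := Equiv.Perm.decomposeFin.symm.injective h3
    simp only [Prod.mk.injEq, true_and] at h4
    rw [h4]
  · simp [Fintype.card_perm, Nat.factorial_succ]

/-- The part of `permSum` that comes from the permutations with `σ j = 0`. -/
def permSumAt {k p m : ℕ} (h : k + p = m + 1) (θ : Form R L k N₁) (η : Form R L p N₂)
    (a : L) (v : Fin m → L) (j : Fin (m + 1)) : N₃ :=
  ∑ e : Equiv.Perm (Fin m), ((-1) ^ (j : ℕ) * (Equiv.Perm.sign e : ℤ)) •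
    β (θ fun i => (j.insertNth a (v ∘ e) : Fin (m + 1) → L) (Fin.cast h (Fin.castAdd p i)))
      (η fun i => (j.insertNth a (v ∘ e) : Fin (m + 1) → L) (Fin.cast h (Fin.natAdd k i)))

lemma permSum_cons {k p m : ℕ} (h : k + p = m + 1) (θ : Form R L k N₁) (η : Form R L p N₂)
    (a : L) (v : Fin m → L) :
    permSum β h θ η (Fin.cons a v) = ∑ j, permSumAt β h θ η a v j := by
  rw [permSum, sum_perm_succ]
  refine Finset.sum_congr rfl fun j _ => Finset.sum_congr rfl fun e _ => ?_
  have h1 : ∀ x, (Fin.cons a v : Fin (m + 1) → L)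
      ((Equiv.Perm.decomposeFin.symm (0, e) * Fin.cycleRange j) x) =
      (j.insertNth a (v ∘ e) : Fin (m + 1) → L) x := by
    intro x
    rw [← Fin.cons_apply_cycleRange, Equiv.Perm.mul_apply]
    generalize Fin.cycleRange j x = y
    refine Fin.cases ?_ (fun y => ?_) y <;> simp
  simp only [h1]
  congr 1
  simp [Fin.sign_cycleRange, mul_comm]

/-- Here `a` is the i-th argument of `θ`. The sign of the cycle cancels the sign of moving `a` to
the first slot, so all k + 1 positions contribute equally. -/
lemma permSumAt_left {k p m : ℕ} (h : k + 1 + p = m + 1) (h' : k + p = m)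
    (θ : Form R L (k + 1) N₁) (η : Form R L p N₂) (a : L) (v : Fin m → L) (i : Fin (k + 1)) :
    permSumAt β h θ η a v (Fin.cast h (Fin.castAdd p i)) =
      permSum β h' (θ.curryLeft a) η v := by
  refine Finset.sum_congr rfl fun e _ => ?_
  set j := Fin.cast h (Fin.castAdd p i) with hj
  have h1 : (fun x => (j.insertNth a (v ∘ e) : Fin (m + 1) → L) (Fin.cast h (Fin.castAdd p x))) =
      i.insertNth a fun x => v (e (Fin.cast h' (Fin.castAdd p x))) := by
    ext x
    refine Fin.succAboveCases i ?_ (fun y => ?_) x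
    · rw [← hj]; simp
    · have : Fin.cast h (Fin.castAdd p (i.succAbove y)) =
          j.succAbove (Fin.cast h' (Fin.castAdd p y)) := by
        ext; simp only [hj, val_succAbove, Fin.val_cast, Fin.val_castAdd]
      rw [this]; simp
  have h2 : (fun x => (j.insertNth a (v ∘ e) : Fin (m + 1) → L) (Fin.cast h (Fin.natAdd (k + 1) x))) =
      fun x => v (e (Fin.cast h' (Fin.natAdd k x))) := by
    ext x
    have : Fin.cast h (Fin.natAdd (k + 1) x) = j.succAbove (Fin.cast h' (Fin.natAdd k x)) := by
      ext; simp only [hj, val_succAbove, Fin.val_cast, Fin.val_castAdd, Fin.val_natAdd]; split_ifs <;> omega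
    rw [this]; simp
  rw [h1, h2, AlternatingMap.map_insertNth]
  have h3 : (j : ℕ) = i := rfl
  rw [h3, map_zsmul, LinearMap.smul_apply, smul_smul, mul_right_comm, ← mul_pow, neg_one_mul,
    neg_neg, one_pow, one_mul]
  rfl

/-- Now `a` is the i-th argument of `η`, at place k + i of the whole list. The part (-1)^i of the
sign cancels, and (-1)^k remains for passing the arguments of `θ`. -/
lemma permSumAt_right {k p m : ℕ} (h : k + (p + 1) = m + 1) (h' : k + p = m)
    (θ : Form R L k N₁) (η : Form R L (p + 1) N₂) (a : L) (v : Fin m → L) (i : Fin (p + 1)) :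
    permSumAt β h θ η a v (Fin.cast h (Fin.natAdd k i)) =
      (-1 : ℤ) ^ k • permSum β h' θ (η.curryLeft a) v := by
  rw [permSum, Finset.smul_sum]
  refine Finset.sum_congr rfl fun e _ => ?_
  set j := Fin.cast h (Fin.natAdd k i) with hj
  have h1 : (fun x => (j.insertNth a (v ∘ e) : Fin (m + 1) → L) (Fin.cast h (Fin.natAdd k x))) =
      i.insertNth a fun x => v (e (Fin.cast h' (Fin.natAdd k x))) := by
    ext x
    refine Fin.succAboveCases i ?_ (fun y => ?_) x
    · rw [← hj]; simp
    · have : Fin.cast h (Fin.natAdd k (i.succAbove y)) =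
          j.succAbove (Fin.cast h' (Fin.natAdd k y)) := by
        ext; simp only [hj, val_succAbove, Fin.val_cast, Fin.val_natAdd]; split_ifs <;> omega
      rw [this]; simp
  have h2 : (fun x => (j.insertNth a (v ∘ e) : Fin (m + 1) → L) (Fin.cast h (Fin.castAdd (p + 1) x))) =
      fun x => v (e (Fin.cast h' (Fin.castAdd p x))) := by
    ext x
    have : Fin.cast h (Fin.castAdd (p + 1) x) = j.succAbove (Fin.cast h' (Fin.castAdd p x)) := by
      ext; simp only [hj, val_succAbove, Fin.val_cast, Fin.val_castAdd, Fin.val_natAdd]; split_ifs <;> omega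
    rw [this]; simp
  rw [h1, h2, AlternatingMap.map_insertNth]
  have h3 : (j : ℕ) = k + i := rfl
  rw [h3, map_zsmul, smul_smul, smul_smul, mul_right_comm, pow_add, mul_assoc ((-1 : ℤ) ^ k),
    ← mul_pow, neg_one_mul, neg_neg, one_pow, mul_one]
  rfl

/-- Both sides satisfy the recursion of the shuffle product. The number of equal contributions, k
for `θ` and p for `η`, supplies the factors that complete the factorials. -/
lemma permSum_eq {m k p : ℕ} (h : k + p = m) (θ : Form R L k N₁) (η : Form R L p N₂)
    (v : Fin m → L) :
    permSum β h θ η v =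
      (k.factorial * p.factorial) • shuffle (biadd β) (List.ofFn v) θ.toList η.toList := by
  induction m generalizing k p with
  | zero =>
    obtain ⟨rfl, rfl⟩ : k = 0 ∧ p = 0 := by omega
    rw [permSum, List.ofFn_zero, shuffle]
    simp only [Form.toList]
    simp
    congr 2 <;> congr 1 <;> exact Subsingleton.elim _ _
  | succ m ih =>
    obtain ⟨a, v, rfl⟩ : ∃ a u, v = Fin.cons a u := ⟨v 0, Fin.tail v, (Fin.cons_self_tail v).symm⟩
    rw [List.ofFn_cons, shuffle_cons, hat_toList, shuffle_zsmul_left, permSum_cons, smul_add,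
      ← (finCongr h).sum_comp, Fin.sum_univ_add]
    congr 1
    · cases k with
      | zero => simp [iota_toList_zero]
      | succ k =>
        rw [iota_toList_succ, Nat.factorial_succ, mul_assoc, mul_smul, ← ih (by omega)]
        refine (Finset.sum_congr rfl fun i _ =>
          permSumAt_left β h (by omega) θ η a v i).trans ?_
        simp
    · cases p with
      | zero => simp [iota_toList_zero]
      | succ p =>
        rw [iota_toList_succ, Nat.factorial_succ, mul_left_comm, mul_smul, smul_comm _ ((-1 : ℤ) ^ k),
          ← ih (by omega)]
        refine (Finset.sum_congr rfl fun i _ =>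
          permSumAt_right β h (by omega) θ η a v i).trans ?_
        simp

variable [Module ℝ N₃]

/-- The wedge product is the shuffle product. -/
lemma toList_wedge {k p : ℕ} (θ : Form R L k N₁) (η : Form R L p N₂) :
    (wedge β θ η).toList = fun w => shuffle (biadd β) w θ.toList η.toList := by
  refine Form.eq_toList _ _ (fun v => ?_) fun w hw => ?_
  · have h := (factorial_smul_wedge β θ η v).trans (permSum_eq β rfl θ η v)
    -- The factor k! p! is cancelled over the reals.
    rw [← Nat.cast_smul_eq_nsmul ℝ, ← Nat.cast_smul_eq_nsmul ℝ] at h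
    refine smul_right_injective _ ?_ h
    positivity
  · exact shuffle_eq_zero _ _ _ (fun u => Form.toList_of_ne _ u) (fun u => Form.toList_of_ne _ u) _ hw

end permSum
end toList

/-! ### The Koszul formula and Cartan's formula -/

section extDer

variable {R L : Type*} [CommRing R] [Algebra ℝ R] [LieRing L] [LieAlgebra ℝ L] [Module R L]
  [LieRingModule L R] [LieRinehartRing R L] [LieRinehartAlgebra ℝ R L]

variable (R L) in
/-- The action of `L` on `R` by derivations. -/
def derAct (a : L) : R →+ R := AddMonoidHom.mk' (fun f => ⁅a, f⁆) (lie_add a)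

@[simp] lemma derAct_apply (a : L) (f : R) : derAct R L a f = ⁅a, f⁆ := rfl

lemma lieD_toList {k : ℕ} (θ : Form R L k R) (a : L) (v : Fin k → L) :
    lieD (derAct R L) a (List.ofFn v) θ.toList =
      ⁅a, θ v⁆ - ∑ i, θ (Function.update v i ⁅a, v i⁆) := by
  induction k with
  | zero => rw [← θ.toList_ofFn v]; simp [lieD]
  | succ k ih =>
    obtain ⟨b, v, rfl⟩ : ∃ b u, v = Fin.cons b u := ⟨v 0, Fin.tail v, (Fin.cons_self_tail v).symm⟩
    rw [List.ofFn_cons, lieD, iota_toList_succ, ih, Fin.sum_univ_succ, ← List.ofFn_cons,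
      Form.toList_ofFn]
    simp only [Fin.cons_zero, Fin.cons_succ, Fin.update_cons_zero, ← Fin.cons_update]
    simp only [AlternatingMap.curryLeft_apply_apply, Matrix.vecCons]
    abel

/-- This is ι_a d = L_a - d ι_a. The summand j = 0 differentiates along `a`, the bracket terms with
i = 0 complete the Lie derivative, and the rest is the formula for ι_a θ with all signs reversed. -/
lemma koszul_cons {k : ℕ} (θ : Form R L (k + 1) R) (a : L) (v : Fin (k + 1) → L) :
    koszul θ (Fin.cons a v) = ⁅a, θ v⁆ - (∑ i, θ (Function.update v i ⁅a, v i⁆)) -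
      koszul (θ.curryLeft a : Form R L k R) v := by
  have h1 : ∀ (j : Fin (k + 1)) (x : L) (u : Fin (k + 1) → L),
      j.succ.removeNth (Fin.cons x u : Fin (k + 2) → L) = Fin.cons x (j.removeNth u) := by
    intro j x u
    ext i
    refine Fin.cases ?_ (fun i => ?_) i <;> simp [Fin.removeNth]
  have h0 : Fin.removeNth 0 (Fin.cons a v : Fin (k + 2) → L) = v := by
    ext i; simp [Fin.removeNth]
  -- The bracket with `a` stands in the first place; returning it to place j costs (-1)^j.
  have h2 : ∀ (j : Fin (k + 1)) (x : L), (-1 : ℤ) ^ ((j : ℕ) + 1) • θ (Fin.cons x (j.removeNth v)) =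
      - θ (Function.update v j x) := by
    intro j x
    have := θ.map_insertNth j x (j.removeNth v)
    rw [Fin.insertNth_removeNth] at this
    rw [this, pow_succ, mul_neg_one, neg_smul]; rfl
  have h3 : ∀ (j : Fin (k + 1)) (f : Fin (k + 2) → R),
      ∑ i with i < j.succ, f i = f 0 + ∑ i with i < j, f i.succ := by
    intro j f
    simp [Finset.sum_filter, Fin.sum_univ_succ]
  rw [koszul, Fin.sum_univ_succ]
  simp only [h0, h1, h3, Fin.cons_zero, Fin.cons_succ, Fin.update_cons_zero, ← Fin.cons_update]
  simp only [Fin.val_zero, pow_zero, one_smul, Fin.not_lt_zero, Finset.filter_false,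
    Finset.sum_empty, add_zero, Fin.val_succ]
  rw [sub_sub, sub_eq_add_neg]
  congr 1
  rw [koszul, ← Finset.sum_add_distrib, ← Finset.sum_neg_distrib]
  refine Finset.sum_congr rfl fun j _ => ?_
  simp only [AlternatingMap.curryLeft_apply_apply, Matrix.vecCons]
  rw [neg_add, ← h2, pow_succ, mul_neg_one]
  simp only [neg_smul, smul_add]
  abel

lemma extDer_apply {k : ℕ} (θ : Form R L k R) (v : Fin (k + 1) → L) :
    extDer k θ v = koszul θ v := rfl

/-- The differential of forms is given by Cartan's formula. -/
lemma toList_extDer {k : ℕ} (θ : Form R L k R) :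
    (extDer k θ).toList = fun w => cartanD (derAct R L) w θ.toList := by
  refine Form.eq_toList _ _ (fun v => ?_) fun w hw => ?_
  · rw [extDer_apply]
    induction k with
    | zero =>
      obtain ⟨b, v, rfl⟩ : ∃ b u, v = Fin.cons b u := ⟨v 0, Fin.tail v, (Fin.cons_self_tail v).symm⟩
      rw [List.ofFn_cons, cartanD, lieD_toList, List.ofFn_zero, cartanD, koszul]
      simp
    | succ k ih => 
      obtain ⟨b, v, rfl⟩ : ∃ b u, v = Fin.cons b u := ⟨v 0, Fin.tail v, (Fin.cons_self_tail v).symm⟩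
      rw [koszul_cons, List.ofFn_cons, cartanD, lieD_toList, iota_toList_succ, ih]
  · exact ListForm.IsHomog.d (x := (θ.toList : ListForm L R)) (fun u => θ.toList_of_ne u) w hw

end extDer

/-! ### Traces that are computed locally -/

section localTrace

variable {R : Type*} [CommRing R] {N N' : Type*} [AddCommGroup N] [Module R N]
  [AddCommGroup N'] [Module R N']

/-- `f` is a localizing function for the trace `tr` if `f • id` is a finite sum of endomorphisms
of rank one, by means of which `f * tr` is computed. -/
def IsLocalizer (tr : Module.End R N →ₗ[R] R) (f : R) : Prop :=
  ∃ (r : ℕ) (g : Fin r → N) (c : Fin r → N →ₗ[R] R),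
    (∀ s, f • s = ∑ k, c k s • g k) ∧ ∀ φ : Module.End R N, f * tr φ = ∑ k, c k (φ (g k))

/-- A trace for which there are enough localizing functions. -/
structure IsLocalTrace (tr : Module.End R N →ₗ[R] R) : Prop where
  eq_zero_of_mul : ∀ h : R, (∀ f, IsLocalizer tr f → f * h = 0) → h = 0
  eq_zero_of_smul : ∀ e : N, (∀ f, IsLocalizer tr f → f • e = 0) → e = 0

namespace IsLocalTrace

variable {tr : Module.End R N →ₗ[R] R} (h : IsLocalTrace tr)
  {tr' : Module.End R N' →ₗ[R] R} (h' : IsLocalTrace tr')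

include h in
lemma eq_of_mul {x y : R} (hxy : ∀ f, IsLocalizer tr f → f * x = f * y) : x = y :=
  sub_eq_zero.1 (h.eq_zero_of_mul _ fun f hf => by rw [mul_sub, hxy f hf, sub_self])

-- Elements of one module can be tested with the localizers of another: those of `tr'` express an
-- element through scalar coefficients, and scalars are tested by the localizers of `tr`.
include h h' in
lemma eq_of_smul {x y : N'} (hxy : ∀ f, IsLocalizer tr f → f • x = f • y) : x = y := by
  rw [← sub_eq_zero]
  refine h'.eq_zero_of_smul _ fun f' hf' => ?_
  obtain ⟨r, g, c, hs, -⟩ := hf'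
  rw [hs]
  refine Finset.sum_eq_zero fun k _ => ?_
  have : c k (x - y) = 0 := h.eq_zero_of_mul _ fun f hf => by
    rw [← smul_eq_mul, ← map_smul, smul_sub, hxy f hf, sub_self, map_zero]
  rw [this, zero_smul]

include h in
lemma trace_rankOne (c : N →ₗ[R] R) (g : N) : tr (c.smulRight g) = c g := by
  refine h.eq_of_mul fun f hf => ?_
  obtain ⟨r, b, c', hs, ht⟩ := hf
  rw [ht, ← smul_eq_mul, ← map_smul, hs, map_sum]
  simp [mul_comm]

-- After multiplication by localizers f and f' of the two modules, both traces become the double sum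
-- of c'_j(φ g_k) c_k(ψ g'_j).
include h h' in
lemma trace_comp_comm (φ : N →ₗ[R] N') (ψ : N' →ₗ[R] N) : tr (ψ ∘ₗ φ) = tr' (φ ∘ₗ ψ) := by
  refine h.eq_of_mul fun f hf => h'.eq_of_mul fun f' hf' => ?_
  obtain ⟨r, g, c, hs, ht⟩ := hf
  obtain ⟨r', g', c', hs', ht'⟩ := hf'
  rw [mul_left_comm f' f (tr' _), ht, ht', Finset.mul_sum, Finset.mul_sum]
  have h1 : ∀ k, f' * c k ((ψ ∘ₗ φ) (g k)) = ∑ j, c' j (φ (g k)) * c k (ψ (g' j)) := by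
    intro k
    rw [← smul_eq_mul, ← map_smul, LinearMap.comp_apply, ← map_smul, hs', map_sum, map_sum]
    simp
  have h2 : ∀ j, f * c' j ((φ ∘ₗ ψ) (g' j)) = ∑ k, c' j (φ (g k)) * c k (ψ (g' j)) := by
    intro j
    rw [← smul_eq_mul, ← map_smul, LinearMap.comp_apply, ← map_smul, hs, map_sum, map_sum]
    simp [mul_comm]
  simp only [h1, h2]
  exact Finset.sum_comm

variable {L : Type*} [Algebra ℝ R] [LieRing L] [LieAlgebra ℝ L] [Module R L]
  [LieRingModule L R] [LieRinehartRing R L] [LieRinehartAlgebra ℝ R L]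
  [Module ℝ N] [IsScalarTower ℝ R N]

include h in
/-- The trace of the covariant derivative of an endomorphism. -/
lemma trace_nabla (D : LinearConnection R L N) (a : L) (φ ψ : Module.End R N)
    (hψ : ∀ e, ψ e = D.nabla a (φ e) - φ (D.nabla a e)) : tr ψ = ⁅a, tr φ⁆ := by
  refine h.eq_of_mul fun f hf => ?_
  obtain ⟨r, g, c, hs, ht⟩ := hf
  have hφ : f • φ = ∑ k, (c k).smulRight (φ (g k)) := by
    ext s
    rw [LinearMap.smul_apply, ← map_smul, hs]
    simp
  -- This is the derivative of the functional c_k under the dual connection; it is linear over `R`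
  -- because the two Leibniz terms cancel.
  let c' : Fin r → N →ₗ[R] R := fun k =>
    { toFun := fun e => ⁅a, c k e⁆ - c k (D.nabla a e)
      map_add' := fun x y => by simp only [map_add, lie_add]; abel
      map_smul' := fun x y => by
        simp only [map_smul, D.leibniz, map_add, smul_eq_mul, LieRinehartRing.leibniz_mul_right,
          RingHom.id_apply]
        ring }
  -- The commutator of ∇_a with both sides of `hφ`. All terms on the right have rank one, so
  -- `trace_rankOne` applies; the terms c_k(∇_a φ g_k) cancel, and what is left is the derivative of
  -- f tr φ.
  have hψ' : f • ψ + ⁅a, f⁆ • φ =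
      ∑ k, ((c k).smulRight (D.nabla a (φ (g k))) + (c' k).smulRight (φ (g k))) := by
    ext s
    have h1 := congrArg (fun T : Module.End R N => D.nabla a (T s)) hφ
    have h2 := congrArg (fun T : Module.End R N => T (D.nabla a s)) hφ
    simp only [LinearMap.smul_apply, LinearMap.sum_apply, LinearMap.smulRight_apply, map_sum,
      D.leibniz] at h1 h2
    simp only [LinearMap.add_apply, LinearMap.smul_apply, hψ, LinearMap.sum_apply,
      LinearMap.smulRight_apply, c', LinearMap.coe_mk, AddHom.coe_mk, smul_sub, h2, sub_smul]
    rw [← sub_eq_zero] at h1 ⊢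
    rw [← h1]
    simp only [Finset.sum_add_distrib, Finset.sum_sub_distrib]
    abel
  have h3 := congrArg tr hφ
  have h4 := congrArg tr hψ'
  simp only [map_add, map_smul, map_sum, h.trace_rankOne] at h3 h4
  have h5 := congrArg (fun x => ⁅a, x⁆) h3
  simp only [smul_eq_mul, LieRinehartRing.leibniz_mul_right, lie_sum] at h5
  simp only [c', LinearMap.coe_mk, AddHom.coe_mk, smul_eq_mul, add_sub_cancel] at h4
  rw [← h5] at h4
  linear_combination h4

end IsLocalTrace
end localTrace
-- Closedness and transgression for list forms
namespace ListForm

open Polynomial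

variable {L V B : Type*} [LieRing L] [AddCommGroup V] [Ring B]

section trace
variable (S : Subring B) (τ : B →+ V) (act : L → V →+ V) (Γ : L →+ B)

lemma trace_d (h : ∀ a, ∀ x ∈ S, τ (adAct Γ a x) = act a (τ x)) (x : ListForm L B)
    (hx : ∀ w, x w ∈ S) (w : List L) :
    τ (d (adAct Γ) x w) = cartanD act w (fun u => τ (x u)) :=
  map_cartanD (adAct Γ) S.toAddSubgroup act τ h w x hx

/-- The traces of the powers of the curvature are closed. -/
lemma cartanD_trace_curv_pow (h : ∀ a, ∀ x ∈ S, τ (adAct Γ a x) = act a (τ x))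
    (hF : ∀ w, curv Γ w ∈ S) (l : ℕ) (w : List L) :
    cartanD act w (fun u => τ ((curv Γ ^ l) u)) = 0 := by
  rw [← trace_d S τ act Γ h _ (pow_apply_mem S _ hF l), d_adAct_curv_pow, zero_apply, map_zero]

end trace

/-- The derivative with respect to the polynomial variable. -/
def der : ListForm L B[X] →+ ListForm L B[X] :=
  AddMonoidHom.mk' (fun x w => derivative (x w)) fun x y => by
    ext1 w; exact derivative_add

lemma der_apply (x : ListForm L B[X]) (w : List L) : der x w = derivative (x w) := rfl

lemma ι_der (a : L) (x : ListForm L B[X]) : ι a (der x) = der (ι a x) := rfl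

lemma inv_der (x : ListForm L B[X]) : inv (der x) = der (inv x) := by
  ext1 w; rw [inv_apply, der_apply, der_apply, inv_apply, map_zsmul]

lemma der_mul (x y : ListForm L B[X]) : der (x * y) = der x * y + x * der y := by
  ext1 w
  induction w generalizing x y with
  | nil => simp [der_apply]
  | cons a w ih =>
    have h : ι a (der (x * y)) w = ι a (der x * y + x * der y) w := by
      rw [ι_der, ι_mul', map_add, add_apply, ih, ih, map_add, ι_mul', ι_mul', inv_der, ι_der, ι_der]
      simp only [add_apply]
      abel
    exact h

lemma der_d_zero (x : ListForm L B[X]) : der (d 0 x) = d 0 (der x) :=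
  funext fun w => map_cartanD 0 ⊤ 0 (derivative : B[X] →ₗ[B] B[X]).toAddMonoidHom (by simp) w x
    (fun _ => trivial)

/-- The affine family of connection forms `Γ + T α`. -/
def affine (Γ α : L →+ B) : L →+ B[X] :=
  (C : B →+* B[X]).toAddMonoidHom.comp Γ +
    (AddMonoidHom.mulLeft X).comp ((C : B →+* B[X]).toAddMonoidHom.comp α)

lemma affine_apply (Γ α : L →+ B) (a : L) : affine Γ α a = C (Γ a) + X * C (α a) := rfl

lemma der_oneForm (Γ : L → B[X]) : der (oneForm Γ) = oneForm fun a => derivative (Γ a) := by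
  ext1 w
  rcases w with _ | ⟨a, _ | ⟨b, w⟩⟩ <;> simp [der_apply]

/-- The derivative of dΓ_T + Γ_T² is dα + αΓ_T + Γ_Tα. Since α is odd, this is its covariant
differential. -/
lemma der_curv_affine (Γ α : L →+ B) :
    der (curv (affine Γ α)) = d (adAct (affine Γ α)) (oneForm fun a => C (α a)) := by
  have h : der (oneForm (affine Γ α)) = oneForm fun a => C (α a) := by
    rw [der_oneForm]; congr 1; ext1 a; simp [affine_apply]
  rw [curv, map_add, der_d_zero, der_mul, h, d_adAct, inv_oneForm]
  noncomm_ring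

section transgression

variable (S : Subring B)

/-- The polynomials with coefficients in a subring. -/
def polySubring : Subring B[X] where
  carrier := {p | ∀ k, p.coeff k ∈ S}
  mul_mem' {p q} hp hq k := by
    rw [coeff_mul]
    exact S.sum_mem fun x _ => S.mul_mem (hp _) (hq _)
  one_mem' k := by
    rw [coeff_one]; split_ifs
    exacts [S.one_mem, S.zero_mem]
  add_mem' hp hq k := by rw [coeff_add]; exact S.add_mem (hp k) (hq k)
  zero_mem' k := by rw [coeff_zero]; exact S.zero_mem
  neg_mem' hp k := by rw [coeff_neg]; exact S.neg_mem (hp k)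

lemma derivative_mem_polySubring {p : B[X]} (hp : p ∈ polySubring S) :
    derivative p ∈ polySubring S := by
  intro k
  rw [coeff_derivative]
  exact S.mul_mem (hp _) (S.add_mem (natCast_mem S k) S.one_mem)

variable (τ : B →+ V)

/-- The coefficientwise trace. -/
def coeffTrace (k : ℕ) : B[X] →+ V := τ.comp (lcoeff B k).toAddMonoidHom

lemma coeffTrace_apply (k : ℕ) (p : B[X]) : coeffTrace τ k p = τ (p.coeff k) := rfl

lemma coeffTrace_derivative (k : ℕ) (p : B[X]) :
    coeffTrace τ k (derivative p) = (k + 1) • coeffTrace τ (k + 1) p := by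
  rw [coeffTrace_apply, coeff_derivative, coeffTrace_apply, ← map_nsmul]
  congr 1
  rw [nsmul_eq_mul', Nat.cast_add, Nat.cast_one]

variable (hτ : ∀ x ∈ S, ∀ y ∈ S, τ (x * y) = τ (y * x))
include hτ

lemma coeffTrace_mul_comm (k : ℕ) : ∀ x ∈ polySubring S, ∀ y ∈ polySubring S,
    coeffTrace τ k (x * y) = coeffTrace τ k (y * x) := by
  intro x hx y hy
  rw [coeffTrace_apply, coeffTrace_apply, coeff_mul, coeff_mul, map_sum, map_sum,
    ← Finset.Nat.sum_antidiagonal_swap]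
  exact Finset.sum_congr rfl fun p _ => hτ _ (hx _) _ (hy _)

/-- The product rule for F^{l+1} gives l + 1 terms; `F` is even, so cyclicity moves the derivative
in each of them to the last place. The factor F^j is there for the induction; the application has j
= 0. -/
lemma trace_mul_der_pow (k : ℕ) (F : ListForm L B[X]) (hF : ∀ w, F w ∈ polySubring S)
    (hF' : inv F = F) (l j : ℕ) (w : List L) :
    coeffTrace τ k ((F ^ j * der (F ^ (l + 1))) w) =
      (l + 1) • coeffTrace τ k ((F ^ (j + l) * der F) w) := by
  have hd : ∀ (x : ListForm L B[X]), (∀ w, x w ∈ polySubring S) →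
      ∀ w, der x w ∈ polySubring S := fun x hx w => derivative_mem_polySubring S (hx w)
  have hp := pow_apply_mem (polySubring S) F hF
  have hinv : ∀ l, inv (F ^ l) = F ^ l := by
    intro l
    induction l with
    | zero => ext1 w; by_cases h : w = [] <;> simp [inv_apply, one_apply, h]
    | succ l ih => rw [pow_succ, inv_mul, ih, hF']
  induction l generalizing j with
  | zero => simp
  | succ l ih =>
    have h1 : F ^ j * der (F ^ (l + 1 + 1)) =
        (F ^ j * der (F ^ (l + 1))) * F + F ^ (j + (l + 1)) * der F := by
      rw [pow_succ F (l + 1), der_mul, mul_add, pow_add F j, mul_assoc, mul_assoc]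
    have h2 := trace_mul_comm (polySubring S) (coeffTrace τ k) (coeffTrace_mul_comm S τ hτ k)
      (F ^ j * der (F ^ (l + 1))) F (mul_apply_mem _ _ _ (hp j) (hd _ (hp _))) hF 0 0
      (by rw [inv_mul, inv_der, hinv, hinv]; simp) (by rw [hF']; simp) w
    rw [h1, add_apply, map_add, h2, ← mul_assoc, ← pow_succ', ih, Nat.add_right_comm j 1 l,
      add_assoc j l 1, succ_nsmul _ (l + 1)]
    simp

/-- The transgression formula for an affine family of connection forms. -/
lemma trace_transgression (act : L → V →+ V) (Γ α : L →+ B)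
    (h : ∀ a, ∀ x ∈ S, τ (adAct Γ a x) = act a (τ x)) (hα : ∀ a, α a ∈ S)
    (hF : ∀ w, curv (affine Γ α) w ∈ polySubring S) (l k : ℕ) (w : List L) :
    (k + 1) • coeffTrace τ (k + 1) ((curv (affine Γ α) ^ (l + 1)) w) =
      (l + 1) • cartanD act w (fun u =>
        coeffTrace τ k ((curv (affine Γ α) ^ l * oneForm fun a => C (α a)) u)) := by
  have hC : ∀ w, oneForm (fun a => C (α a)) w ∈ polySubring S := by
    intro w
    rcases w with _ | ⟨a, _ | ⟨b, w⟩⟩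
    · exact (polySubring S).zero_mem
    · intro k
      rw [oneForm_singleton, coeff_C]; split_ifs
      exacts [hα a, S.zero_mem]
    · exact (polySubring S).zero_mem
  have hact : ∀ a, ∀ x ∈ polySubring S,
      coeffTrace τ k (adAct (affine Γ α) a x) = act a (coeffTrace τ k x) := by
    intro a x hx
    have h0 : adAct (affine Γ α) a x =
        (C (Γ a) * x - x * C (Γ a)) + X * (C (α a) * x - x * C (α a)) := by
      rw [adAct_apply, affine_apply, add_mul, mul_add, mul_sub, ← mul_assoc x X, ← X_mul, mul_assoc,
        mul_assoc]
      abel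
    rw [h0, map_add, coeffTrace_apply, coeff_sub, coeff_C_mul, coeff_mul_C, coeffTrace_apply,
      ← adAct_apply (fun a => Γ a), h a _ (hx k)]
    -- The part of the action that depends on T is a commutator inside `S`, which the trace kills.
    -- So the trace is compatible with every member of the affine family.
    have h1 : τ ((X * (C (α a) * x - x * C (α a))).coeff k) = 0 := by
      cases k with
      | zero => simp
      | succ k =>
        rw [coeff_X_mul, coeff_sub, coeff_C_mul, coeff_mul_C, map_sub, hτ _ (hα a) _ (hx k), sub_self]
    rw [h1, add_zero]; rfl
  rw [← coeffTrace_derivative, ← der_apply]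
  have h1 := trace_mul_der_pow S τ hτ k (curv (affine Γ α)) hF (inv_curv _) l 0 w
  rw [pow_zero, one_mul, zero_add, der_curv_affine] at h1
  rw [h1, ← trace_d (polySubring S) (coeffTrace τ k) act (affine Γ α) hact _
    (mul_apply_mem _ _ _ (pow_apply_mem _ _ hF l) hC), d_mul (adAct_mul _), d_adAct_curv_pow,
    inv_curv_pow, zero_mul, zero_add]

end transgression
end ListForm

open Polynomial ListForm

/-! ### Powers of algebra-valued forms -/

section formPow

variable {R L : Type*} [CommRing R] [Algebra ℝ R] [LieRing L] [Module R L]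
  {A B : Type*} [Ring A] [Algebra R A] [Ring B]

/-- An algebra-valued form as a list form. -/
def Form.listForm {k : ℕ} (θ : Form R L k A) : ListForm L A := θ.toList

lemma Form.listForm_ofFn {k : ℕ} (θ : Form R L k A) (v : Fin k → L) :
    θ.listForm (List.ofFn v) = θ v := θ.toList_ofFn v

lemma Form.isHomog_listForm {k : ℕ} (θ : Form R L k A) : IsHomog k θ.listForm :=
  θ.toList_of_ne

lemma Form.listForm_pair (θ : Form R L 2 A) (a b : L) : θ.listForm [a, b] = θ ![a, b] := by
  rw [← θ.listForm_ofFn]; simp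

lemma listForm_wedge [Module ℝ A] {k p : ℕ} (θ : Form R L k A) (η : Form R L p A) :
    Form.listForm (wedge (LinearMap.mul R A) θ η) = θ.listForm * η.listForm := by
  have h : biadd (LinearMap.mul R A) = AddMonoidHom.mul := by ext; simp
  rw [Form.listForm, toList_wedge, h]; rfl

lemma wedge_pair [Module ℝ A] (θ : Form R L 1 A) (η : Form R L 1 A) (a b : L) :
    (wedge (LinearMap.mul R A) θ η : Form R L 2 A) ![a, b] =
      θ ![a] * η ![b] - θ ![b] * η ![a] := by
  rw [← Form.listForm_pair, listForm_wedge]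
  have h1 : ∀ (ζ : Form R L 1 A) (c : L), ζ.listForm [c] = ζ ![c] := fun ζ c => by
    rw [← ζ.listForm_ofFn]; simp
  have h0 : ∀ (ζ : Form R L 1 A), ζ.listForm [] = 0 := fun ζ => ζ.isHomog_listForm _ (by simp)
  have h2 : ∀ (ζ : Form R L 1 A) (c d : L), ζ.listForm [c, d] = 0 :=
    fun ζ c d => ζ.isHomog_listForm _ (by simp)
  simp [mul_cons, h1, h0, h2, ι_inv, inv_apply]
  abel

/-- The powers of a form of degree two. -/
def Form.pow (θ : Form R L 2 A) : (l : ℕ) → Form R L (2 * l) A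
  | 0 => AlternatingMap.constOfIsEmpty R L (Fin 0) (1 : A)
  | l + 1 => wedge (LinearMap.mul R A) (Form.pow θ l) θ

lemma listForm_pow [Module ℝ A] (θ : Form R L 2 A) (l : ℕ) :
    (θ.pow l).listForm = θ.listForm ^ l := by
  induction l with
  | zero =>
    ext1 w
    rw [pow_zero, one_apply]
    cases w with
    | nil => rfl
    | cons a w => exact (θ.pow 0).toList_of_ne _ (by simp)
  | succ l ih => rw [pow_succ, ← ih, ← listForm_wedge]; rfl

/-- The map on list forms that is induced by a ring homomorphism. -/
def ListForm.mapHom (g : A →+* B) : ListForm L A →+* ListForm L B where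
  toFun x w := g (x w)
  map_zero' := funext fun _ => map_zero g
  map_add' _ _ := funext fun _ => map_add g _ _
  map_one' := by
    ext1 w
    rw [one_apply, one_apply]
    split_ifs <;> simp
  map_mul' x y := funext fun w => map_shuffle AddMonoidHom.mul AddMonoidHom.mul g.toAddMonoidHom
    g.toAddMonoidHom g.toAddMonoidHom (fun _ _ => map_mul g _ _) w x y

lemma ListForm.mapHom_apply (g : A →+* B) (x : ListForm L A) (w : List L) :
    mapHom g x w = g (x w) := rfl

lemma ListForm.ext_pair {x y : ListForm L A} (hx : IsHomog 2 x) (hy : IsHomog 2 y)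
    (h : ∀ a b, x [a, b] = y [a, b]) : x = y := by
  ext1 w
  by_cases hw : w.length = 2
  · obtain ⟨a, b, rfl⟩ := List.length_eq_two.1 hw
    exact h a b
  · rw [hx w hw, hy w hw]

lemma ListForm.IsHomog.mapHom {k : ℕ} {x : ListForm L A} (hx : IsHomog k x) (g : A →+* B) :
    IsHomog k (mapHom g x) := fun w hw => by rw [mapHom_apply, hx w hw, map_zero]

/-- Evaluation of polynomials at `1`. -/
def evalOne : A[X] →+* A := eval₂RingHom' (RingHom.id A) 1 fun _ => Commute.one_right _

lemma evalOne_apply (p : A[X]) : evalOne p = p.eval 1 := rfl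

/-- Evaluation of polynomials at `0`. -/
def evalZero : A[X] →+* A := eval₂RingHom' (RingHom.id A) 0 fun _ => Commute.zero_right _

lemma evalZero_apply (p : A[X]) : evalZero p = p.coeff 0 := (coeff_zero_eq_eval_zero p).symm

/-- The polynomials of bounded degree form an additive subgroup, and a shuffle product is a signed
sum of products of values. -/
lemma natDegree_pow_le (x : ListForm L A[X]) (n : ℕ) (hx : ∀ w, (x w).natDegree ≤ n) (l : ℕ)
    (w : List L) : ((x ^ l) w).natDegree ≤ n * l := by
  have hmem : ∀ (m : ℕ) (p : A[X]), p ∈ (degreeLE A m).toAddSubgroup ↔ p.natDegree ≤ m := by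
    intro m p
    rw [Submodule.mem_toAddSubgroup, mem_degreeLE, natDegree_le_iff_degree_le]
  induction l generalizing w with
  | zero => rw [pow_zero, one_apply]; split_ifs <;> simp
  | succ l ih =>
    rw [pow_succ, ← hmem]
    refine shuffle_mem _ _ w _ _ fun u v => ?_
    rw [hmem]
    exact natDegree_mul_le.trans (by rw [mul_add, mul_one]; exact add_le_add (ih u) (hx v))

end formPow

/-! ### Closedness of the trace forms -/

section chernWeil

variable {R L : Type*} [CommRing R] [Algebra ℝ R] [LieRing L] [LieAlgebra ℝ L] [Module R L]
  [LieRingModule L R] [LieRinehartRing R L] [LieRinehartAlgebra ℝ R L]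
  {N : Type*} [AddCommGroup N] [Module R N] [Module ℝ N] [IsScalarTower ℝ R N]

variable (R N) in
/-- `R`-linear endomorphisms as `ℝ`-linear endomorphisms. -/
def endRestrict : Module.End R N →+* Module.End ℝ N where
  toFun φ := φ.restrictScalars ℝ
  map_zero' := rfl
  map_one' := rfl
  map_add' _ _ := rfl
  map_mul' _ _ := rfl

@[simp] lemma endRestrict_apply (φ : Module.End R N) (e : N) : endRestrict R N φ e = φ e := rfl

variable (tr : Module.End R N →ₗ[R] R)

/-- The operators ∇_a are only ℝ-linear, so the curvature calculus takes place in the ℝ-linear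
endomorphisms. Any ℝ-linear retraction extends the trace there; trace identities are used only on
`R`-linear endomorphisms. -/
lemma exists_trace_extension :
    ∃ τ : Module.End ℝ N →+ R, ∀ φ : Module.End R N, τ (endRestrict R N φ) = tr φ := by
  let j : Module.End R N →ₗ[ℝ] Module.End ℝ N :=
    { endRestrict R N with
      map_smul' := fun c φ => by ext e; simp }
  obtain ⟨r, hr⟩ := j.exists_leftInverse_of_injective (by
    rw [LinearMap.ker_eq_bot]
    intro φ ψ h
    ext e
    exact LinearMap.congr_fun h e)
  refine ⟨tr.toAddMonoidHom.comp r.toAddMonoidHom, fun φ => ?_⟩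
  exact congrArg tr (LinearMap.congr_fun hr φ)

namespace LinearConnection

/-- The connection form, with values in the `ℝ`-linear endomorphisms. -/
def form (D : LinearConnection R L N) : L →+ Module.End ℝ N := D.nabla.toAddMonoidHom

lemma curvature_pair (D : LinearConnection R L N) (a b : L) :
    D.curvature ![a, b] = D.curvatureOp a b := rfl

lemma endRestrict_curvatureOp (D : LinearConnection R L N) (a b : L) :
    endRestrict R N (D.curvatureOp a b) =
      D.form a * D.form b - D.form b * D.form a - D.form ⁅a, b⁆ := by
  ext e; rfl

/-- The geometric curvature is dΓ + Γ² for the connection form Γ = ∇, after forgetting linearity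
over functions. -/
lemma mapHom_curvature (D : LinearConnection R L N) :
    mapHom (endRestrict R N) D.curvature.listForm = curv D.form := by
  refine ext_pair (D.curvature.isHomog_listForm.mapHom _) (isHomog_curv _) fun a b => ?_
  rw [mapHom_apply, Form.listForm_pair, curvature_pair, endRestrict_curvatureOp, curv_pair]

lemma curvaturePow_eq (D : LinearConnection R L N) (l : ℕ) :
    D.curvaturePow l = D.curvature.pow l := by
  induction l with
  | zero => rfl
  | succ l ih => rw [curvaturePow, Form.pow, ih]

/-- The commutator of a connection with an endomorphism. -/
def endNabla (D : LinearConnection R L N) (a : L) (φ : Module.End R N) : Module.End R N where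
  toFun e := D.nabla a (φ e) - φ (D.nabla a e)
  map_add' x y := by simp only [map_add]; abel
  map_smul' f x := by
    simp only [map_smul, D.leibniz, map_add, RingHom.id_apply, smul_sub]
    abel

/-- The difference of two connections. -/
def diff (D₁ D₀ : LinearConnection R L N) : L →ₗ[R] Module.End R N where
  toFun a :=
    { toFun := fun e => D₁.nabla a e - D₀.nabla a e
      map_add' := fun x y => by simp only [map_add]; abel
      map_smul' := fun f x => by
        simp only [D₁.leibniz, D₀.leibniz, RingHom.id_apply, smul_sub]; abel }
  map_add' a b := by
    ext e
    simp only [map_add, LinearMap.add_apply, LinearMap.coe_mk, AddHom.coe_mk]; abel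
  map_smul' f a := by
    ext e
    simp [smul_sub]

/-- The form `tr (R_∇^l)`. -/
def tracePow (D : LinearConnection R L N) (l : ℕ) : Form R L (2 * l) R :=
  tr.compAlternatingMap (D.curvaturePow l)

lemma toList_tracePow (D : LinearConnection R L N) (l : ℕ) (w : List L) :
    (D.tracePow tr l).toList w = tr ((D.curvature.listForm ^ l) w) := by
  rw [tracePow, toList_compAlternatingMap, curvaturePow_eq, ← listForm_pow]; rfl

variable {tr} (h : IsLocalTrace tr)
include h

lemma trace_adAct_form (D : LinearConnection R L N) (τ : Module.End ℝ N →+ R)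
    (hτ : ∀ φ : Module.End R N, τ (endRestrict R N φ) = tr φ) (a : L) (x : Module.End ℝ N)
    (hx : x ∈ (endRestrict R N).range) : τ (adAct D.form a x) = derAct R L a (τ x) := by
  obtain ⟨φ, rfl⟩ := hx
  have : adAct D.form a (endRestrict R N φ) = endRestrict R N (D.endNabla a φ) := by
    ext e; rfl
  rw [this, hτ, hτ, h.trace_nabla D a φ _ fun e => rfl, derAct_apply]

/-- The form `tr (R_∇^l)` is closed. -/
lemma extDer_tracePow (D : LinearConnection R L N) (l : ℕ) :
    extDer (2 * l) (D.tracePow tr l) = 0 := by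
  obtain ⟨τ, hτ⟩ := exists_trace_extension tr
  apply Form.toList_injective
  rw [toList_extDer]
  have h1 := cartanD_trace_curv_pow (endRestrict R N).range τ (derAct R L) D.form
    (D.trace_adAct_form h τ hτ) (fun w => by rw [← mapHom_curvature]; exact ⟨_, rfl⟩) l
  have h2 : (D.tracePow tr l).toList = fun u => τ ((curv D.form ^ l) u) := by
    ext1 w
    rw [toList_tracePow, ← mapHom_curvature, ← map_pow, mapHom_apply, hτ]
  ext1 w
  rw [h2, h1]
  by_cases hw : w.length = 2 * l + 1
  · obtain ⟨v, rfl⟩ := exists_ofFn w hw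
    rw [Form.toList_ofFn]; rfl
  · rw [Form.toList_of_ne _ _ hw]

end LinearConnection
end chernWeil

/-! ### Independence of the connection -/

section transgression

variable {R L : Type*} [CommRing R] [Algebra ℝ R] [LieRing L] [LieAlgebra ℝ L] [Module R L]
  [LieRingModule L R] [LieRinehartRing R L] [LieRinehartAlgebra ℝ R L]
  {N : Type*} [AddCommGroup N] [Module R N] [Module ℝ N] [IsScalarTower ℝ R N]

lemma affine_commutator {A : Type*} [Ring A] (x : A) (hx : ∀ y, x * y = y * x)
    (a b c a' b' c' : A) :
    (a * b - b * a - c) +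
        x * ((a' * b' - b' * a' - c') - (a * b - b * a - c) -
          ((a' - a) * (b' - b) - (b' - b) * (a' - a))) +
        x ^ 2 * ((a' - a) * (b' - b) - (b' - b) * (a' - a)) =
      (a + x * (a' - a)) * (b + x * (b' - b)) - (b + x * (b' - b)) * (a + x * (a' - a)) -
        (c + x * (c' - c)) := by
  have h : ∀ p q r s : A, (p + x * q) * (r + x * s) =
      p * r + x * (p * s + q * r) + x ^ 2 * (q * s) := by
    intro p q r s
    have h1 : p * (x * s) = x * (p * s) := by rw [← mul_assoc, ← hx, mul_assoc]
    have h2 : x * q * (x * s) = x ^ 2 * (q * s) := by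
      rw [sq, mul_assoc, mul_assoc, ← mul_assoc q, ← hx, mul_assoc]
    rw [add_mul, mul_add, mul_add, h1, h2, mul_assoc, mul_add]
    abel
  rw [h, h]
  noncomm_ring

lemma Form.sum_apply {ι : Type*} {k : ℕ} (s : Finset ι) (θ : ι → Form R L k N) (v : Fin k → L) :
    (∑ i ∈ s, θ i) v = ∑ i ∈ s, θ i v :=
  map_sum (AddMonoidHom.mk' (fun θ : Form R L k N => θ v) fun _ _ => rfl) θ s

namespace LinearConnection

variable (D₁ D₀ : LinearConnection R L N)

/-- The difference of two connections, as a form of degree one. -/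
def diffForm : Form R L 1 (Module.End R N) :=
  AlternatingMap.ofSubsingleton R L (Module.End R N) (0 : Fin 1) (D₁.diff D₀)

lemma diffForm_apply (a : L) : D₁.diffForm D₀ ![a] = D₁.diff D₀ a := rfl

/-- Multiplication with a power of the polynomial variable. -/
def monomialR {A : Type*} [Ring A] [Algebra R A] (k : ℕ) : A →ₗ[R] A[X] :=
  (monomial k).restrictScalars R

/-- The curvature of the affine family of connections that joins `D₀` and `D₁`. -/
def affineCurvature : Form R L 2 (Module.End R N)[X] :=
  let S : Form R L 2 (Module.End R N) :=
    wedge (LinearMap.mul R (Module.End R N)) (D₁.diffForm D₀) (D₁.diffForm D₀)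
  (monomialR 0).compAlternatingMap D₀.curvature +
    (monomialR 1).compAlternatingMap (D₁.curvature - D₀.curvature - S) +
    (monomialR 2).compAlternatingMap S

lemma affineCurvature_pair (a b : L) : D₁.affineCurvature D₀ ![a, b] =
    C (D₀.curvatureOp a b) +
      X * C (D₁.curvatureOp a b - D₀.curvatureOp a b -
        (D₁.diff D₀ a * D₁.diff D₀ b - D₁.diff D₀ b * D₁.diff D₀ a)) +
      X ^ 2 * C (D₁.diff D₀ a * D₁.diff D₀ b - D₁.diff D₀ b * D₁.diff D₀ a) := by
  have h := wedge_pair (D₁.diffForm D₀) (D₁.diffForm D₀) a b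
  simp only [diffForm_apply] at h
  have hm : ∀ (k : ℕ) (c : Module.End R N), monomialR (R := R) k c = X ^ k * C c := fun k c => by
    rw [X_pow_mul_C, C_mul_X_pow_eq_monomial]; rfl
  rw [← h, ← pow_one (X : (Module.End R N)[X]), ← pow_mul, one_mul, ← hm, ← hm]
  rfl

/-- The curvature of ∇⁰ + Tα is R_0 + T d^{∇⁰}α + T²α², with d^{∇⁰}α = R_1 - R_0 - α² by the case T
= 1. In this shape every coefficient is a form with values in `R`-linear endomorphisms. -/
lemma mapHom_affineCurvature :
    mapHom (mapRingHom (endRestrict R N)) (D₁.affineCurvature D₀).listForm =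
      curv (affine D₀.form ((endRestrict R N).toAddMonoidHom.comp (D₁.diff D₀).toAddMonoidHom)) := by
  refine ext_pair ((Form.isHomog_listForm _).mapHom _) (isHomog_curv _) fun a b => ?_
  have hd : ∀ a, endRestrict R N (D₁.diff D₀ a) = D₁.form a - D₀.form a := fun a => by
    ext e; rfl
  have ha : ∀ a, affine D₀.form ((endRestrict R N).toAddMonoidHom.comp
      (D₁.diff D₀).toAddMonoidHom) a = C (D₀.form a) + X * C (D₁.form a - D₀.form a) := by
    intro a; rw [← hd]; rfl
  rw [mapHom_apply, Form.listForm_pair, affineCurvature_pair, curv_pair, ha, ha, ha]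
  simp only [coe_mapRingHom, Polynomial.map_add, Polynomial.map_mul, Polynomial.map_pow, map_X,
    map_C, map_sub, map_mul, Polynomial.map_sub, hd, endRestrict_curvatureOp]
  exact affine_commutator X (fun _ => X_mul) _ _ _ _ _ _

lemma natDegree_affineCurvature (w : List L) :
    ((D₁.affineCurvature D₀).listForm w).natDegree ≤ 2 := by
  by_cases hw : w.length = 2
  · obtain ⟨a, b, rfl⟩ := List.length_eq_two.1 hw
    rw [Form.listForm_pair, affineCurvature_pair]
    compute_degree
  · rw [Form.isHomog_listForm _ w hw]; simp

lemma mapHom_evalOne_affineCurvature :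
    mapHom evalOne (D₁.affineCurvature D₀).listForm = D₁.curvature.listForm := by
  refine ext_pair ((Form.isHomog_listForm _).mapHom _) (Form.isHomog_listForm _) fun a b => ?_
  rw [mapHom_apply, Form.listForm_pair, Form.listForm_pair, affineCurvature_pair, curvature_pair,
    X_mul_C, X_pow_mul_C, evalOne_apply]
  simp
  abel

lemma mapHom_evalZero_affineCurvature :
    mapHom evalZero (D₁.affineCurvature D₀).listForm = D₀.curvature.listForm := by
  refine ext_pair ((Form.isHomog_listForm _).mapHom _) (Form.isHomog_listForm _) fun a b => ?_
  rw [mapHom_apply, Form.listForm_pair, Form.listForm_pair, affineCurvature_pair, curvature_pair,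
    evalZero_apply]
  simp

/-- The coefficients of the transgression form. -/
def transgressionForm (l : ℕ) : Form R L (2 * l + 1) (Module.End R N)[X] :=
  wedge (LinearMap.mul R (Module.End R N)[X]) ((D₁.affineCurvature D₀).pow l)
    ((monomialR 0).compAlternatingMap (D₁.diffForm D₀))

lemma mapHom_transgressionForm (l : ℕ) :
    mapHom (mapRingHom (endRestrict R N)) (D₁.transgressionForm D₀ l).listForm =
      curv (affine D₀.form
        ((endRestrict R N).toAddMonoidHom.comp (D₁.diff D₀).toAddMonoidHom)) ^ l *
      oneForm fun a => C (endRestrict R N (D₁.diff D₀ a)) := by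
  rw [transgressionForm, listForm_wedge, map_mul, listForm_pow, map_pow, mapHom_affineCurvature]
  congr 1
  ext1 w
  rw [mapHom_apply]
  rcases w with _ | ⟨a, _ | ⟨b, w⟩⟩
  · rw [Form.isHomog_listForm _ [] (by simp), map_zero]; rfl
  · have : [a] = List.ofFn ![a] := by simp
    rw [oneForm_singleton, this, Form.listForm_ofFn]
    exact map_C (endRestrict R N)
  · rw [Form.isHomog_listForm _ (a :: b :: w) (by simp), map_zero]; rfl

/-- The `R`-linear coefficient of a polynomial. -/
def coeffR {A : Type*} [Ring A] [Algebra R A] (k : ℕ) : A[X] →ₗ[R] A :=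
  (lcoeff A k).restrictScalars R

variable {tr : Module.End R N →ₗ[R] R} (h : IsLocalTrace tr)
include h

/-- The transgression formula for list forms, carried back to alternating `R`-multilinear forms, so
that its primitive defines an exact form of the algebroid. -/
lemma trace_coeff_affineCurvature (l k : ℕ) (v : Fin (2 * (l + 1)) → L) :
    tr ((((D₁.affineCurvature D₀).pow (l + 1)) v).coeff (k + 1)) =
      ((l + 1 : ℝ) / (k + 1)) • extDer (2 * l + 1)
        ((tr ∘ₗ coeffR k).compAlternatingMap (D₁.transgressionForm D₀ l)) v := by
  obtain ⟨τ, hτ⟩ := exists_trace_extension tr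
  have hmem : ∀ w, curv (affine D₀.form
      ((endRestrict R N).toAddMonoidHom.comp (D₁.diff D₀).toAddMonoidHom)) w ∈
        polySubring (endRestrict R N).range := by
    intro w k
    rw [← mapHom_affineCurvature, mapHom_apply, coe_mapRingHom, coeff_map]
    exact ⟨_, rfl⟩
  have hcomm : ∀ x ∈ (endRestrict R N).range, ∀ y ∈ (endRestrict R N).range,
      τ (x * y) = τ (y * x) := by
    rintro _ ⟨φ, rfl⟩ _ ⟨ψ, rfl⟩
    rw [← map_mul, ← map_mul, hτ, hτ]
    exact h.trace_comp_comm h ψ φ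
  have hc : ∀ (m j : ℕ) (θ : Form R L m (Module.End R N)[X]) (w : List L),
      coeffTrace τ j (mapHom (mapRingHom (endRestrict R N)) θ.listForm w) =
        tr ((θ.listForm w).coeff j) := by
    intro m j θ w
    rw [coeffTrace_apply, mapHom_apply, coe_mapRingHom, coeff_map, hτ]
  have key := trace_transgression (endRestrict R N).range τ hcomm (derAct R L) D₀.form
    ((endRestrict R N).toAddMonoidHom.comp (D₁.diff D₀).toAddMonoidHom)
    (D₀.trace_adAct_form h τ hτ) (fun a => ⟨_, rfl⟩) hmem l k (List.ofFn v)
  have h1 : curv (affine D₀.form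
      ((endRestrict R N).toAddMonoidHom.comp (D₁.diff D₀).toAddMonoidHom)) ^ (l + 1) =
      mapHom (mapRingHom (endRestrict R N)) ((D₁.affineCurvature D₀).pow (l + 1)).listForm := by
    rw [listForm_pow, map_pow, mapHom_affineCurvature]
  have h2 : ∀ u, coeffTrace τ k ((curv (affine D₀.form
      ((endRestrict R N).toAddMonoidHom.comp (D₁.diff D₀).toAddMonoidHom)) ^ l *
      oneForm fun a => C (endRestrict R N (D₁.diff D₀ a))) u) =
      Form.toList ((tr ∘ₗ coeffR k).compAlternatingMap (D₁.transgressionForm D₀ l)) u := by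
    intro u
    rw [← mapHom_transgressionForm, hc, toList_compAlternatingMap]; rfl
  rw [h1, hc, Form.listForm_ofFn] at key
  have h3 : (extDer (2 * l + 1)
      ((tr ∘ₗ coeffR k).compAlternatingMap (D₁.transgressionForm D₀ l))) v =
      cartanD (derAct R L) (List.ofFn v) (fun u => coeffTrace τ k ((curv (affine D₀.form
      ((endRestrict R N).toAddMonoidHom.comp (D₁.diff D₀).toAddMonoidHom)) ^ l *
      oneForm fun a => C (endRestrict R N (D₁.diff D₀ a))) u)) := by
    refine (Form.toList_ofFn (extDer (2 * l + 1) _) v).symm.trans ?_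
    rw [funext h2, toList_extDer]
  rw [h3]
  rw [← Nat.cast_smul_eq_nsmul ℝ, ← Nat.cast_smul_eq_nsmul ℝ] at key
  have hk : ((k + 1 : ℕ) : ℝ) ≠ 0 := by positivity
  rw [← inv_smul_smul₀ hk (tr _)]
  refine (congrArg (fun x => ((k + 1 : ℕ) : ℝ)⁻¹ • x) key).trans ?_
  rw [smul_smul, div_eq_inv_mul]
  push_cast
  rfl

/-- The forms `tr (R_∇^l)` of two connections differ by an exact form. -/
lemma exists_tracePow_sub_eq (l : ℕ) : ∃ η : Form R L (2 * l + 1) R,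
    D₁.tracePow tr (l + 1) - D₀.tracePow tr (l + 1) = extDer (2 * l + 1) η := by
  -- This is (l + 1) times the integral of tr(F_T^l α) over T from 0 to 1, term by term: T^k
  -- integrates to 1/(k + 1). The range comes from the bound 2(l + 1) for the degree of F_T^{l+1} in
  -- T.
  refine ⟨∑ k ∈ Finset.range (2 * (l + 1)), ((l + 1 : ℝ) / (k + 1)) •
    (tr ∘ₗ coeffR k).compAlternatingMap (D₁.transgressionForm D₀ l), ?_⟩
  ext v
  rw [map_sum, AlternatingMap.sub_apply]
  simp only [map_smul]
  change _ = (∑ k ∈ Finset.range (2 * (l + 1)), ((l + 1 : ℝ) / (k + 1)) • extDer (2 * l + 1)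
    ((tr ∘ₗ coeffR k).compAlternatingMap (D₁.transgressionForm D₀ l)) :
      Form R L (2 * l + 1 + 1) R) v
  rw [Form.sum_apply]
  simp only [AlternatingMap.smul_apply]
  have h1 : D₁.tracePow tr (l + 1) v =
      tr ((((D₁.affineCurvature D₀).pow (l + 1)) v).eval 1) := by
    rw [← Form.toList_ofFn (D₁.tracePow tr (l + 1)), toList_tracePow,
      ← mapHom_evalOne_affineCurvature D₁ D₀, ← map_pow, ← listForm_pow, mapHom_apply,
      Form.listForm_ofFn, evalOne_apply]
  have h0 : D₀.tracePow tr (l + 1) v =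
      tr ((((D₁.affineCurvature D₀).pow (l + 1)) v).coeff 0) := by
    rw [← Form.toList_ofFn (D₀.tracePow tr (l + 1)), toList_tracePow,
      ← mapHom_evalZero_affineCurvature D₁ D₀, ← map_pow, ← listForm_pow, mapHom_apply,
      Form.listForm_ofFn, evalZero_apply]
  have hdeg : (((D₁.affineCurvature D₀).pow (l + 1)) v).natDegree < 2 * (l + 1) + 1 := by
    rw [← Form.listForm_ofFn, listForm_pow]
    exact Nat.lt_succ_of_le (natDegree_pow_le _ 2 (D₁.natDegree_affineCurvature D₀) (l + 1) _)
  -- The value at T = 1 is the sum of all coefficients. Splitting off the constant one, which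
  -- belongs to `D₀`, leaves the coefficients k + 1.
  rw [h1, h0, eval_eq_sum_range' hdeg, Finset.sum_range_succ']
  simp only [one_pow, mul_one, map_add, map_sum, add_sub_cancel_right]
  exact Finset.sum_congr rfl fun k _ => trace_coeff_affineCurvature D₁ D₀ h l k v

end LinearConnection
end transgression

/-! ### Graded forms and their components -/

section shuffleLow

variable {L V₁ V₂ V₃ : Type*} [AddCommGroup V₁] [AddCommGroup V₂] [AddCommGroup V₃]
  (β : V₁ →+ V₂ →+ V₃)

lemma shuffle_const_right (w : List L) (θ : List L → V₁) (η : List L → V₂)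
    (h : ∀ a, iota a η = 0) : shuffle β w θ η = β (θ w) (η []) := by
  induction w generalizing θ with
  | nil => rfl
  | cons a w ih => rw [shuffle_cons, h, shuffle_zero_right, ih, add_zero]; rfl

lemma shuffle_const_left (w : List L) (θ : List L → V₁) (η : List L → V₂)
    (h : ∀ a, iota a θ = 0) (h' : hat θ = θ) : shuffle β w θ η = β (θ []) (η w) := by
  induction w generalizing η with
  | nil => rfl
  | cons a w ih => rw [shuffle_cons, h, shuffle_zero_left, h', ih, zero_add]; rfl

lemma shuffle_pair (θ : List L → V₁) (η : List L → V₂) (hθ : ∀ u, u.length ≠ 1 → θ u = 0)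
    (hη : ∀ u, u.length ≠ 1 → η u = 0) (a b : L) :
    shuffle β [a, b] θ η = β (θ [a]) (η [b]) - β (θ [b]) (η [a]) := by
  simp [shuffle, hθ [], hη [], hat_apply, hθ [a, b], hη [a, b]]
  abel

end shuffleLow

section graded

variable {R L : Type*} [CommRing R] [Algebra ℝ R] [LieRing L] [LieAlgebra ℝ L] [Module R L]
  [LieRingModule L R] [LieRinehartRing R L] [LieRinehartAlgebra ℝ R L]

/-- An element of a module as a form of degree zero. -/
def Form.ofElem {N : Type*} [AddCommGroup N] [Module R N] (e : N) : Form R L 0 N :=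
  AlternatingMap.constOfIsEmpty R L (Fin 0) e

lemma Form.ofElem_apply {N : Type*} [AddCommGroup N] [Module R N] (e : N) (v : Fin 0 → L) :
    (Form.ofElem e : Form R L 0 N) v = e := rfl

lemma Form.toList_ofElem_nil {N : Type*} [AddCommGroup N] [Module R N] (e : N) :
    (Form.ofElem e : Form R L 0 N).toList [] = e := rfl

lemma Form.eq_ofElem {N : Type*} [AddCommGroup N] [Module R N] (θ : Form R L 0 N) :
    θ = Form.ofElem (θ ![]) := by
  ext v
  rw [Form.ofElem_apply]; congr 1; exact Subsingleton.elim _ _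

lemma Form.toList_pair {N : Type*} [AddCommGroup N] [Module R N] (θ : Form R L 2 N) (a b : L) :
    θ.toList [a, b] = θ ![a, b] := by
  rw [← θ.toList_ofFn]; simp

lemma Form.toList_singleton {N : Type*} [AddCommGroup N] [Module R N] (θ : Form R L 1 N) (a : L) :
    θ.toList [a] = θ ![a] := by
  rw [← θ.toList_ofFn]; simp

lemma extDer_ofElem (f : R) (a : L) : extDer 0 (Form.ofElem f : Form R L 0 R) ![a] = ⁅a, f⁆ := by
  rw [← Form.toList_singleton (extDer 0 _), toList_extDer]
  simp [cartanD, lieD, Form.toList_ofElem_nil]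

lemma extDer_one (θ : Form R L 1 R) (a b : L) :
    extDer 1 θ ![a, b] = ⁅a, θ ![b]⁆ - ⁅b, θ ![a]⁆ - θ ![⁅a, b⁆] := by
  rw [← Form.toList_pair (extDer 1 _), toList_extDer]
  simp [cartanD, lieD, Form.toList_singleton]
  abel

variable {n : ℕ} {N : Fin n → Type*} [∀ i, AddCommGroup (N i)] [∀ i, Module R (N i)]
  [∀ i, Module ℝ (N i)] [∀ i, IsScalarTower ℝ R (N i)]

/-- The inclusion of `Ω^p(A, E_j)` into the graded forms. -/
def incl (j : Fin n) (p : ℕ) : Form R L p (N j) →+ GradedForm R L N :=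
  DirectSum.of (fun s : Fin n × ℕ => Form R L s.2 (N s.1)) (j, p)

/-- The component of a graded form in `Ω^q(A, E_i)`. -/
def component (i : Fin n) (q : ℕ) : GradedForm R L N →ₗ[ℝ] Form R L q (N i) :=
  DirectSum.component ℝ (Fin n × ℕ) (fun s => Form R L s.2 (N s.1)) (i, q)

lemma component_incl_same (j : Fin n) (p : ℕ) (η : Form R L p (N j)) :
    component j p (incl j p η) = η :=
  DirectSum.of_eq_same _ _

lemma component_incl_of_ne (j : Fin n) (p : ℕ) (η : Form R L p (N j)) (i : Fin n) (q : ℕ)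
    (h : (i, q) ≠ (j, p)) : component i q (incl j p η) = 0 :=
  DirectSum.of_eq_of_ne _ _ _ h

lemma incl_congr (j : Fin n) {p q : ℕ} (h : q = p) (η : Form R L q (N j)) (η' : Form R L p (N j))
    (hη : η.toList = η'.toList) : incl j q η = incl j p η' := by
  subst h
  rw [Form.toList_injective hη]

lemma gradedWedge_incl {k : ℕ} (θ : Form R L k R) (j : Fin n) (p : ℕ) (η : Form R L p (N j)) :
    gradedWedge θ (incl j p η) = incl j (k + p) (wedge (LinearMap.lsmul R (N j)) θ η) := by
  unfold gradedWedge incl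
  rw [← DirectSum.lof_eq_of ℝ, DirectSum.toModule_lof]
  rfl

lemma gradedForm_induction {P : GradedForm R L N → Prop} (h0 : P 0)
    (h : ∀ j p (η : Form R L p (N j)), P (incl j p η)) (hadd : ∀ x y, P x → P y → P (x + y))
    (x : GradedForm R L N) : P x :=
  DirectSum.induction_on x h0 (fun s η => h s.1 s.2 η) hadd

lemma component_gradedWedge_of_lt {k : ℕ} (θ : Form R L k R) (x : GradedForm R L N) (i : Fin n)
    (q : ℕ) (hq : q < k) : component i q (gradedWedge θ x) = 0 := by
  induction x using gradedForm_induction with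
  | h0 => simp
  | h j p η =>
    rw [gradedWedge_incl, component_incl_of_ne]
    intro h
    rw [Prod.mk.injEq] at h
    omega
  | hadd x y hx hy => rw [map_add, map_add, hx, hy, add_zero]

lemma component_gradedWedge {k : ℕ} (θ : Form R L k R) (x : GradedForm R L N) (i : Fin n) (p : ℕ) :
    component i (k + p) (gradedWedge θ x) = wedgeLeft θ p (component i p x) := by
  induction x using gradedForm_induction with
  | h0 => simp
  | h j p' η =>
    rw [gradedWedge_incl]
    by_cases h : (i, p) = (j, p')
    · rw [Prod.mk.injEq] at h
      obtain ⟨rfl, rfl⟩ := h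
      rw [component_incl_same, component_incl_same]; rfl
    · rw [component_incl_of_ne _ _ _ _ _ h, map_zero, component_incl_of_ne]
      intro h'
      rw [Prod.mk.injEq] at h h'
      exact h ⟨h'.1, by omega⟩
  | hadd x y hx hy => rw [map_add, map_add, hx, hy, map_add, map_add]

lemma toList_component_gradedWedge {k : ℕ} (θ : Form R L k R) (x : GradedForm R L N) (i : Fin n)
    {p q : ℕ} (h : q = k + p) (w : List L) :
    (component i q (gradedWedge θ x)).toList w =
      shuffle (biadd (LinearMap.lsmul R (N i))) w θ.toList (component i p x).toList := by
  subst h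
  rw [component_gradedWedge]
  exact congrFun (toList_wedge _ θ (component i p x)) w

lemma component_gradedWedge_ofElem (f : R) (x : GradedForm R L N) (i : Fin n) (q : ℕ)
    (v : Fin q → L) : component i q (gradedWedge (Form.ofElem f) x) v = f • component i q x v := by
  rw [← Form.toList_ofFn, toList_component_gradedWedge _ _ _ (zero_add q).symm,
    shuffle_const_left _ _ _ _ (iota_toList_zero _) (by simp [hat_toList]), Form.toList_ofFn]
  rfl

lemma component_gradedWedge_self {k : ℕ} (θ : Form R L k R) (x : GradedForm R L N) (i : Fin n)
    (v : Fin k → L) :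
    component i k (gradedWedge θ x) v = θ v • component i 0 x ![] := by
  rw [← Form.toList_ofFn, toList_component_gradedWedge _ _ _ (add_zero k).symm,
    shuffle_const_right _ _ _ _ (iota_toList_zero _), Form.toList_ofFn,
    (component i 0 x).eq_ofElem]
  rfl

lemma component_gradedWedge_pair (θ : Form R L 1 R) (x : GradedForm R L N) (i : Fin n) (a b : L) :
    component i 2 (gradedWedge θ x) ![a, b] =
      θ ![a] • component i 1 x ![b] - θ ![b] • component i 1 x ![a] := by
  rw [← Form.toList_pair, toList_component_gradedWedge _ _ _ (show 2 = 1 + 1 from rfl),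
    shuffle_pair _ _ _ θ.toList_of_ne (component i 1 x).toList_of_ne]
  simp only [Form.toList_singleton]
  rfl

lemma gradedWedge_ofElem_incl (f : R) (j : Fin n) (p : ℕ) (η : Form R L p (N j)) :
    gradedWedge (Form.ofElem f) (incl j p η) = incl j p (f • η) := by
  rw [gradedWedge_incl]
  refine incl_congr j (zero_add p) _ _ ?_
  rw [toList_wedge]
  ext1 w
  rw [shuffle_const_left _ _ _ _ (iota_toList_zero _) (by simp [hat_toList])]
  exact (congrFun (toList_compAlternatingMap (f • LinearMap.id) η) w).symm

/-- Forms with values in a module are locally sums of products of scalar forms and elements. -/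
lemma incl_smul_eq_sum {r : ℕ} (j : Fin n) (f : R) (g : Fin r → N j) (c : Fin r → N j →ₗ[R] R)
    (hs : ∀ s, f • s = ∑ k, c k s • g k) (p : ℕ) (η : Form R L p (N j)) :
    incl j p (f • η) = ∑ k, gradedWedge ((c k).compAlternatingMap η)
      (incl j 0 (Form.ofElem (g k) : Form R L 0 (N j))) := by
  have h : f • η = ∑ k, (wedge (LinearMap.lsmul R (N j)) ((c k).compAlternatingMap η)
      (Form.ofElem (g k)) : Form R L p (N j)) := by
    ext v
    rw [Form.sum_apply, AlternatingMap.smul_apply, hs]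
    refine Finset.sum_congr rfl fun k _ => ?_
    refine Eq.trans ?_ (Form.toList_ofFn _ v)
    change _ = Form.toList (wedge (LinearMap.lsmul R (N j)) ((c k).compAlternatingMap η)
      (Form.ofElem (g k))) (List.ofFn v)
    rw [toList_wedge]
    change _ = shuffle _ _ _ _
    rw [shuffle_const_right _ _ _ _ (iota_toList_zero _), Form.toList_ofFn]
    rfl
  rw [h, map_sum]
  refine Finset.sum_congr rfl fun k _ => ?_
  rw [gradedWedge_incl]; rfl

end graded

/-! ### The components of a connection up to homotopy -/

section homotopyConnection

variable {R L : Type*} [CommRing R] [Algebra ℝ R] [LieRing L] [LieAlgebra ℝ L] [Module R L]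
  [LieRingModule L R] [LieRinehartRing R L] [LieRinehartAlgebra ℝ R L]
  {n : ℕ} {N : Fin n → Type*} [∀ i, AddCommGroup (N i)] [∀ i, Module R (N i)]
  [∀ i, Module ℝ (N i)] [∀ i, IsScalarTower ℝ R (N i)]

namespace HomotopyConnection

variable (D : HomotopyConnection R L N)

/-- The component of `𝒟 e` in `Ω^q(A, E_j)`, for `e ∈ Γ(E_i)`. -/
def comp (i j : Fin n) (q : ℕ) (e : N i) : Form R L q (N j) :=
  component j q (D.toLinearMap (incl i 0 (Form.ofElem e : Form R L 0 (N i))))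

lemma degree_incl (j : Fin n) (p : ℕ) (η : Form R L p (N j)) (i : Fin n) (q : ℕ)
    (h : component i q (D.toLinearMap (incl j p η)) ≠ 0) : q + i = p + j + 1 := by
  refine D.degree_one (p + j) (incl j p η) (fun s hs => ?_) (i, q) h
  by_contra hne
  refine hs (component_incl_of_ne j p η s.1 s.2 fun h => hne ?_)
  rw [Prod.mk.injEq] at h
  rw [h.1, h.2]

lemma comp_add (i j : Fin n) (q : ℕ) (e e' : N i) :
    D.comp i j q (e + e') = D.comp i j q e + D.comp i j q e' := by
  have h : (Form.ofElem (e + e') : Form R L 0 (N i)) = Form.ofElem e + Form.ofElem e' := rfl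
  rw [comp, h, map_add, map_add, map_add]; rfl

lemma comp_real_smul (i j : Fin n) (q : ℕ) (c : ℝ) (e : N i) :
    D.comp i j q (c • e) = c • D.comp i j q e := by
  have h : incl i 0 (Form.ofElem (c • e) : Form R L 0 (N i)) =
      c • incl i 0 (Form.ofElem e : Form R L 0 (N i)) :=
    (DirectSum.lof ℝ (Fin n × ℕ) (fun s => Form R L s.2 (N s.1)) (i, 0)).map_smul c
      (Form.ofElem e : Form R L 0 (N i))
  rw [comp, h, map_smul, map_smul]; rfl

lemma toLinearMap_incl_smul (f : R) (j : Fin n) (p : ℕ) (η : Form R L p (N j)) :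
    D.toLinearMap (incl j p (f • η)) =
      gradedWedge (extDer 0 (Form.ofElem f)) (incl j p η) +
        gradedWedge (Form.ofElem f) (D.toLinearMap (incl j p η)) := by
  rw [← gradedWedge_ofElem_incl, D.leibniz, pow_zero, one_smul]

/-- The defect of linearity over functions is df ∧ e, which lives in form degree one and in E_i. So
only the diagonal component of form degree one is a connection; ∂ and ω are linear. -/
lemma comp_smul_apply (i j : Fin n) (q : ℕ) (f : R) (e : N i) (v : Fin q → L) :
    D.comp i j q (f • e) v =
      component j q (gradedWedge (extDer 0 (Form.ofElem f))
        (incl i 0 (Form.ofElem e : Form R L 0 (N i)))) v +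
        f • D.comp i j q e v := by
  have h : (Form.ofElem (f • e) : Form R L 0 (N i)) = f • Form.ofElem e := rfl
  rw [comp, h, toLinearMap_incl_smul, map_add, AlternatingMap.add_apply,
    component_gradedWedge_ofElem]
  rfl

/-- The component `∂ : Γ(E_i) → Γ(E_j)` of `𝒟`. -/
def bdry (i j : Fin n) : N i →ₗ[R] N j where
  toFun e := D.comp i j 0 e ![]
  map_add' e e' := by rw [comp_add]; rfl
  map_smul' f e := by
    rw [comp_smul_apply, component_gradedWedge_of_lt _ _ _ _ zero_lt_one]
    simp

/-- The component `Γ(E_i) → Γ(E_j)` of `𝒟` of form degree two, at a pair of elements. -/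
def htpy (a b : L) (i j : Fin n) : N i →ₗ[R] N j where
  toFun e := D.comp i j 2 e ![a, b]
  map_add' e e' := by rw [comp_add]; rfl
  map_smul' f e := by
    rw [comp_smul_apply, component_gradedWedge_pair, component_incl_of_ne _ _ _ _ _ (by simp)]
    simp

/-- The linear connection on `E_i` that is a component of `𝒟`. -/
def conn (i : Fin n) : LinearConnection R L (N i) where
  nabla :=
    { toFun := fun a =>
        { toFun := fun e => D.comp i i 1 e ![a]
          map_add' := fun e e' => by rw [comp_add]; rfl
          map_smul' := fun c e => by rw [comp_real_smul]; rfl }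
      map_add' := fun a b => by
        ext e
        exact (D.comp i i 1 e).map_vecCons_add ![] a b
      map_smul' := fun f a => by
        ext e
        exact (D.comp i i 1 e).map_vecCons_smul ![] f a }
  leibniz a f e := by
    change D.comp i i 1 (f • e) ![a] = f • D.comp i i 1 e ![a] + _
    rw [comp_smul_apply, component_gradedWedge_self, component_incl_same, extDer_ofElem, add_comm]; rfl

lemma conn_nabla (i : Fin n) (a : L) (e : N i) : (D.conn i).nabla a e = D.comp i i 1 e ![a] := rfl

lemma bdry_ne_zero {i j : Fin n} (h : D.bdry i j ≠ 0) : (j : ℕ) = i + 1 := by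
  have : ∃ e, D.comp i j 0 e ≠ 0 := by
    by_contra! h0
    exact h (by ext e; change D.comp i j 0 e ![] = 0; rw [h0]; rfl)
  obtain ⟨e, he⟩ := this
  have := D.degree_incl i 0 _ j 0 he
  omega

variable {tr : ∀ i, Module.End R (N i) →ₗ[R] R} (htr : ∀ i, IsLocalTrace (tr i))

/-- The operator `𝒟` is local. -/
lemma smul_component_incl {r : ℕ} (j : Fin n) (f : R) (g : Fin r → N j) (c : Fin r → N j →ₗ[R] R)
    (hs : ∀ s, f • s = ∑ k, c k s • g k) (p : ℕ) (η : Form R L p (N j)) (i : Fin n) (q : ℕ)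
    (v : Fin q → L) :
    f • component i q (D.toLinearMap (incl j p η)) v =
      ∑ k, (component i q (gradedWedge (extDer p ((c k).compAlternatingMap η))
          (incl j 0 (Form.ofElem (g k) : Form R L 0 (N j)))) v +
        (-1 : ℝ) ^ p • component i q (gradedWedge ((c k).compAlternatingMap η)
          (D.toLinearMap (incl j 0 (Form.ofElem (g k) : Form R L 0 (N j))))) v) -
      component i q (gradedWedge (extDer 0 (Form.ofElem f)) (incl j p η)) v := by
  have h := D.toLinearMap_incl_smul f j p η
  rw [incl_smul_eq_sum j f g c hs, map_sum] at h
  simp only [D.leibniz] at h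
  have h' := congrArg (fun x : GradedForm R L N => component i q x v) h
  simp only [map_sum, Form.sum_apply, map_add, AlternatingMap.add_apply, map_smul,
    AlternatingMap.smul_apply, component_gradedWedge_ofElem] at h'
  rw [h', add_sub_cancel_left]

include htr

/-- The operator does not lower form degree: locally η is a sum of products θ ∧ g with θ of degree
p, and both terms of the Leibniz rule keep a scalar factor of degree at least p. -/
lemma component_incl_of_lt (j : Fin n) (p : ℕ) (η : Form R L p (N j)) (i : Fin n) (q : ℕ)
    (hq : q < p) : component i q (D.toLinearMap (incl j p η)) = 0 := by
  ext v
  refine (htr j).eq_of_smul (htr i) fun f hf => ?_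
  obtain ⟨r, g, c, hs, -⟩ := hf
  have h1 : component i q (gradedWedge (extDer 0 (Form.ofElem f)) (incl j p η)) v = 0 := by
    cases q with
    | zero => rw [component_gradedWedge_of_lt _ _ _ _ zero_lt_one]; rfl
    | succ q =>
      rw [← Form.toList_ofFn, toList_component_gradedWedge _ _ _ (add_comm q 1),
        component_incl_of_ne _ _ _ _ _ (by simp; omega)]
      rw [Form.toList_zero]
      exact shuffle_zero_right (biadd (LinearMap.lsmul R (N i))) _ _
  rw [D.smul_component_incl j f g c hs, h1, sub_zero]
  refine (Finset.sum_eq_zero fun k _ => ?_).trans (smul_zero f).symm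
  rw [component_gradedWedge_of_lt _ _ _ _ (by omega), component_gradedWedge_of_lt _ _ _ _ hq]
  simp

/-- For θ ∧ g the term dθ ∧ g has degree p + 1, so only (-1)^p θ ∧ ∂g stays in degree p. -/
lemma component_incl_self (j : Fin n) (p : ℕ) (η : Form R L p (N j)) (i : Fin n) (v : Fin p → L) :
    component i p (D.toLinearMap (incl j p η)) v = (-1 : ℝ) ^ p • D.bdry j i (η v) := by
  refine (htr j).eq_of_smul (htr i) fun f hf => ?_
  obtain ⟨r, g, c, hs, -⟩ := hf
  have h1 : component i p (gradedWedge (extDer 0 (Form.ofElem f)) (incl j p η)) v = 0 := by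
    cases p with
    | zero => rw [component_gradedWedge_of_lt _ _ _ _ zero_lt_one]; rfl
    | succ p =>
      rw [← Form.toList_ofFn, toList_component_gradedWedge _ _ _ (add_comm p 1),
        component_incl_of_ne _ _ _ _ _ (by simp)]
      rw [Form.toList_zero]
      exact shuffle_zero_right (biadd (LinearMap.lsmul R (N i))) _ _
  rw [D.smul_component_incl j f g c hs, h1, sub_zero, smul_comm, ← map_smul, hs, map_sum,
    Finset.smul_sum]
  refine Finset.sum_congr rfl fun k _ => ?_
  rw [component_gradedWedge_of_lt _ _ _ _ (Nat.lt_succ_self p), component_gradedWedge_self, map_smul]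
  exact zero_add _

/-- On one-forms with values in the same bundle, the component that raises form degree by one is the
covariant differential d^∇: the Leibniz rule for `𝒟` and that for ∇ give the same local expansion.
-/
lemma component_incl_pair (j : Fin n) (η : Form R L 1 (N j)) (a b : L) :
    component j 2 (D.toLinearMap (incl j 1 η)) ![a, b] =
      (D.conn j).nabla a (η ![b]) - (D.conn j).nabla b (η ![a]) - η ![⁅a, b⁆] := by
  refine (htr j).eq_of_smul (htr j) fun f hf => ?_
  obtain ⟨r, g, c, hs, -⟩ := hf
  rw [D.smul_component_incl j f g c hs]
  have hn : ∀ (x : L) (e : N j), f • (D.conn j).nabla x e =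
      ∑ k, (c k e • (D.conn j).nabla x (g k) + ⁅x, c k e⁆ • g k) - ⁅x, f⁆ • e := by
    intro x e
    have h := (D.conn j).leibniz x f e
    rw [hs, map_sum] at h
    simp only [(D.conn j).leibniz] at h
    rw [h, add_sub_cancel_right]
  simp only [component_gradedWedge_pair, component_gradedWedge_self, extDer_one,
    component_incl_same, extDer_ofElem, smul_sub, hn]
  rw [hs (η ![⁅a, b⁆])]
  have hc : ∀ k x, component j 1 (D.toLinearMap
      (incl j 0 (Form.ofElem (g k) : Form R L 0 (N j)))) ![x] = (D.conn j).nabla x (g k) :=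
    fun _ _ => rfl
  simp only [hc, Form.ofElem_apply, LinearMap.compAlternatingMap_apply, pow_one, neg_smul, one_smul,
    sub_smul, Finset.sum_add_distrib, Finset.sum_sub_distrib, Finset.sum_neg_distrib]
  abel

/-- The components of `𝒟 ∘ 𝒟`, as sums over the components of `𝒟`. -/
lemma sum_component_eq_zero (hD : D.IsRepresentation) (i j : Fin n) (e : N i) (q : ℕ) :
    ∑ k : Fin n, ∑ p ∈ Finset.range (q + 1),
      component j q (D.toLinearMap (incl k p (D.comp i k p e))) = 0 := by
  classical
  set y := D.toLinearMap (incl i 0 (Form.ofElem e : Form R L 0 (N i))) with hy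
  have h0 : D.toLinearMap y = 0 := LinearMap.congr_fun hD _
  set F : Fin n × ℕ → Form R L q (N j) := fun s =>
    component j q (D.toLinearMap (incl s.1 s.2 (component s.1 s.2 y))) with hF
  have h1 : ∑ s ∈ DFinsupp.support y, F s = 0 := by
    have h2 := congrArg (fun x => component j q (D.toLinearMap x)) (DirectSum.sum_support_of y)
    simp only [map_sum, h0, map_zero] at h2
    exact h2
  rw [← Finset.sum_product', ← h1]
  refine Finset.sum_congr_of_eq_on_inter ?_ ?_ fun _ _ _ => rfl
  · intro s _ hs
    have : component s.1 s.2 y = 0 := by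
      by_contra hne
      exact hs (DFinsupp.mem_support_iff.2 hne)
    change component j q (D.toLinearMap (incl s.1 s.2 (component s.1 s.2 y))) = 0
    rw [this, map_zero, map_zero, map_zero]
  · intro s _ hs
    -- Outside the range the form degree exceeds q, and `𝒟` cannot return to q.
    refine D.component_incl_of_lt htr _ _ _ _ _ ?_
    simpa using hs

/-- The component `∂` of a representation up to homotopy is compatible with the connections. -/
lemma bdry_nabla (hD : D.IsRepresentation) (i j : Fin n) (a : L) (e : N i) :
    D.bdry i j ((D.conn i).nabla a e) = (D.conn j).nabla a (D.bdry i j e) := by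
  have h := congrArg (fun θ : Form R L 1 (N j) => θ ![a]) (D.sum_component_eq_zero htr hD i j e 1)
  simp only [Finset.sum_range_succ, Finset.sum_range_zero, zero_add, Finset.sum_add_distrib,
    AlternatingMap.add_apply, Form.sum_apply, D.component_incl_self htr, pow_one] at h
  -- Total degree leaves one index in each sum: ∂ first and then the connection on E_j, or the
  -- connection on E_i first and then -∂.
  rw [Finset.sum_eq_single j, Finset.sum_eq_single i] at h
  · rw [(D.comp i j 0 e).eq_ofElem] at h
    rw [← sub_eq_zero, ← neg_eq_zero, neg_sub, sub_eq_add_neg]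
    rw [neg_smul, one_smul] at h
    exact h
  · intro k _ hk
    have : D.comp i k 1 e = 0 := by
      by_contra hne
      have := D.degree_incl i 0 _ k 1 hne
      exact hk (Fin.ext (by omega))
    rw [this, AlternatingMap.zero_apply, map_zero, smul_zero]
  · simp
  · intro k _ hk
    by_contra hne
    have h2 : D.comp i k 0 e ≠ 0 := by
      intro h0
      rw [h0, map_zero, map_zero, map_zero] at hne
      exact hne rfl
    have h3 := D.degree_incl i 0 _ k 0 h2
    have h4 : component j 1 (D.toLinearMap (incl k 0 (D.comp i k 0 e))) ≠ 0 := by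
      intro h0
      rw [h0] at hne
      exact hne rfl
    have h5 := D.degree_incl k 0 _ j 1 h4
    exact hk (Fin.ext (by omega))
  · simp

/-- The curvature of the connections is homotopic to zero. -/
lemma curvatureOp_conn (hD : D.IsRepresentation) (i : Fin n) (a b : L) (e : N i) :
    (D.conn i).curvatureOp a b e =
      -∑ k, (D.htpy a b k i (D.bdry i k e) + D.bdry k i (D.htpy a b i k e)) := by
  have h := congrArg (fun θ : Form R L 2 (N i) => θ ![a, b])
    (D.sum_component_eq_zero htr hD i i e 2)
  simp only [Finset.sum_range_succ, Finset.sum_range_zero, zero_add, Finset.sum_add_distrib,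
    AlternatingMap.add_apply, Form.sum_apply, D.component_incl_self htr] at h
  -- The intermediate terms of form degree one survive only for k = i, where they give d^∇(∇e),
  -- which is the curvature. The terms of form degree zero and two give ω∂ and ∂ω.
  rw [Finset.sum_eq_single (f := fun k =>
    component i 2 (D.toLinearMap (incl k 1 (D.comp i k 1 e))) ![a, b]) i,
    D.component_incl_pair htr] at h
  · have h1 : ∀ k, component i 2 (D.toLinearMap (incl k 0 (D.comp i k 0 e))) ![a, b] =
        D.htpy a b k i (D.bdry i k e) := by
      intro k
      rw [(D.comp i k 0 e).eq_ofElem]; rfl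
    simp only [h1] at h
    rw [eq_neg_iff_add_eq_zero, Finset.sum_add_distrib]
    refine Eq.trans ?_ h
    have h2 : ∀ k, (-1 : ℝ) ^ 2 • D.bdry k i (D.comp i k 2 e ![a, b]) =
        D.bdry k i (D.htpy a b i k e) := fun k => by simp; rfl
    simp only [h2]
    change (D.conn i).nabla a ((D.conn i).nabla b e) - (D.conn i).nabla b ((D.conn i).nabla a e) -
      (D.conn i).nabla ⁅a, b⁆ e + _ = _
    simp only [conn_nabla]
    abel
  · intro k _ hk
    have : D.comp i k 1 e = 0 := by
      by_contra hne
      have := D.degree_incl i 0 _ k 1 hne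
      exact hk (Fin.ext (by omega))
    rw [this, map_zero, map_zero, map_zero]; rfl
  · simp

end HomotopyConnection
end homotopyConnection

/-! ### Vanishing of the supertrace -/

section supertrace
open ListForm

variable {R L : Type*} [CommRing R] [Algebra ℝ R] [LieRing L] [LieAlgebra ℝ L] [Module R L]
  [LieRingModule L R] [LieRinehartRing R L] [LieRinehartAlgebra ℝ R L]
  {n : ℕ} {N : Fin n → Type*} [∀ i, AddCommGroup (N i)] [∀ i, Module R (N i)]
  [∀ i, Module ℝ (N i)] [∀ i, IsScalarTower ℝ R (N i)]

namespace HomotopyConnection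

/-- The supertrace of a family of endomorphisms. -/
def supertrace (tr : ∀ i, Module.End R (N i) →ₗ[R] R) : (∀ i, Module.End R (N i)) →+ R :=
  AddMonoidHom.mk' (fun φ => ∑ i : Fin n, (-1 : ℝ) ^ (i : ℕ) • tr i (φ i)) fun φ ψ => by
    simp [Finset.sum_add_distrib]

lemma supertrace_apply (tr : ∀ i, Module.End R (N i) →ₗ[R] R) (φ : ∀ i, Module.End R (N i)) :
    supertrace tr φ = ∑ i : Fin n, (-1 : ℝ) ^ (i : ℕ) • tr i (φ i) := rfl

variable (D : HomotopyConnection R L N)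

/-- The families of endomorphisms that commute with `∂`. -/
def bdryCommutant : Subring (∀ i, Module.End R (N i)) where
  carrier := {φ | ∀ i j e, D.bdry i j (φ i e) = φ j (D.bdry i j e)}
  mul_mem' {φ ψ} hφ hψ i j e := by simp [hφ i j, hψ i j]
  one_mem' i j e := rfl
  add_mem' {φ ψ} hφ hψ i j e := by simp [hφ i j, hψ i j]
  zero_mem' i j e := by simp
  neg_mem' {φ} hφ i j e := by simp [hφ i j]

/-- The family of the curvatures of the connections `D.conn i`. -/
def curvatureFamily : ListForm L (∀ i, Module.End R (N i)) :=
  fun w i => (D.conn i).curvature.listForm w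

lemma curvatureFamily_pow_apply (l : ℕ) (w : List L) (i : Fin n) :
    (D.curvatureFamily ^ l) w i = ((D.conn i).curvature.listForm ^ l) w := by
  have h : mapHom (Pi.evalRingHom (fun i => Module.End R (N i)) i) D.curvatureFamily =
      (D.conn i).curvature.listForm := rfl
  rw [← h, ← map_pow]; rfl

lemma curvatureFamily_of_ne (w : List L) (hw : w.length ≠ 2) : D.curvatureFamily w = 0 :=
  funext fun i => (D.conn i).curvature.isHomog_listForm w hw

lemma curvatureFamily_pair (a b : L) (i : Fin n) :
    D.curvatureFamily [a, b] i = (D.conn i).curvatureOp a b := by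
  rw [← LinearConnection.curvature_pair, ← Form.listForm_pair]; rfl

variable {tr : ∀ i, Module.End R (N i) →ₗ[R] R} (htr : ∀ i, IsLocalTrace (tr i))
  (hD : D.IsRepresentation)
include htr hD

lemma curvatureFamily_mem (w : List L) : D.curvatureFamily w ∈ D.bdryCommutant := by
  by_cases hw : w.length = 2
  · obtain ⟨a, b, rfl⟩ := List.length_eq_two.1 hw
    intro i j e
    rw [curvatureFamily_pair, curvatureFamily_pair]
    change D.bdry i j ((D.conn i).nabla a ((D.conn i).nabla b e) -
        (D.conn i).nabla b ((D.conn i).nabla a e) - (D.conn i).nabla ⁅a, b⁆ e) = _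
    simp only [map_sub, D.bdry_nabla htr hD]
    rfl
  · rw [D.curvatureFamily_of_ne w hw]
    exact D.bdryCommutant.zero_mem

/-- The curvature is a supercommutator of ∂ and ω up to sign, and φ commutes with ∂, so the product
is one too; the supertrace kills it. -/
lemma supertrace_mul_curvatureFamily (φ : ∀ i, Module.End R (N i)) (hφ : φ ∈ D.bdryCommutant)
    (w : List L) : supertrace tr (φ * D.curvatureFamily w) = 0 := by
  by_cases hw : w.length = 2
  · obtain ⟨a, b, rfl⟩ := List.length_eq_two.1 hw
    have h1 : ∀ i, (φ * D.curvatureFamily [a, b]) i =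
        -∑ k, (φ i ∘ₗ D.htpy a b k i ∘ₗ D.bdry i k + φ i ∘ₗ D.bdry k i ∘ₗ D.htpy a b i k) := by
      intro i
      ext e
      rw [Pi.mul_apply, curvatureFamily_pair, Module.End.mul_apply, D.curvatureOp_conn htr hD]
      simp
    -- Move ∂ to the left past φ, then around the trace to the right end; the trace passes from E_i
    -- to E_k.
    have h2 : ∀ i k, tr i (φ i ∘ₗ D.bdry k i ∘ₗ D.htpy a b i k) =
        tr k (φ k ∘ₗ D.htpy a b i k ∘ₗ D.bdry k i) := by
      intro i k
      have : φ i ∘ₗ D.bdry k i ∘ₗ D.htpy a b i k = D.bdry k i ∘ₗ (φ k ∘ₗ D.htpy a b i k) := by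
        ext e
        exact (hφ k i _).symm
      rw [this, (htr i).trace_comp_comm (htr k)]
      rfl
    rw [supertrace_apply]
    simp only [h1, map_neg, map_sum, map_add, h2, smul_neg, Finset.sum_neg_distrib, neg_eq_zero,
      Finset.smul_sum, smul_add, Finset.sum_add_distrib]
    rw [Finset.sum_comm (f := fun (i k : Fin n) =>
      (-1 : ℝ) ^ (i : ℕ) • tr k (φ k ∘ₗ D.htpy a b i k ∘ₗ D.bdry k i)), ← Finset.sum_add_distrib]
    refine Finset.sum_eq_zero fun i _ => ?_
    rw [← Finset.sum_add_distrib]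
    refine Finset.sum_eq_zero fun k _ => ?_
    -- A nonzero ∂ from E_i to E_k forces k = i + 1, which makes the two signs opposite.
    by_cases h : D.bdry i k = 0
    · simp [h]
    · rw [D.bdry_ne_zero h, pow_succ, mul_neg_one, neg_smul, add_neg_cancel]
  · rw [D.curvatureFamily_of_ne w hw, mul_zero, map_zero]

/-- The alternating sum of the traces of the powers of the curvatures vanishes. -/
lemma sum_tracePow_conn (l : ℕ) :
    ∑ i : Fin n, (-1 : ℝ) ^ (i : ℕ) • (D.conn i).tracePow (tr i) (l + 1) = 0 := by
  ext v
  have h : (D.curvatureFamily ^ (l + 1)) (List.ofFn v) ∈ (supertrace tr).ker := by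
    rw [pow_succ]
    -- Each term of the shuffle product R^l R is a value of R^l, which commutes with ∂, times a
    -- value of R, so every term has supertrace zero.
    exact shuffle_mem _ _ _ _ _ fun u u' => D.supertrace_mul_curvatureFamily htr hD _
      (pow_apply_mem D.bdryCommutant _ (D.curvatureFamily_mem htr hD) l u) u'
  rw [AddMonoidHom.mem_ker, supertrace_apply] at h
  rw [Form.sum_apply, AlternatingMap.zero_apply, ← h]
  refine Finset.sum_congr rfl fun i _ => ?_
  rw [AlternatingMap.smul_apply, ← Form.toList_ofFn, LinearConnection.toList_tracePow,
    curvatureFamily_pow_apply]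

end HomotopyConnection
end supertrace

/-! ### The fibrewise trace is local -/

section geometry

variable {EM : Type*} [NormedAddCommGroup EM] [NormedSpace ℝ EM]
  {H : Type*} [TopologicalSpace H] {I : ModelWithCorners ℝ EM H}
  {M : Type*} [TopologicalSpace M] [ChartedSpace H M]
  {F : Type*} [NormedAddCommGroup F] [NormedSpace ℝ F]
  {E : M → Type*} [TopologicalSpace (TotalSpace F E)] [∀ x, TopologicalSpace (E x)]
  [∀ x, AddCommGroup (E x)] [∀ x, Module ℝ (E x)] [FiberBundle F E] [VectorBundle ℝ F E]
  [FiniteDimensional ℝ EM] [IsManifold I ∞ M] [T2Space M] [FiniteDimensional ℝ F]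
  [ContMDiffVectorBundle ∞ F E I]

lemma exists_isLocalizer_bundleTrace (x : M) : ∃ f : C^∞⟮I, M; ℝ⟯, f x = 1 ∧
    IsLocalizer (bundleTrace (I := I) (F := F) (E := E)) f := by
  obtain ⟨U, hU, hx, g, b, hb, hc⟩ := exists_global_frame (I := I) (F := F) (E := E) x
  choose c hc using hc
  obtain ⟨ψ, -, hψ⟩ := (SmoothBumpFunction.nhds_basis_tsupport (I := I) x).mem_iff.1
    (hU.mem_nhds hx)
  have h0 : ∀ y ∉ U, ψ y = 0 := fun y hy => by
    by_contra h
    exact hy (hψ (subset_tsupport _ h))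
  let f : C^∞⟮I, M; ℝ⟯ := ⟨ψ, ψ.contMDiff⟩
  have hf : ∀ y ∉ U, f y = 0 := h0
  -- The chosen coefficient functions `c s k` are constrained only on `U`, hence need not be linear
  -- in `s`. Multiplication by the bump function, which vanishes off `U`, makes them so.
  refine ⟨f, ψ.eq_one, _, g, fun k =>
    { toFun := fun s => f * c s k
      map_add' := fun s t => ?_
      map_smul' := fun h s => ?_ }, fun s => ?_, fun φ => ?_⟩
  · ext y
    change f y * c (s + t) k y = f y * c s k y + f y * c t k y
    by_cases hy : y ∈ U
    · rw [hc _ y hy, hc _ y hy, hc _ y hy, section_add_apply, map_add, Finsupp.add_apply, mul_add]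
    · simp [hf y hy]
  · ext y
    change f y * c (h • s) k y = h y * (f y * c s k y)
    by_cases hy : y ∈ U
    · rw [hc _ y hy, hc _ y hy, section_smul_apply, map_smul, Finsupp.smul_apply, smul_eq_mul]
      ring
    · simp [hf y hy]
  · ext y
    rw [section_sum_apply, section_smul_apply]
    change _ = ∑ k, (f y * c s k y) • g k y
    by_cases hy : y ∈ U
    · conv_lhs => rw [← (b y hy).sum_repr (s y), Finset.smul_sum]
      refine Finset.sum_congr rfl fun k _ => ?_
      rw [hb, hc _ y hy, mul_smul]
    · simp [hf y hy]
  · ext y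
    have hs : (∑ k, f * c (φ (g k)) k) y = ∑ k, f y * c (φ (g k)) k y :=
      map_sum (ContMDiffMap.evalRingHom y) _ _
    refine Eq.trans ?_ hs.symm
    change f y * LinearMap.trace ℝ (E y) (fiberMap φ y) = _
    by_cases hy : y ∈ U
    · rw [LinearMap.trace_eq_matrix_trace ℝ (b y hy), Matrix.trace, Finset.mul_sum]
      refine Finset.sum_congr rfl fun k _ => ?_
      rw [hc _ y hy, Matrix.diag_apply, LinearMap.toMatrix_apply, hb, fiberMap_apply]
    · simp [hf y hy]

lemma isLocalTrace_bundleTrace : IsLocalTrace (bundleTrace (I := I) (F := F) (E := E)) where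
  eq_zero_of_mul h hh := by
    ext x
    obtain ⟨f, hf, hl⟩ := exists_isLocalizer_bundleTrace (I := I) (F := F) (E := E) x
    have : f x * h x = 0 := congrArg (fun u : C^∞⟮I, M; ℝ⟯ => u x) (hh f hl)
    rwa [hf, one_mul] at this
  eq_zero_of_smul e hh := by
    ext x
    obtain ⟨f, hf, hl⟩ := exists_isLocalizer_bundleTrace (I := I) (F := F) (E := E) x
    have : f x • e x = 0 := congrArg (fun u : Cₛ^∞⟮I; F, E⟯ => u x) (hh f hl)
    rwa [hf, one_smul] at this

end geometry

/-! ### Cohomology classes and the conclusion -/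

section cohomology

variable {R L : Type*} [CommRing R] [Algebra ℝ R] [LieRing L] [LieAlgebra ℝ L] [Module R L]
  [LieRingModule L R] [LieRinehartRing R L] [LieRinehartAlgebra ℝ R L]

lemma sum_smul_cohomologyClass_eq_zero {ι : Type*} {k : ℕ} (s : Finset ι) (c : ι → ℝ)
    (θ : ι → Form R L k R) (hθ : ∀ i, extDer k (θ i) = 0) (h : ∑ i ∈ s, c i • θ i = 0) :
    ∑ i ∈ s, c i • cohomologyClass (θ i) (hθ i) = 0 := by
  let z : ι → closedForms R L k := fun i => ⟨θ i, hθ i⟩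
  have hz : ∑ i ∈ s, c i • z i = 0 := by
    ext1
    rw [Submodule.coe_sum]
    exact h
  have h1 := congrArg (Submodule.mkQ ((exactForms R L k).comap (closedForms R L k).subtype)) hz
  simp only [map_sum, map_smul, map_zero] at h1
  exact h1

end cohomology

section pontryagin

variable {EM : Type*} [NormedAddCommGroup EM] [NormedSpace ℝ EM] [FiniteDimensional ℝ EM]
  {H : Type*} [TopologicalSpace H] {I : ModelWithCorners ℝ EM H}
  {M : Type*} [TopologicalSpace M] [ChartedSpace H M] [IsManifold I ∞ M] [T2Space M]
  {FA : Type*} [NormedAddCommGroup FA] [NormedSpace ℝ FA] [FiniteDimensional ℝ FA]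
  {A : M → Type*} [TopologicalSpace (TotalSpace FA A)] [∀ x, TopologicalSpace (A x)]
  [∀ x, AddCommGroup (A x)] [∀ x, Module ℝ (A x)] [FiberBundle FA A] [VectorBundle ℝ FA A]
  [ContMDiffVectorBundle ∞ FA A I] [LieAlgebroid I FA A]
  {F : Type*} [NormedAddCommGroup F] [NormedSpace ℝ F] [FiniteDimensional ℝ F]
  {E : M → Type*} [TopologicalSpace (TotalSpace F E)] [∀ x, TopologicalSpace (E x)]
  [∀ x, AddCommGroup (E x)] [∀ x, Module ℝ (E x)] [FiberBundle F E] [VectorBundle ℝ F E]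
  [ContMDiffVectorBundle ∞ F E I]

lemma extDer_pontryaginForm
    (D : LinearConnection C^∞⟮I, M; ℝ⟯ Cₛ^∞⟮I; FA, A⟯ Cₛ^∞⟮I; F, E⟯) (l : ℕ) :
    extDer (2 * l) (pontryaginForm D l) = 0 :=
  LinearConnection.extDer_tracePow isLocalTrace_bundleTrace D l

/-- The class of `tr (R_∇^l)` does not depend on the connection. -/
lemma isPontryaginCharacter_cohomologyClass
    (D : LinearConnection C^∞⟮I, M; ℝ⟯ Cₛ^∞⟮I; FA, A⟯ Cₛ^∞⟮I; F, E⟯) (l : ℕ) :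
    IsPontryaginCharacter I FA A F E (l + 1)
      (cohomologyClass (pontryaginForm D (l + 1)) (extDer_pontryaginForm D (l + 1))) := by
  refine ⟨⟨D⟩, fun D' => ⟨extDer_pontryaginForm D' (l + 1), ?_⟩⟩
  refine (Submodule.Quotient.eq _).2 ?_
  obtain ⟨η, hη⟩ := LinearConnection.exists_tracePow_sub_eq D D' isLocalTrace_bundleTrace l
  -- The degree 2(l + 1) unfolds to (2l + 1) + 1, so the exact forms there are the range of the
  -- differential.
  exact ⟨η, hη.symm⟩

end pontryagin

end LieAlgd
end

theorem mainTheorem2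
    {m : ℕ} {M : Type*} [TopologicalSpace M] [T2Space M] [SecondCountableTopology M]
    [ChartedSpace (EuclideanSpace ℝ (Fin m)) M] [IsManifold (𝓡 m) ∞ M]
    {FA : Type*} [NormedAddCommGroup FA] [NormedSpace ℝ FA] [FiniteDimensional ℝ FA]
    {A : M → Type*} [TopologicalSpace (TotalSpace FA A)] [∀ x, TopologicalSpace (A x)]
    [∀ x, AddCommGroup (A x)] [∀ x, Module ℝ (A x)] [FiberBundle FA A] [VectorBundle ℝ FA A]
    [ContMDiffVectorBundle ∞ FA A (𝓡 m)] [LieAlgd.LieAlgebroid (𝓡 m) FA A]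
    {n : ℕ} {F : Fin n → Type*} [∀ i, NormedAddCommGroup (F i)] [∀ i, NormedSpace ℝ (F i)]
    [∀ i, FiniteDimensional ℝ (F i)]
    {E : Fin n → M → Type*} [∀ i, TopologicalSpace (TotalSpace (F i) (E i))]
    [∀ i x, TopologicalSpace (E i x)] [∀ i x, AddCommGroup (E i x)] [∀ i x, Module ℝ (E i x)]
    [∀ i, FiberBundle (F i) (E i)] [∀ i, VectorBundle ℝ (F i) (E i)]
    [∀ i, ContMDiffVectorBundle ∞ (F i) (E i) (𝓡 m)]
    (hrep : ∃ D : LieAlgd.HomotopyConnection C^∞⟮𝓡 m, M; ℝ⟯ Cₛ^∞⟮𝓡 m; FA, A⟯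
      (fun i => Cₛ^∞⟮𝓡 m; F i, E i⟯), D.IsRepresentation)
    (l : ℕ) (hl : 1 ≤ l) :
    ∃ σ : Fin n → LieAlgd.Cohomology C^∞⟮𝓡 m, M; ℝ⟯ Cₛ^∞⟮𝓡 m; FA, A⟯ (2 * l),
      (∀ i, LieAlgd.IsPontryaginCharacter (𝓡 m) FA A (F i) (E i) l (σ i)) ∧
      ∑ i : Fin n, (-1 : ℝ) ^ (i : ℕ) • σ i = 0 := by
  obtain ⟨D, hD⟩ := hrep
  obtain ⟨l, rfl⟩ := Nat.exists_eq_add_of_le' hl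
  refine ⟨fun i => LieAlgd.cohomologyClass (LieAlgd.pontryaginForm (D.conn i) (l + 1))
    (LieAlgd.extDer_pontryaginForm _ _),
    fun i => LieAlgd.isPontryaginCharacter_cohomologyClass _ l, ?_⟩
  -- Representing each class by the connection contained in `𝒟` makes the alternating sum zero
  -- before passing to cohomology.
  have h := D.sum_tracePow_conn (fun _ => LieAlgd.isLocalTrace_bundleTrace) hD l
  exact LieAlgd.sum_smul_cohomologyClass_eq_zero _ _ _ _ h
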